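/- Let $c_0,c_1,c_2,\dots$ be independent identically distributed real random variables with a continuous probability density $r$, with $\mathbb E c_k=0$ and $\mathbb E c_k^2=1$, and let $\varphi(s)=\int_{\mathbb R} r(t)e^{its}\,dt$ be their characteristic function. Assume that $\varphi$ is three times differentiable and that for some constants $a,A>0$ $$\left|\varphi^{(j)}(s)\right|\le\frac{A}{(1+a|s|)^6},\qquad j=0,1,2,3,\quad s\in\mathbb R .$$ Let $$f_n(x)=\sum_{k=0}^n\sqrt{\binom nk}\,c_kx^k .$$ Almost surely the two series $$g(y)=e^{-y^2/2}\sum_{k=0}^\infty\frac{y^k}{\sqrt{k!}}\,c_k,\qquad h(y)=e^{-y^2/2}\sum_{k=0}^\infty\frac{k y^{k-1}-y^{k+1}}{\sqrt{k!}}\,c_k$$ converge absolutely for all real $y$, and $h=g'$. For every $n\ge1$ let $p_n$ be the density of the distribution of real zeros of $f_n$, that is, the continuous function $p_n\ge0$ with $$\mathbb E\,\#\{x\in[\alpha,\beta]: f_n(x)=0\}=\int_\alpha^\beta p_n(x)\,dx\quad\text{for all }\alpha\le\beta;$$ it exists and is given by the Kac–Rice formula $p_n(x)=\int_{-\infty}^\infty|\eta|\,D_n(0,\eta;x)\,d\eta$,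 where $D_n(\cdot,\cdot;x)$ is the continuous joint density of $f_n(x),f_n'(x)$. Likewise let $\hat p$ be the density of the distribution of real zeros of $g$, which exists as a continuous function in the same sense and is given by $$\hat p(y)=\int_{-\infty}^\infty|\eta|\,D(0,\eta;y)\,d\eta,$$ where $D(\cdot,\cdot;y)$ is the continuous joint density of $g(y),h(y)$. Then $$\lim_{n\to\infty}\frac{p_n(y/\sqrt n)}{\sqrt n}=\hat p(y)\quad\text{uniformly in } |y|\le n^{1/8},$$ that is, $\sup_{|y|\le n^{1/8}}\left|p_n(y/\sqrt n)/\sqrt n-\hat p(y)\right|\to0$ as $n\to\infty$. In addition, $$\lim_{n\to\infty}\frac{p_n(x)}{\sqrt n}=\frac1{\pi(1+x^2)}\quad\text{uniformly in } n^{-3/8}\le|x|\le1,$$ that is, $\sup_{n^{-3/8}\le|x|\le1}\left|p_n(x)/\sqrt n-\frac1{\pi(1+x^2)}\right|\to0$ as $n\to\infty$. -/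

import Mathlib

open MeasureTheory ProbabilityTheory Filter
open scoped ENNReal

namespace RealZeros

variable {Ω : Type*} [MeasurableSpace Ω]

/-- The random polynomial `f_n(x) = ∑_{k=0}^n √(n choose k) c_k x^k`. -/
noncomputable def poly (c : ℕ → Ω → ℝ) (n : ℕ) (x : ℝ) (ω : Ω) : ℝ :=
  ∑ k ∈ Finset.range (n + 1), Real.sqrt (n.choose k) * c k ω * x ^ k

/-- Its derivative in `x`. -/
noncomputable def polyDeriv (c : ℕ → Ω → ℝ) (n : ℕ) (x : ℝ) (ω : Ω) : ℝ :=
  deriv (fun t : ℝ => poly c n t ω) x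

/-- `m_k(y) = y^k e^{-y²/2} / √(k!)`. -/
noncomputable def mWeight (k : ℕ) (y : ℝ) : ℝ :=
  y ^ k / Real.sqrt (k.factorial) * Real.exp (-y ^ 2 / 2)

/-- `l_k(y) = (k - y²) y^{k-1} e^{-y²/2} / √(k!)`. The product `(k - y²) y^{k-1}` is written
`k y^{k-1} - y^{k+1}`, which for `k = 0` is `-y`, also at `y = 0`. -/
noncomputable def lWeight (k : ℕ) (y : ℝ) : ℝ :=
  (k * y ^ (k - 1) - y ^ (k + 1)) / Real.sqrt (k.factorial) * Real.exp (-y ^ 2 / 2)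

/-- The limiting random function `g(y) = ∑_k m_k(y) c_k = e^{-y²/2} ∑_k c_k y^k / √(k!)`. -/
noncomputable def limitG (c : ℕ → Ω → ℝ) (y : ℝ) (ω : Ω) : ℝ :=
  ∑' k : ℕ, mWeight k y * c k ω

/-- `h(y) = ∑_k l_k(y) c_k`, the derivative of `g`. -/
noncomputable def limitH (c : ℕ → Ω → ℝ) (y : ℝ) (ω : Ω) : ℝ :=
  ∑' k : ℕ, lWeight k y * c k ω

/-- `D` is the (necessarily unique) continuous joint probability density of `(X, Y)`. -/
structure IsContJointDensity (P : Measure Ω) (X Y : Ω → ℝ) (D : ℝ × ℝ → ℝ) : Prop where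
  continuous : Continuous D
  nonneg : ∀ z, 0 ≤ D z
  law : P.map (fun ω => (X ω, Y ω)) =
    (volume : Measure (ℝ × ℝ)).withDensity (fun z => ENNReal.ofReal (D z))

/-- `p` is the density of the distribution of real zeros of the random function `F` with
derivative `F'`: it is continuous, the expected number of zeros of `F` in every compact interval
is the integral of `p`, and `p` is given at every point by the Kac-Rice formula, in terms of the
continuous joint density of `F(x), F'(x)`. -/
structure IsZeroDensity (P : Measure Ω) (F F' : ℝ → Ω → ℝ) (p : ℝ → ℝ) : Prop where
  continuous : Continuous p
  nonneg : ∀ x, 0 ≤ p x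
  expected_count : ∀ a b : ℝ,
    ∫⁻ ω, ((Set.encard {x : ℝ | x ∈ Set.Icc a b ∧ F x ω = 0} : ℕ∞) : ℝ≥0∞) ∂P =
      ∫⁻ x in Set.Icc a b, ENNReal.ofReal (p x)
  kac_rice : ∀ x : ℝ, ∃ D : ℝ × ℝ → ℝ, IsContJointDensity P (F x) (F' x) D ∧
    Integrable (fun η : ℝ => |η| * D (0, η)) ∧ p x = ∫ η : ℝ, |η| * D (0, η)

end RealZeros

/-! Write f(x) = c₀ + U(x), where U involves only the coefficients independent of c₀. Given those
coefficients, the one-dimensional area formula turns the expected number of zeros in K into ∫_K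
|U'(x)| r(-U(x)) dx. Hence the density of zeros is `zeroDensity`, the expectation E[|U'| r(-U)]. The
same expression results from the Kac-Rice integral once the joint density of value and derivative is
made explicit through c₀ and c₁ (`IsIidStd.isZeroDensity`). A positive factor such as e^{-y²/2} does
not move zeros, so polynomials and the limiting series are treated alike.

The limits come from two regimes, governed by v = n x² / (1+x²)² (`binVar`).

For y = x√n in a compact set, the rescaled coefficients converge to 1/√(k!) under a common bound.
Dominated convergence then gives uniform convergence on compact sets
(`IsIidStd.tendsto_zeroDensity`).

For large v, put K = ∫ (1 - cos t)/t² dt. Then K|w| = ∫ (1 - cos tw)/t² dt, and r is recovered from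
φ by Fourier inversion. This turns K E[|U'| r(-U)] into (2π)⁻¹ times a double integral of a
symmetric second difference of ∏ φ(aₖ s + bₖ t), divided by t²
(`IsIidStd.zeroDensity_eq_kacRiceInt`). A shear makes the weights orthonormal, at the cost of the
factor (1+x²)/√n. Then aₖ² are binomial probabilities with success probability x²/(1+x²), and bₖ is
aₖ times the standardized deviation of k. Large v makes all weights small, so the product tends to
e^{-(s²+t²)/2} by the central limit theorem. A bound on φ that is stable under products supplies a
majorant independent of n. The Gaussian integral is 2K, so (1+x²) pₙ(x)/√n tends to 1/π as v → ∞,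
uniformly in n and x (`IsIidStd.tendsto_normalized_zeroDensity`).

On n^{-3/8} ≤ |x| ≤ 1 one has v ≥ n^{1/4}/4, which gives the second limit. For the first, sending n
→ ∞ with y fixed shows that the limiting density is also close to 1/π for large |y|. Bounded |y| is
covered by the first regime, and for the remaining |y| ≤ n^{1/8} both densities are close to 1/π. -/

namespace RealZeros

open Set Topology

/-! ### Area formula and measurability of the number of zeros -/

section

/-- The noncritical points of a continuously differentiable function decompose into countably many
measurable pieces on which the function is injective. -/
lemma exists_injOn_pieces {f f' : ℝ → ℝ} (hf : ∀ x, HasDerivAt f (f' x) x)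
    (hf' : Continuous f') :
    ∃ D : ℕ → Set ℝ, (∀ n, MeasurableSet (D n)) ∧ Pairwise (Function.onFun Disjoint D) ∧
      (∀ n, InjOn f (D n)) ∧ ⋃ n, D n = {x | f' x ≠ 0} := by
  classical
  -- On an interval without critical points Rolle's theorem forces injectivity; rational endpoints
  -- keep the family countable.
  let J : ℚ × ℚ → Set ℝ := fun i =>
    if (∀ x ∈ Ioo (i.1 : ℝ) (i.2 : ℝ), f' x ≠ 0) then Ioo (i.1 : ℝ) i.2 else ∅
  have hJm : ∀ i, MeasurableSet (J i) := by
    intro i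
    by_cases h : ∀ x ∈ Ioo (i.1 : ℝ) i.2, f' x ≠ 0
    · have hJ : J i = Ioo (i.1 : ℝ) i.2 := by simp only [J]; rw [if_pos h]
      rw [hJ]; exact measurableSet_Ioo
    · have hJ : J i = ∅ := by simp only [J]; rw [if_neg h]
      rw [hJ]; exact MeasurableSet.empty
  have hJi : ∀ i, InjOn f (J i) := by
    intro i
    by_cases h : ∀ x ∈ Ioo (i.1 : ℝ) i.2, f' x ≠ 0
    · have hJ : J i = Ioo (i.1 : ℝ) i.2 := by simp only [J]; rw [if_pos h]
      rw [hJ]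
      intro x hx y hy hxy
      by_contra hne
      wlog hlt : x < y generalizing x y
      · exact this hy hx hxy.symm (Ne.symm hne) (lt_of_le_of_ne (not_lt.mp hlt) (Ne.symm hne))
      obtain ⟨z, hz, hz'⟩ := exists_hasDerivAt_eq_zero hlt
        (fun w _ => (hf w).continuousAt.continuousWithinAt) hxy (fun w _ => hf w)
      exact h z ⟨hx.1.trans hz.1, hz.2.trans hy.2⟩ hz'
    · have hJ : J i = ∅ := by simp only [J]; rw [if_neg h]
      rw [hJ]; exact injOn_empty f
  have hJU : ⋃ i, J i = {x | f' x ≠ 0} := by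
    ext x
    simp only [mem_iUnion, mem_ofPred_eq]
    constructor
    · rintro ⟨i, hi⟩
      by_cases h : ∀ x ∈ Ioo (i.1 : ℝ) i.2, f' x ≠ 0
      · simp only [J] at hi; rw [if_pos h] at hi; exact h x hi
      · simp only [J] at hi; rw [if_neg h] at hi; exact hi.elim
    · intro hx
      have hnh : {x | f' x ≠ 0} ∈ 𝓝 x := (isOpen_ne_fun hf' continuous_const).mem_nhds hx
      obtain ⟨l, u, hlu, hsub⟩ := mem_nhds_iff_exists_Ioo_subset.1 hnh
      obtain ⟨p, hp1, hp2⟩ := exists_rat_btwn hlu.1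
      obtain ⟨q, hq1, hq2⟩ := exists_rat_btwn hlu.2
      refine ⟨(p, q), ?_⟩
      have h : ∀ x ∈ Ioo (p : ℝ) q, f' x ≠ 0 := fun z hz =>
        hsub ⟨hp1.trans hz.1, hz.2.trans hq2⟩
      simp only [J]; rw [if_pos h]; exact ⟨hp2, hq1⟩
  obtain ⟨e, he⟩ := exists_surjective_nat (ℚ × ℚ)
  refine ⟨disjointed (fun n => J (e n)), fun n => MeasurableSet.disjointed (fun n => hJm _) n,
    disjoint_disjointed _, fun n => (hJi (e n)).mono (disjointed_subset _ n), ?_⟩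
  rw [iUnion_disjointed, ← hJU]
  exact he.iUnion_comp J

/-- The area formula in dimension one, with multiplicities. -/
theorem lintegral_encard_fiber {f f' : ℝ → ℝ} (hf : ∀ x, HasDerivAt f (f' x) x)
    (hf' : Continuous f') {g : ℝ → ℝ≥0∞} (hg : Measurable g) {s : Set ℝ}
    (hs : MeasurableSet s) :
    ∫⁻ t, (({x | x ∈ s ∧ f x = t}.encard : ℕ∞) : ℝ≥0∞) * g t =
      ∫⁻ x in s, ENNReal.ofReal |f' x| * g (f x) := by
  obtain ⟨D, hDm, hDd, hDi, hDU⟩ := exists_injOn_pieces hf hf'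
  have hfc : Continuous f := continuous_iff_continuousAt.2 fun x => (hf x).continuousAt
  -- Sard's theorem in dimension one: critical values are null and may be ignored on the left-hand
  -- side.
  have hnull : volume (f '' {x | f' x = 0}) = 0 := by
    refine addHaar_image_eq_zero_of_det_fderivWithin_eq_zero volume
      (f' := fun x => ContinuousLinearMap.toSpanSingleton ℝ (f' x))
      (fun x _ => (hf x).hasFDerivAt.hasFDerivWithinAt) ?_
    intro x hx
    rw [ContinuousLinearMap.det_toSpanSingleton]
    exact hx
  have himg : ∀ n, MeasurableSet (f '' (s ∩ D n)) := fun n =>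
    (hs.inter (hDm n)).image_of_continuousOn_injOn hfc.continuousOn
      ((hDi n).mono inter_subset_right)
  -- At a regular value each piece contains at most one preimage, so counting preimages is counting
  -- the pieces whose image contains t. Counting measure supplies the countable additivity.
  have hcount : ∀ t, t ∉ f '' {x | f' x = 0} →
      (({x | x ∈ s ∧ f x = t}.encard : ℕ∞) : ℝ≥0∞) =
        ∑' n, (f '' (s ∩ D n)).indicator (fun _ => (1 : ℝ≥0∞)) t := by
    intro t ht
    have hm : ∀ n, MeasurableSet {x | x ∈ s ∩ D n ∧ f x = t} := fun n =>
      (hs.inter (hDm n)).inter (hfc.measurable (measurableSet_singleton t))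
    have hset : {x | x ∈ s ∧ f x = t} = ⋃ n, {x | x ∈ s ∩ D n ∧ f x = t} := by
      ext x
      simp only [mem_ofPred_eq, mem_iUnion, mem_inter_iff]
      constructor
      · rintro ⟨h1, h2⟩
        have : x ∈ ⋃ n, D n := by
          rw [hDU]; exact fun h => ht ⟨x, h, h2⟩
        obtain ⟨n, hn⟩ := mem_iUnion.1 this
        exact ⟨n, ⟨h1, hn⟩, h2⟩
      · rintro ⟨n, ⟨h1, _⟩, h2⟩
        exact ⟨h1, h2⟩
    have hms : MeasurableSet {x | x ∈ s ∧ f x = t} :=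
      hs.inter (hfc.measurable (measurableSet_singleton t))
    rw [← Measure.count_apply hms, hset, measure_iUnion _ hm]
    · congr 1
      ext n
      rw [Measure.count_apply (hm n)]
      by_cases h : t ∈ f '' (s ∩ D n)
      · rw [indicator_of_mem h]
        obtain ⟨x, hx, hxt⟩ := h
        have : {x | x ∈ s ∩ D n ∧ f x = t} = {x} := by
          ext z
          simp only [mem_ofPred_eq, mem_singleton_iff]
          constructor
          · rintro ⟨hz, hzt⟩
            exact hDi n hz.2 hx.2 (hzt.trans hxt.symm)
          · rintro rfl
            exact ⟨hx, hxt⟩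
        rw [this, encard_singleton]
        simp
      · rw [indicator_of_notMem h]
        have : {x | x ∈ s ∩ D n ∧ f x = t} = ∅ := by
          ext z
          simp only [mem_ofPred_eq, mem_empty_iff_false, iff_false]
          rintro ⟨hz, hzt⟩
          exact h ⟨z, hz, hzt⟩
        rw [this, encard_empty]
        simp
    · intro i j hij
      exact (hDd hij).mono (fun x hx => hx.1.2) (fun x hx => hx.1.2)
  have hae : ∀ᵐ t, (({x | x ∈ s ∧ f x = t}.encard : ℕ∞) : ℝ≥0∞) * g t =
      ∑' n, (f '' (s ∩ D n)).indicator g t := by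
    have : ∀ᵐ t, t ∉ f '' {x | f' x = 0} := measure_eq_zero_iff_ae_notMem.1 hnull
    filter_upwards [this] with t ht
    rw [hcount t ht, ← ENNReal.tsum_mul_right]
    congr 1
    ext n
    by_cases h : t ∈ f '' (s ∩ D n) <;> simp [h]
  rw [lintegral_congr_ae hae, lintegral_tsum fun n => (hg.indicator (himg n)).aemeasurable]
  have hpiece : ∀ n, ∫⁻ t, (f '' (s ∩ D n)).indicator g t =
      ∫⁻ x in s ∩ D n, ENNReal.ofReal |f' x| * g (f x) := fun n => by
    rw [lintegral_indicator (himg n)]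
    exact lintegral_image_eq_lintegral_abs_deriv_mul (hs.inter (hDm n))
      (fun x _ => (hf x).hasDerivWithinAt) ((hDi n).mono inter_subset_right) g
  simp_rw [hpiece]
  rw [← lintegral_iUnion (fun n => hs.inter (hDm n))
    (fun i j hij => (hDd hij).mono inter_subset_right inter_subset_right), ← inter_iUnion, hDU,
    ← lintegral_inter_add_sdiff (μ := volume) _ s (B := {x | f' x ≠ 0})
      (hf'.measurable (measurableSet_singleton 0)).compl]
  have hms : MeasurableSet (s \ {x | f' x ≠ 0}) :=
    hs.diff (hf'.measurable (measurableSet_singleton 0)).compl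
  -- Critical points also contribute nothing on the right, since the Jacobian factor vanishes there.
  have : ∫⁻ x in s \ {x | f' x ≠ 0}, ENNReal.ofReal |f' x| * g (f x) = 0 := by
    rw [setLIntegral_congr_fun (g := fun _ => 0) hms, lintegral_zero]
    intro x hx
    have : f' x = 0 := by simpa using hx.2
    simp [this]
  rw [this, add_zero]

variable {Θ : Type*} [MeasurableSpace Θ]

/-- The event that a continuous random function vanishes somewhere on a compact set. -/
lemma measurableSet_exists_zero {Φ : ℝ → Θ → ℝ} (hc : ∀ θ, Continuous fun x => Φ x θ)
    (hm : ∀ x, Measurable (Φ x)) {K : Set ℝ} (hK : IsCompact K) :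
    MeasurableSet {θ | ∃ x ∈ K, Φ x θ = 0} := by
  obtain ⟨D, hDK, hDc, hD⟩ := (TopologicalSpace.IsSeparable.of_separableSpace
    K).exists_countable_dense_subset
  -- By compactness |Φ| attains its minimum on K, so a zero exists exactly when |Φ| is arbitrarily
  -- small on a countable dense subset.
  have : {θ | ∃ x ∈ K, Φ x θ = 0} = ⋂ n : ℕ, ⋃ x ∈ D, {θ | |Φ x θ| < 1 / ((n : ℝ) + 1)} := by
    ext θ
    simp only [mem_ofPred_eq, mem_iInter, mem_iUnion]
    constructor
    · rintro ⟨x, hx, h0⟩ n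
      have hopen : IsOpen {x | |Φ x θ| < 1 / ((n : ℝ) + 1)} :=
        isOpen_lt (hc θ).abs continuous_const
      have hxm : x ∈ {x | |Φ x θ| < 1 / ((n : ℝ) + 1)} := by
        simp only [mem_ofPred_eq, h0, abs_zero]; positivity
      obtain ⟨y, hy1, hy2⟩ := mem_closure_iff.1 (hD hx) _ hopen hxm
      exact ⟨y, hy2, hy1⟩
    · intro h
      obtain ⟨x0, hx0, _⟩ := h 0
      obtain ⟨x, hx, hmin⟩ := hK.exists_isMinOn ⟨x0, hDK hx0⟩ (hc θ).abs.continuousOn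
      refine ⟨x, hx, ?_⟩
      by_contra hne
      obtain ⟨n, hn⟩ := exists_nat_one_div_lt (abs_pos.2 hne)
      obtain ⟨y, hy, hyn⟩ := h n
      have : |Φ x θ| ≤ |Φ y θ| := hmin (hDK hy)
      linarith
  rw [this]
  exact MeasurableSet.iInter fun n => MeasurableSet.biUnion hDc fun x _ =>
    measurableSet_lt (hm x).abs measurable_const

/-- The number of zeros of a continuous random function in a compact set is measurable. -/
lemma measurable_encard_zeros {Φ : ℝ → Θ → ℝ} (hc : ∀ θ, Continuous fun x => Φ x θ)
    (hm : ∀ x, Measurable (Φ x)) {K : Set ℝ} (hK : IsCompact K) :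
    Measurable fun θ => (({x | x ∈ K ∧ Φ x θ = 0}.encard : ℕ∞) : ℝ≥0∞) := by
  -- There are at least m zeros exactly when m disjoint closed rational intervals each contain one.
  -- This is a countable union of finite intersections of measurable events.
  have key : ∀ m : ℕ, {θ | (m : ℕ∞) ≤ {x | x ∈ K ∧ Φ x θ = 0}.encard} =
      ⋃ p : {p : Fin m → ℚ × ℚ // Pairwise (Function.onFun Disjoint
          fun i => Icc ((p i).1 : ℝ) (p i).2)},
        ⋂ i, {θ | ∃ x ∈ K ∩ Icc ((p.1 i).1 : ℝ) (p.1 i).2, Φ x θ = 0} := by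
    intro m
    ext θ
    simp only [mem_ofPred_eq, mem_iUnion, mem_iInter]
    constructor
    · intro h
      obtain ⟨t, hts, htc⟩ := exists_subset_encard_eq h
      have htf : t.Finite := finite_of_encard_eq_coe htc
      obtain ⟨W, hW, hWd⟩ := htf.t2_separation
      have hcard : Nat.card t = m := by
        have := htf.cast_ncard_eq
        rw [htc] at this
        rw [Nat.card_coe_set_eq]; exact_mod_cast this
      have := htf.to_subtype
      let e : Fin m ≃ t := (finCongr hcard.symm).trans (Finite.equivFin t).symm
      have hex : ∀ i : Fin m, ∃ p : ℚ × ℚ, (e i : ℝ) ∈ Icc (p.1 : ℝ) p.2 ∧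
          Icc (p.1 : ℝ) p.2 ⊆ W (e i) := by
        intro i
        obtain ⟨l, u, hlu, hsub⟩ := mem_nhds_iff_exists_Ioo_subset.1
          ((hW (e i)).2.mem_nhds (hW (e i)).1)
        obtain ⟨p, hp1, hp2⟩ := exists_rat_btwn hlu.1
        obtain ⟨q, hq1, hq2⟩ := exists_rat_btwn hlu.2
        exact ⟨(p, q), ⟨hp2.le, hq1.le⟩, fun z hz => hsub ⟨hp1.trans_le hz.1, hz.2.trans_lt hq2⟩⟩
      choose p hp1 hp2 using hex
      refine ⟨⟨p, ?_⟩, fun i => ⟨e i, ⟨(hts (e i).2).1, hp1 i⟩, (hts (e i).2).2⟩⟩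
      intro i j hij
      refine (hWd (e i).2 (e j).2 ?_).mono (hp2 i) (hp2 j)
      exact fun h => hij (e.injective (Subtype.ext h))
    · rintro ⟨⟨p, hp⟩, h⟩
      choose x hx hx0 using h
      have hinj : Function.Injective x := by
        intro i j hij
        by_contra hne
        exact (Set.disjoint_left.1 (hp hne)) (hx i).2 (by rw [hij]; exact (hx j).2)
      calc (m : ℕ∞) = (range x).encard := by
            rw [← image_univ, hinj.encard_image]; simp
        _ ≤ _ := encard_le_encard (by rintro _ ⟨i, rfl⟩; exact ⟨(hx i).1, hx0 i⟩)
  have hms : ∀ m : ℕ, MeasurableSet {θ | (m : ℕ∞) ≤ {x | x ∈ K ∧ Φ x θ = 0}.encard} := by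
    intro m
    rw [key m]
    exact MeasurableSet.iUnion fun p => MeasurableSet.iInter fun i =>
      measurableSet_exists_zero hc hm (hK.inter_right isClosed_Icc)
  have hN : Measurable fun θ => ({x | x ∈ K ∧ Φ x θ = 0}.encard : ℕ∞) := by
    refine measurable_to_countable' fun b => ?_
    induction b using ENat.recTopCoe with
    | coe m =>
      have : (fun θ => ({x | x ∈ K ∧ Φ x θ = 0}.encard : ℕ∞)) ⁻¹' {(m : ℕ∞)} =
          {θ | (m : ℕ∞) ≤ {x | x ∈ K ∧ Φ x θ = 0}.encard} \
            {θ | ((m + 1 : ℕ) : ℕ∞) ≤ {x | x ∈ K ∧ Φ x θ = 0}.encard} := by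
        ext θ
        simp only [mem_preimage, mem_singleton_iff, Set.mem_sdiff, mem_ofPred_eq, not_le]
        push_cast
        rw [ENat.lt_add_one_iff (ENat.natCast_ne_top m), le_antisymm_iff, and_comm]
      rw [this]
      exact (hms m).diff (hms _)
    | top =>
      have : (fun θ => ({x | x ∈ K ∧ Φ x θ = 0}.encard : ℕ∞)) ⁻¹' {⊤} =
          ⋂ m : ℕ, {θ | (m : ℕ∞) ≤ {x | x ∈ K ∧ Φ x θ = 0}.encard} := by
        ext θ
        simp only [mem_preimage, mem_singleton_iff, mem_iInter, mem_ofPred_eq]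
        exact ENat.eq_top_iff_forall_ge
      rw [this]
      exact MeasurableSet.iInter hms
  exact (measurable_from_top (f := fun n : ℕ∞ => (n : ℝ≥0∞))).comp hN

end

/-! ### Joint densities and zero counts by integrating out c₀ and c₁ -/

section

section Independence

variable {Ω Ξ : Type*} [MeasurableSpace Ω] [MeasurableSpace Ξ] {P : Measure Ω}
  [IsProbabilityMeasure P] {r : ℝ → ℝ}

/-- Integrating out a random variable with density `r` that is independent of `ξ`. -/
lemma lintegral_indep_density {X : Ω → ℝ} {ξ : Ω → Ξ} (hX : Measurable X) (hξ : Measurable ξ)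
    (hr : Continuous r)
    (hlaw : P.map X = volume.withDensity (fun t => ENNReal.ofReal (r t)))
    (hind : IndepFun X ξ P) {f : ℝ × Ξ → ℝ≥0∞} (hf : Measurable f) :
    ∫⁻ ω, f (X ω, ξ ω) ∂P = ∫⁻ ω, (∫⁻ t, ENNReal.ofReal (r t) * f (t, ξ ω)) ∂P := by
  have hrm : Measurable fun t => ENNReal.ofReal (r t) := hr.measurable.ennreal_ofReal
  have h1 : ∫⁻ ω, f (X ω, ξ ω) ∂P = ∫⁻ z, f z ∂(P.map fun ω => (X ω, ξ ω)) :=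
    (lintegral_map hf (hX.prodMk hξ)).symm
  have := Measure.isProbabilityMeasure_map (μ := P) hX.aemeasurable
  have := Measure.isProbabilityMeasure_map (μ := P) hξ.aemeasurable
  rw [h1, (indepFun_iff_map_prod_eq_prod_map_map hX.aemeasurable hξ.aemeasurable).1 hind,
    lintegral_prod_symm' _ hf, lintegral_map hf.lintegral_prod_left' hξ, hlaw]
  refine lintegral_congr fun ω => ?_
  exact lintegral_withDensity_eq_lintegral_mul _ hrm
    (g := fun t => f (t, ξ ω)) (hf.comp (measurable_id.prodMk measurable_const))

end Independence

lemma lintegral_comp_affine {f : ℝ → ℝ≥0∞} (hf : Measurable f) {a : ℝ} (ha : a ≠ 0) (b : ℝ) :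
    ∫⁻ t, f (a * t + b) = ENNReal.ofReal |a⁻¹| * ∫⁻ t, f t := by
  have h1 : ∫⁻ t, f (a * t + b) = ∫⁻ t, f (t + b) ∂(Measure.map (a * ·) volume) :=
    (lintegral_map (hf.comp (measurable_id.add_const b)) (measurable_const_mul a)).symm
  rw [h1, Real.map_volume_mul_left ha, lintegral_smul_measure, lintegral_add_right_eq_self]
  rfl

/-- The joint density of `e (c₀ + β c₁ + y)` and `e' (c₀ + β c₁ + y) + e (δ c₁ + z)` for
independent `c₀`, `c₁` with density `r`. -/
noncomputable def affineDensity (r : ℝ → ℝ) (e e' β δ : ℝ) (z w : ℝ × ℝ) : ℝ :=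
  1 / (e ^ 2 * |δ|) * (r (z.1 / e - β * (((z.2 - e' * z.1 / e) / e - w.2) / δ) - w.1) *
    r (((z.2 - e' * z.1 / e) / e - w.2) / δ))

section affineDensity

variable {r : ℝ → ℝ} {M : ℝ} {e e' β δ : ℝ}

lemma continuous_affineDensity (hr : Continuous r) (e e' β δ : ℝ) :
    Continuous fun q : (ℝ × ℝ) × (ℝ × ℝ) => affineDensity r e e' β δ q.1 q.2 := by
  unfold affineDensity
  simp only [div_eq_mul_inv]
  fun_prop

lemma affineDensity_nonneg (hr0 : ∀ t, 0 ≤ r t) (e e' β δ : ℝ) (z w : ℝ × ℝ) :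
    0 ≤ affineDensity r e e' β δ z w := by
  unfold affineDensity
  have := hr0 (z.1 / e - β * (((z.2 - e' * z.1 / e) / e - w.2) / δ) - w.1)
  have := hr0 (((z.2 - e' * z.1 / e) / e - w.2) / δ)
  positivity

lemma affineDensity_le (hr0 : ∀ t, 0 ≤ r t) (hrM : ∀ t, r t ≤ M) (e e' β δ : ℝ)
    (z w : ℝ × ℝ) : affineDensity r e e' β δ z w ≤ 1 / (e ^ 2 * |δ|) * (M * M) := by
  unfold affineDensity
  have h0 : 0 ≤ M := (hr0 0).trans (hrM 0)
  gcongr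
  · exact hr0 _
  · exact hrM _
  · exact hrM _

/-- The planar change of variables is triangular. It is done as two affine substitutions on the
line, with t₀ replaced by u at fixed t₁ (factor 1/e) and then t₁ by v at fixed u (factor 1/(e|δ|)).
-/
lemma lintegral_affineDensity (hr : Continuous r) (hr0 : ∀ t, 0 ≤ r t) (he : 0 < e)
    (hδ : δ ≠ 0) {f : ℝ × ℝ → ℝ≥0∞} (hf : Measurable f) (w : ℝ × ℝ) :
    ∫⁻ t₁, ENNReal.ofReal (r t₁) * ∫⁻ t₀, ENNReal.ofReal (r t₀) *
        f (e * (t₀ + β * t₁ + w.1), e' * (t₀ + β * t₁ + w.1) + e * (δ * t₁ + w.2)) =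
      ∫⁻ z, ENNReal.ofReal (affineDensity r e e' β δ z w) * f z := by
  have hrm : Measurable r := hr.measurable
  have he0 : e ≠ 0 := he.ne'
  have step1 : ∀ t₁, ∫⁻ t₀, ENNReal.ofReal (r t₀) *
        f (e * (t₀ + β * t₁ + w.1), e' * (t₀ + β * t₁ + w.1) + e * (δ * t₁ + w.2)) =
      ENNReal.ofReal |e⁻¹| * ∫⁻ u, ENNReal.ofReal (r (u / e - β * t₁ - w.1)) *
        f (u, e' * u / e + e * (δ * t₁ + w.2)) := by
    intro t₁
    rw [← lintegral_comp_affine (f := fun u => ENNReal.ofReal (r (u / e - β * t₁ - w.1)) *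
        f (u, e' * u / e + e * (δ * t₁ + w.2))) (by fun_prop) he0 (e * (β * t₁ + w.1))]
    congr 1
    ext t₀
    have e1 : (e * t₀ + e * (β * t₁ + w.1)) / e - β * t₁ - w.1 = t₀ := by
      field_simp; ring
    have e2 : e * t₀ + e * (β * t₁ + w.1) = e * (t₀ + β * t₁ + w.1) := by ring
    have e3 : e' * (e * t₀ + e * (β * t₁ + w.1)) / e = e' * (t₀ + β * t₁ + w.1) := by
      field_simp; ring
    rw [e1, e3, e2]
  simp_rw [step1]
  have hm : Measurable fun q : ℝ × ℝ => ENNReal.ofReal (r q.1) * (ENNReal.ofReal |e⁻¹| *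
      (ENNReal.ofReal (r (q.2 / e - β * q.1 - w.1)) *
        f (q.2, e' * q.2 / e + e * (δ * q.1 + w.2)))) := by fun_prop
  have step2 : ∀ t₁, ENNReal.ofReal (r t₁) * (ENNReal.ofReal |e⁻¹| *
      ∫⁻ u, ENNReal.ofReal (r (u / e - β * t₁ - w.1)) *
        f (u, e' * u / e + e * (δ * t₁ + w.2))) =
      ∫⁻ u, ENNReal.ofReal (r t₁) * (ENNReal.ofReal |e⁻¹| *
        (ENNReal.ofReal (r (u / e - β * t₁ - w.1)) *
        f (u, e' * u / e + e * (δ * t₁ + w.2)))) := by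
    intro t₁
    rw [lintegral_const_mul _ (by fun_prop), lintegral_const_mul _ (by fun_prop)]
  simp_rw [step2]
  rw [lintegral_lintegral_swap hm.aemeasurable]
  have hm2 : Measurable fun z : ℝ × ℝ => ENNReal.ofReal (affineDensity r e e' β δ z w) * f z := by
    refine Measurable.mul (Measurable.ennreal_ofReal ?_) hf
    exact ((continuous_affineDensity hr e e' β δ).comp
      (continuous_id.prodMk continuous_const)).measurable
  rw [Measure.volume_eq_prod, lintegral_prod _ hm2.aemeasurable]
  congr 1
  ext u
  have hne : e * δ ≠ 0 := mul_ne_zero he0 hδ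
  have hpos : 0 < |e * δ| := abs_pos.2 hne
  have key : ∀ I : ℝ≥0∞, ENNReal.ofReal |e * δ| * (ENNReal.ofReal |(e * δ)⁻¹| * I) = I := by
    intro I
    rw [← mul_assoc, ← ENNReal.ofReal_mul hpos.le, abs_inv, mul_inv_cancel₀ hpos.ne',
      ENNReal.ofReal_one, one_mul]
  rw [← key (∫⁻ v, ENNReal.ofReal (affineDensity r e e' β δ (u, v) w) * f (u, v)),
    ← lintegral_comp_affine (f := fun v => ENNReal.ofReal (affineDensity r e e' β δ (u, v) w) *
      f (u, v)) (hm2.comp (measurable_const.prodMk measurable_id)) hne (e * w.2 + e' * u / e),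
    ← lintegral_const_mul]
  · congr 1
    ext t₁
    have e1 : ((e * δ * t₁ + (e * w.2 + e' * u / e) - e' * u / e) / e - w.2) / δ = t₁ := by
      field_simp; ring
    have e2 : e * δ * t₁ + (e * w.2 + e' * u / e) = e' * u / e + e * (δ * t₁ + w.2) := by ring
    simp only [affineDensity]
    rw [e1, e2, ← mul_assoc, ← mul_assoc, ← mul_assoc,
      ← ENNReal.ofReal_mul (hr0 _), ← ENNReal.ofReal_mul (mul_nonneg (hr0 _) (abs_nonneg _)),
      ← ENNReal.ofReal_mul (abs_nonneg _)]
    congr 2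
    rw [abs_inv, abs_mul, abs_of_pos he]
    have := abs_pos.2 hδ
    field_simp
  · exact (hm2.comp (measurable_const.prodMk measurable_id)).comp (by fun_prop)

end affineDensity

section JointDensity

variable {Ω : Type*} [MeasurableSpace Ω] {P : Measure Ω} [IsProbabilityMeasure P] {r : ℝ → ℝ}
  {M e e' β δ : ℝ} {c₀ c₁ : Ω → ℝ} {W : Ω → ℝ × ℝ}

lemma continuous_integral_affineDensity (hr : Continuous r) (hr0 : ∀ t, 0 ≤ r t)
    (hrM : ∀ t, r t ≤ M) (hW : Measurable W) :
    Continuous fun z => ∫ ω, affineDensity r e e' β δ z (W ω) ∂P := by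
  refine continuous_of_dominated (bound := fun _ => 1 / (e ^ 2 * |δ|) * (M * M)) ?_ ?_
    (integrable_const _) ?_
  · intro z
    exact (((continuous_affineDensity hr e e' β δ).comp
      (continuous_const.prodMk continuous_id)).measurable.comp hW).aestronglyMeasurable
  · intro z
    refine ae_of_all _ fun ω => ?_
    rw [Real.norm_of_nonneg (affineDensity_nonneg hr0 _ _ _ _ _ _)]
    exact affineDensity_le hr0 hrM _ _ _ _ _ _
  · refine ae_of_all _ fun ω => ?_
    exact (continuous_affineDensity hr e e' β δ).comp (continuous_id.prodMk continuous_const)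

lemma ofReal_integral_affineDensity (hr : Continuous r) (hr0 : ∀ t, 0 ≤ r t)
    (hrM : ∀ t, r t ≤ M) (hW : Measurable W) (z : ℝ × ℝ) :
    ENNReal.ofReal (∫ ω, affineDensity r e e' β δ z (W ω) ∂P) =
      ∫⁻ ω, ENNReal.ofReal (affineDensity r e e' β δ z (W ω)) ∂P := by
  refine ofReal_integral_eq_lintegral_ofReal ?_
    (ae_of_all _ fun ω => affineDensity_nonneg hr0 _ _ _ _ _ _)
  refine Integrable.of_bound (C := 1 / (e ^ 2 * |δ|) * (M * M)) ?_ (ae_of_all _ fun ω => ?_)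
  · exact (((continuous_affineDensity hr e e' β δ).comp
      (continuous_const.prodMk continuous_id)).measurable.comp hW).aestronglyMeasurable
  · rw [Real.norm_of_nonneg (affineDensity_nonneg hr0 _ _ _ _ _ _)]
    exact affineDensity_le hr0 hrM _ _ _ _ _ _

/-- The continuous joint density of a random variable and its derivative. -/
theorem isContJointDensity_affine (hr : Continuous r) (hr0 : ∀ t, 0 ≤ r t)
    (hrM : ∀ t, r t ≤ M) (he : 0 < e) (hδ : δ ≠ 0)
    (hc₀ : Measurable c₀) (hc₁ : Measurable c₁) (hW : Measurable W)
    (hlaw₀ : P.map c₀ = volume.withDensity (fun t => ENNReal.ofReal (r t)))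
    (hlaw₁ : P.map c₁ = volume.withDensity (fun t => ENNReal.ofReal (r t)))
    (hind₀ : IndepFun c₀ (fun ω => (c₁ ω, W ω)) P) (hind₁ : IndepFun c₁ W P) :
    IsContJointDensity P (fun ω => e * (c₀ ω + β * c₁ ω + (W ω).1))
      (fun ω => e' * (c₀ ω + β * c₁ ω + (W ω).1) + e * (δ * c₁ ω + (W ω).2))
      (fun z => ∫ ω, affineDensity r e e' β δ z (W ω) ∂P) where
  continuous := continuous_integral_affineDensity hr hr0 hrM hW
  nonneg z := integral_nonneg fun ω => affineDensity_nonneg hr0 _ _ _ _ _ _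
  law := by
    have hrm : Measurable r := hr.measurable
    refine Measure.ext_of_lintegral _ fun f hf => ?_
    rw [lintegral_map hf (by fun_prop)]
    have hD : Measurable fun z => ENNReal.ofReal (∫ ω, affineDensity r e e' β δ z (W ω) ∂P) :=
      (continuous_integral_affineDensity hr hr0 hrM hW).measurable.ennreal_ofReal
    rw [lintegral_withDensity_eq_lintegral_mul _ hD hf]
    have h0 := lintegral_indep_density (P := P) hc₀ (hc₁.prodMk hW) hr hlaw₀ hind₀
      (f := fun q : ℝ × (ℝ × (ℝ × ℝ)) => f (e * (q.1 + β * q.2.1 + q.2.2.1),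
        e' * (q.1 + β * q.2.1 + q.2.2.1) + e * (δ * q.2.1 + q.2.2.2))) (by fun_prop)
    refine h0.trans ?_
    have h1 := lintegral_indep_density (P := P) hc₁ hW hr hlaw₁ hind₁
      (f := fun q : ℝ × (ℝ × ℝ) => ∫⁻ t, ENNReal.ofReal (r t) *
        f (e * (t + β * q.1 + q.2.1),
        e' * (t + β * q.1 + q.2.1) + e * (δ * q.1 + q.2.2)))
        (Measurable.lintegral_prod_right' (f := fun s : (ℝ × (ℝ × ℝ)) × ℝ =>
          ENNReal.ofReal (r s.2) * f (e * (s.2 + β * s.1.1 + s.1.2.1),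
            e' * (s.2 + β * s.1.1 + s.1.2.1) + e * (δ * s.1.1 + s.1.2.2))) (by fun_prop))
    refine h1.trans ?_
    simp_rw [lintegral_affineDensity hr hr0 he hδ hf]
    have hK : Measurable fun q : Ω × (ℝ × ℝ) =>
        ENNReal.ofReal (affineDensity r e e' β δ q.2 (W q.1)) * f q.2 :=
      (((continuous_affineDensity hr e e' β δ).measurable.comp
        (measurable_snd.prodMk (hW.comp measurable_fst))).ennreal_ofReal).mul
        (hf.comp measurable_snd)
    rw [lintegral_lintegral_swap hK.aemeasurable]
    congr 1
    ext z
    rw [Pi.mul_apply, ofReal_integral_affineDensity hr hr0 hrM hW, lintegral_mul_const]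
    exact ((continuous_affineDensity hr e e' β δ).measurable.comp
        (measurable_const.prodMk hW)).ennreal_ofReal

/-- The Kac-Rice integral of the joint density as an expectation. -/
theorem lintegral_abs_mul_affineDensity (hr : Continuous r) (hr0 : ∀ t, 0 ≤ r t)
    (hrM : ∀ t, r t ≤ M) (he : 0 < e) (hδ : δ ≠ 0) (hc₁ : Measurable c₁) (hW : Measurable W)
    (hlaw₁ : P.map c₁ = volume.withDensity (fun t => ENNReal.ofReal (r t)))
    (hind₁ : IndepFun c₁ W P) :
    ∫⁻ η, ENNReal.ofReal (|η| * ∫ ω, affineDensity r e e' β δ (0, η) (W ω) ∂P) =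
      ∫⁻ ω, ENNReal.ofReal (|δ * c₁ ω + (W ω).2| * r (-(β * c₁ ω + (W ω).1))) ∂P := by
  have hrm : Measurable r := hr.measurable
  have hAm : Measurable fun q : Ω × ℝ => affineDensity r e e' β δ (0, q.2) (W q.1) :=
    (continuous_affineDensity hr e e' β δ).measurable.comp
        ((measurable_const.prodMk measurable_snd).prodMk (hW.comp measurable_fst))
  have hpt : ∀ η, ENNReal.ofReal (|η| * ∫ ω, affineDensity r e e' β δ (0, η) (W ω) ∂P) =
      ∫⁻ ω, ENNReal.ofReal (|η| * affineDensity r e e' β δ (0, η) (W ω)) ∂P := by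
    intro η
    rw [ENNReal.ofReal_mul (abs_nonneg _), ofReal_integral_affineDensity hr hr0 hrM hW,
      ← lintegral_const_mul]
    · simp_rw [ENNReal.ofReal_mul (abs_nonneg η)]
    · exact (hAm.comp (measurable_id.prodMk measurable_const)).ennreal_ofReal
  simp_rw [hpt]
  have hK : Measurable fun q : ℝ × Ω =>
      ENNReal.ofReal (|q.1| * affineDensity r e e' β δ (0, q.1) (W q.2)) :=
    (measurable_fst.abs.mul (hAm.comp measurable_swap)).ennreal_ofReal
  rw [lintegral_lintegral_swap hK.aemeasurable,
    lintegral_indep_density (P := P) hc₁ hW hr hlaw₁ hind₁ (f := fun q : ℝ × (ℝ × ℝ) =>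
      ENNReal.ofReal (|δ * q.1 + q.2.2| * r (-(β * q.1 + q.2.1)))) (by fun_prop)]
  congr 1
  ext ω
  have he0 : e ≠ 0 := he.ne'
  have hne : e * δ ≠ 0 := mul_ne_zero he0 hδ
  have hpos : 0 < |e * δ| := abs_pos.2 hne
  have key : ∀ I : ℝ≥0∞, ENNReal.ofReal |e * δ| * (ENNReal.ofReal |(e * δ)⁻¹| * I) = I := by
    intro I
    rw [← mul_assoc, ← ENNReal.ofReal_mul hpos.le, abs_inv, mul_inv_cancel₀ hpos.ne',
      ENNReal.ofReal_one, one_mul]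
  have hg : Measurable fun η =>
      ENNReal.ofReal (|η| * affineDensity r e e' β δ (0, η) (W ω)) :=
    hK.comp (measurable_id.prodMk measurable_const)
  rw [← key (∫⁻ η, ENNReal.ofReal (|η| * affineDensity r e e' β δ (0, η) (W ω))),
    ← lintegral_comp_affine hg hne (e * (W ω).2), ← lintegral_const_mul]
  swap
  · exact hg.comp (f := fun t => e * δ * t + e * (W ω).2) (by fun_prop)
  congr 1
  ext t
  -- On the line where the value is zero, the terms with e' drop out and the powers of e cancel. The
  -- Kac-Rice integral therefore does not see the positive normalizing factor.
  have e1 : ((e * δ * t + e * (W ω).2 - e' * 0 / e) / e - (W ω).2) / δ = t := by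
    field_simp; ring
  have e2 : (0 : ℝ) / e - β * t - (W ω).1 = -(β * t + (W ω).1) := by ring
  have e3 : |e * δ * t + e * (W ω).2| = e * |δ * t + (W ω).2| := by
    rw [show e * δ * t + e * (W ω).2 = e * (δ * t + (W ω).2) by ring, abs_mul, abs_of_pos he]
  simp only [affineDensity]
  rw [e1, e2, e3, ← ENNReal.ofReal_mul (abs_nonneg _), ← ENNReal.ofReal_mul (hr0 _), abs_mul,
    abs_of_pos he]
  congr 1
  have := abs_pos.2 hδ
  field_simp

end JointDensity

section ZeroCount

variable {Ω Ξ : Type*} [MeasurableSpace Ω] [MeasurableSpace Ξ] {P : Measure Ω}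
  [IsProbabilityMeasure P] {r : ℝ → ℝ}

/-- The expected number of zeros of `c₀ + U`, where `c₀` is independent of `U`. -/
theorem lintegral_encard_zeros (hr : Continuous r)
    {c₀ : Ω → ℝ} {ξ : Ω → Ξ} (hc₀ : Measurable c₀) (hξ : Measurable ξ)
    (hlaw : P.map c₀ = volume.withDensity (fun t => ENNReal.ofReal (r t)))
    (hind : IndepFun c₀ ξ P) {U V : ℝ → Ξ → ℝ} (hU : ∀ x, Measurable (U x))
    (hV : ∀ x, Measurable (V x)) (hUV : ∀ x θ, HasDerivAt (fun t => U t θ) (V x θ) x)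
    (hVc : ∀ θ, Continuous fun x => V x θ) {K : Set ℝ} (hK : IsCompact K) :
    ∫⁻ ω, (({x | x ∈ K ∧ c₀ ω + U x (ξ ω) = 0}.encard : ℕ∞) : ℝ≥0∞) ∂P =
      ∫⁻ x in K, ∫⁻ ω, ENNReal.ofReal (|V x (ξ ω)| * r (-U x (ξ ω))) ∂P := by
  have hrm : Measurable r := hr.measurable
  have hUc : ∀ θ, Continuous fun x => U x θ := fun θ =>
    continuous_iff_continuousAt.2 fun x => (hUV x θ).continuousAt
  have hN : Measurable fun q : ℝ × Ξ =>
      (({x | x ∈ K ∧ q.1 + U x q.2 = 0}.encard : ℕ∞) : ℝ≥0∞) :=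
    measurable_encard_zeros (Φ := fun x (q : ℝ × Ξ) => q.1 + U x q.2)
      (fun q => continuous_const.add (hUc q.2))
      (fun x => measurable_fst.add ((hU x).comp measurable_snd)) hK
  rw [lintegral_indep_density hc₀ hξ hr hlaw hind hN]
  -- For frozen ξ, a zero of t + U is a point where -U takes the value t. The area formula for -U
  -- with weight r applies.
  have hinner : ∀ ω, ∫⁻ t, ENNReal.ofReal (r t) *
      (({x | x ∈ K ∧ t + U x (ξ ω) = 0}.encard : ℕ∞) : ℝ≥0∞) =
      ∫⁻ x in K, ENNReal.ofReal (|V x (ξ ω)| * r (-U x (ξ ω))) := by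
    intro ω
    have := lintegral_encard_fiber (f := fun x => -U x (ξ ω)) (fun x => (hUV x (ξ ω)).neg)
      (hVc (ξ ω)).neg (g := fun t => ENNReal.ofReal (r t)) hrm.ennreal_ofReal hK.measurableSet
    simp only [abs_neg] at this
    simp_rw [ENNReal.ofReal_mul (abs_nonneg _)]
    rw [← this]
    congr 1
    ext t
    rw [mul_comm]
    have : {x | x ∈ K ∧ t + U x (ξ ω) = 0} = {x | x ∈ K ∧ -U x (ξ ω) = t} := by
      ext x
      simp only [mem_ofPred_eq]
      refine and_congr_right fun _ => ?_
      constructor <;> intro h <;> linarith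
    rw [this]
  simp_rw [hinner]
  refine lintegral_lintegral_swap ?_
  have hUm := measurable_uncurry_of_continuous_of_measurable hUc hU
  have hVm := measurable_uncurry_of_continuous_of_measurable hVc hV
  have hsw : Measurable fun q : Ω × ℝ => (q.2, ξ q.1) :=
    measurable_snd.prodMk (hξ.comp measurable_fst)
  exact (((hVm.comp hsw).abs.mul (hrm.comp (hUm.comp hsw).neg)).ennreal_ofReal).aemeasurable

end ZeroCount

end

/-! ### Power series with coefficients of controlled growth -/

section

/-- A sequence of at most exponential growth, in a summed form. -/
def Tame (ζ : ℕ → ℝ) : Prop := Summable fun k => |ζ k| * (1 / 2 : ℝ) ^ k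

/-- The power series with coefficients `α k * ζ k`. -/
noncomputable def ser (α : ℕ → ℝ) (x : ℝ) (ζ : ℕ → ℝ) : ℝ := ∑' k, α k * x ^ k * ζ k

/-- The formal derivative of `ser`. -/
noncomputable def serDeriv (α : ℕ → ℝ) (x : ℝ) (ζ : ℕ → ℝ) : ℝ :=
  ∑' k, α k * (k * x ^ (k - 1)) * ζ k

/-- Entire growth of order two of the coefficients. -/
def CoeffBound (L : ℝ) (α : ℕ → ℝ) : Prop :=
  ∀ k, |α k| ≤ L ^ k / Real.sqrt (k.factorial)

lemma pow_div_sqrt_factorial_le {z : ℝ} (hz : 0 ≤ z) (k : ℕ) :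
    z ^ k / Real.sqrt (k.factorial) ≤ Real.exp (z ^ 2 / 2) := by
  have hf : (0 : ℝ) < k.factorial := by exact_mod_cast k.factorial_pos
  have h := Real.pow_div_factorial_le_exp (z ^ 2) (by positivity) k
  have h2 : z ^ k / Real.sqrt (k.factorial) = Real.sqrt ((z ^ 2) ^ k / k.factorial) := by
    rw [Real.sqrt_div (by positivity), ← pow_mul, mul_comm, pow_mul,
      Real.sqrt_sq (by positivity)]
  rw [h2, Real.exp_half]
  exact Real.sqrt_le_sqrt h

/-- In the constant 4 one factor 2 absorbs k ≤ 2^k, and the other pays for the geometric factor that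
is matched with `Tame`. -/
lemma coeff_mul_le {L R : ℝ} (hL : 0 ≤ L) (hR : 1 ≤ R) {α : ℕ → ℝ} (hα : CoeffBound L α)
    (k : ℕ) : |α k| * (k * R ^ k) ≤ Real.exp ((4 * L * R) ^ 2 / 2) * (1 / 2) ^ k := by
  have hR0 : 0 ≤ R := by linarith
  have hs : 0 < Real.sqrt (k.factorial) := Real.sqrt_pos.2 (by exact_mod_cast k.factorial_pos)
  have hk : (k : ℝ) ≤ 2 ^ k := by exact_mod_cast Nat.lt_two_pow_self.le
  have h := pow_div_sqrt_factorial_le (z := 4 * L * R) (by positivity) k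
  calc |α k| * (k * R ^ k) ≤ (L ^ k / Real.sqrt (k.factorial)) * (2 ^ k * R ^ k) := by
        gcongr; exact hα k
    _ = (4 * L * R) ^ k / Real.sqrt (k.factorial) * (1 / 2) ^ k := by
        rw [show (4 * L * R) = 2 * (2 * (L * R)) by ring, mul_pow 2, mul_pow 2, mul_pow L, one_div,
          inv_pow]
        field_simp
    _ ≤ _ := by gcongr

/-- The common majorant of the coefficients for `|x| ≤ R`. -/
noncomputable def majorant (L R : ℝ) : ℝ := 2 * Real.exp ((4 * L * R) ^ 2 / 2)

lemma majorant_nonneg (L R : ℝ) : 0 ≤ majorant L R := by unfold majorant; positivity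

lemma serDeriv_coeff_le {L R : ℝ} (hL : 0 ≤ L) (hR : 1 ≤ R) {α : ℕ → ℝ} (hα : CoeffBound L α)
    {x : ℝ} (hx : |x| ≤ R) (k : ℕ) :
    |α k * (k * x ^ (k - 1))| ≤ majorant L R * (1 / 2) ^ k := by
  have hR0 : 0 ≤ R := by linarith
  rw [abs_mul, abs_mul, abs_pow, Nat.abs_cast]
  have h1 : |x| ^ (k - 1) ≤ R ^ k :=
    (pow_le_pow_left₀ (abs_nonneg x) hx _).trans (pow_le_pow_right₀ hR (Nat.sub_le k 1))
  calc |α k| * (k * |x| ^ (k - 1)) ≤ |α k| * (k * R ^ k) := by gcongr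
    _ ≤ Real.exp ((4 * L * R) ^ 2 / 2) * (1 / 2) ^ k := coeff_mul_le hL hR hα k
    _ ≤ _ := by
      unfold majorant
      have : 0 ≤ Real.exp ((4 * L * R) ^ 2 / 2) * (1 / 2) ^ k := by positivity
      linarith

lemma ser_coeff_le {L R : ℝ} (hL : 0 ≤ L) (hR : 1 ≤ R) {α : ℕ → ℝ} (hα : CoeffBound L α)
    {x : ℝ} (hx : |x| ≤ R) (k : ℕ) :
    |α k * x ^ k| ≤ majorant L R * (1 / 2) ^ k := by
  have hR0 : 0 ≤ R := by linarith
  rw [abs_mul, abs_pow]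
  -- The constant term is separate because the factor k in `coeff_mul_le` vanishes there.
  rcases Nat.eq_zero_or_pos k with rfl | hk
  · have := hα 0
    simp only [pow_zero, Nat.factorial_zero, Nat.cast_one, Real.sqrt_one, div_one] at this
    have h2 : 1 ≤ Real.exp ((4 * L * R) ^ 2 / 2) := Real.one_le_exp (by positivity)
    simp only [pow_zero, mul_one, majorant]
    linarith
  · have hk1 : (1 : ℝ) ≤ k := by exact_mod_cast hk
    calc |α k| * |x| ^ k ≤ |α k| * (1 * R ^ k) := by rw [one_mul]; gcongr
      _ ≤ |α k| * (k * R ^ k) := by gcongr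
      _ ≤ Real.exp ((4 * L * R) ^ 2 / 2) * (1 / 2) ^ k := coeff_mul_le hL hR hα k
      _ ≤ _ := by
        unfold majorant
        have : 0 ≤ Real.exp ((4 * L * R) ^ 2 / 2) * (1 / 2) ^ k := by positivity
        linarith

lemma abs_mul_le_of_coeff {B a z : ℝ} {k : ℕ} (h : |a| ≤ B * (1 / 2) ^ k) :
    ‖a * z‖ ≤ B * (|z| * (1 / 2) ^ k) := by
  rw [Real.norm_eq_abs, abs_mul]
  calc |a| * |z| ≤ (B * (1 / 2) ^ k) * |z| := by gcongr
    _ = _ := by ring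

section Deterministic

variable {L : ℝ} {α : ℕ → ℝ} {ζ : ℕ → ℝ}

lemma summable_ser (hL : 0 ≤ L) (hα : CoeffBound L α) (hζ : Tame ζ) (x : ℝ) :
    Summable fun k => α k * x ^ k * ζ k :=
  Summable.of_norm_bounded (Summable.mul_left (majorant L (max 1 |x|)) hζ) fun k =>
    abs_mul_le_of_coeff (ser_coeff_le hL (le_max_left _ _) hα (le_max_right _ _) k)

lemma summable_serDeriv (hL : 0 ≤ L) (hα : CoeffBound L α) (hζ : Tame ζ) (x : ℝ) :
    Summable fun k => α k * (k * x ^ (k - 1)) * ζ k :=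
  Summable.of_norm_bounded (Summable.mul_left (majorant L (max 1 |x|)) hζ) fun k =>
    abs_mul_le_of_coeff (serDeriv_coeff_le hL (le_max_left _ _) hα (le_max_right _ _) k)

lemma hasDerivAt_ser (hL : 0 ≤ L) (hα : CoeffBound L α) (hζ : Tame ζ) (x : ℝ) :
    HasDerivAt (fun t => ser α t ζ) (serDeriv α x ζ) x := by
  have hR : 1 ≤ |x| + 1 := by linarith [abs_nonneg x]
  have hx : x ∈ Metric.ball (0 : ℝ) (|x| + 1) := by simp
  refine hasDerivAt_tsum_of_isPreconnected
    (u := fun k => majorant L (|x| + 1) * (|ζ k| * (1 / 2 : ℝ) ^ k))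
    (g := fun k t => α k * t ^ k * ζ k) (g' := fun k t => α k * (k * t ^ (k - 1)) * ζ k)
    (Summable.mul_left _ hζ) (t := Metric.ball 0 (|x| + 1)) Metric.isOpen_ball
    (convex_ball _ _).isPreconnected (y₀ := x) ?_ ?_ hx (summable_ser hL hα hζ x) hx
  · intro k y _
    exact ((hasDerivAt_pow k y).const_mul (α k)).mul_const (ζ k)
  · intro k y hy
    refine abs_mul_le_of_coeff (serDeriv_coeff_le hL hR hα ?_ k)
    have : |y| < |x| + 1 := by simpa using hy
    exact this.le

lemma abs_serDeriv_le (hL : 0 ≤ L) (hα : CoeffBound L α) (hζ : Tame ζ) {R x : ℝ} (hR : 1 ≤ R)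
    (hx : |x| ≤ R) : |serDeriv α x ζ| ≤ majorant L R * ∑' k, |ζ k| * (1 / 2 : ℝ) ^ k :=
  tsum_of_norm_bounded (hζ.hasSum.mul_left _) fun k =>
    abs_mul_le_of_coeff (serDeriv_coeff_le hL hR hα hx k)

variable {ι : Type*} {l : Filter ι} {αs : ι → ℕ → ℝ} {xs : ι → ℝ} {x : ℝ}

lemma eventually_abs_le (hx : Tendsto xs l (𝓝 x)) : ∀ᶠ i in l, |xs i| ≤ |x| + 1 := by
  have := (hx.abs).eventually (gt_mem_nhds (show |x| < |x| + 1 by linarith))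
  filter_upwards [this] with i hi using hi.le

lemma tendsto_ser (hL : 0 ≤ L) (hαs : ∀ i, CoeffBound L (αs i))
    (hlim : ∀ k, Tendsto (fun i => αs i k) l (𝓝 (α k))) (hx : Tendsto xs l (𝓝 x))
    (hζ : Tame ζ) : Tendsto (fun i => ser (αs i) (xs i) ζ) l (𝓝 (ser α x ζ)) := by
  have hR : 1 ≤ |x| + 1 := by linarith [abs_nonneg x]
  refine tendsto_tsum_of_dominated_convergence (Summable.mul_left (majorant L (|x| + 1)) hζ)
    (fun k => ((hlim k).mul (hx.pow k)).mul_const _) ?_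
  filter_upwards [eventually_abs_le hx] with i hi k
  exact abs_mul_le_of_coeff (ser_coeff_le hL hR (hαs i) hi k)

lemma tendsto_serDeriv (hL : 0 ≤ L) (hαs : ∀ i, CoeffBound L (αs i))
    (hlim : ∀ k, Tendsto (fun i => αs i k) l (𝓝 (α k))) (hx : Tendsto xs l (𝓝 x))
    (hζ : Tame ζ) : Tendsto (fun i => serDeriv (αs i) (xs i) ζ) l (𝓝 (serDeriv α x ζ)) := by
  have hR : 1 ≤ |x| + 1 := by linarith [abs_nonneg x]
  refine tendsto_tsum_of_dominated_convergence (Summable.mul_left (majorant L (|x| + 1)) hζ)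
    (fun k => ((hlim k).mul ((hx.pow (k - 1)).const_mul _)).mul_const _) ?_
  filter_upwards [eventually_abs_le hx] with i hi k
  exact abs_mul_le_of_coeff (serDeriv_coeff_le hL hR (hαs i) hi k)

end Deterministic

/-- Drop the first `m` terms of a sequence. -/
def zeroBelow (m : ℕ) (ζ : ℕ → ℝ) : ℕ → ℝ := fun k => if k < m then 0 else ζ k

lemma measurable_zeroBelow (m : ℕ) : Measurable (zeroBelow m) := by
  refine measurable_pi_lambda _ fun k => ?_
  by_cases h : k < m
  · simp [zeroBelow, h]
  · simpa [zeroBelow, h] using measurable_pi_apply k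

lemma abs_zeroBelow_le (m : ℕ) (ζ : ℕ → ℝ) (k : ℕ) : |zeroBelow m ζ k| ≤ |ζ k| := by
  by_cases h : k < m <;> simp [zeroBelow, h]

lemma Tame.zeroBelow {ζ : ℕ → ℝ} (hζ : Tame ζ) (m : ℕ) : Tame (zeroBelow m ζ) :=
  Summable.of_nonneg_of_le (fun k => by positivity)
    (fun k => mul_le_mul_of_nonneg_right (abs_zeroBelow_le m ζ k) (by positivity)) hζ

lemma tsum_zeroBelow_succ {a ζ : ℕ → ℝ} (m : ℕ)
    (h : Summable fun k => a k * zeroBelow m ζ k) :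
    ∑' k, a k * zeroBelow m ζ k = a m * ζ m + ∑' k, a k * zeroBelow (m + 1) ζ k := by
  rw [h.tsum_eq_add_tsum_ite m]
  congr 1
  · simp [zeroBelow]
  · refine tsum_congr fun k => ?_
    by_cases hk : k = m
    · simp [hk, zeroBelow]
    · have : k < m + 1 ↔ k < m := by omega
      simp [hk, zeroBelow, this]

open Classical in
/-- Replace sequences that are not tame by zero. -/
noncomputable def tameOrZero (ζ : ℕ → ℝ) : ℕ → ℝ := if Tame ζ then ζ else 0

lemma tame_tameOrZero (ζ : ℕ → ℝ) : Tame (tameOrZero ζ) := by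
  unfold tameOrZero
  split_ifs with h
  · exact h
  · simp [Tame]

lemma Tame.tameOrZero_eq {ζ : ℕ → ℝ} (hζ : Tame ζ) : tameOrZero ζ = ζ := if_pos hζ

lemma tame_iff_tsum_ne_top (ζ : ℕ → ℝ) :
    Tame ζ ↔ ∑' k, ENNReal.ofReal (|ζ k| * (1 / 2 : ℝ) ^ k) ≠ ⊤ := by
  have h0 : ∀ k, 0 ≤ |ζ k| * (1 / 2 : ℝ) ^ k := fun k => by positivity
  constructor
  · intro h
    rw [← ENNReal.ofReal_tsum_of_nonneg h0 h]
    exact ENNReal.ofReal_ne_top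
  · intro h
    have := ENNReal.summable_toReal h
    simp only [ENNReal.toReal_ofReal (h0 _)] at this
    exact this

lemma measurable_tsum_ofReal : Measurable fun ζ : ℕ → ℝ =>
    ∑' k, ENNReal.ofReal (|ζ k| * (1 / 2 : ℝ) ^ k) :=
  Measurable.tsum fun k =>
    (((measurable_pi_apply k).abs).mul_const _).ennreal_ofReal

lemma measurable_tameOrZero : Measurable tameOrZero := by
  classical
  have : MeasurableSet {ζ : ℕ → ℝ | Tame ζ} := by
    simp_rw [tame_iff_tsum_ne_top]
    exact (measurable_tsum_ofReal (measurableSet_singleton ⊤)).compl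
  exact Measurable.ite this measurable_id measurable_const

lemma measurable_ser (α : ℕ → ℝ) (x : ℝ) : Measurable (ser α x) :=
  Measurable.tsum fun k => (measurable_pi_apply k).const_mul _

lemma measurable_serDeriv (α : ℕ → ℝ) (x : ℝ) : Measurable (serDeriv α x) :=
  Measurable.tsum fun k => (measurable_pi_apply k).const_mul _

end

/-! ### Density of zeros of a random power series -/

section

variable {Ω : Type*} [MeasurableSpace Ω]

/-- Independent standardized random variables with a common continuous density. -/
structure IsIidStd (P : Measure Ω) (c : ℕ → Ω → ℝ) (r : ℝ → ℝ) : Prop where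
  meas : ∀ k, Measurable (c k)
  indep : iIndepFun c P
  cont : Continuous r
  nonneg : ∀ t, 0 ≤ r t
  law : ∀ k, P.map (c k) = volume.withDensity (fun t => ENNReal.ofReal (r t))
  mean : ∀ k, ∫ ω, c k ω ∂P = 0
  var : ∀ k, ∫ ω, (c k ω) ^ 2 ∂P = 1

/-- The density of zeros of a random power series with leading coefficient `c 0`. -/
noncomputable def zeroDensity (P : Measure Ω) (c : ℕ → Ω → ℝ) (r : ℝ → ℝ) (α : ℕ → ℝ) (x : ℝ) :
    ℝ :=
  ∫ ω, |serDeriv α x (zeroBelow 1 (c · ω))| * r (-ser α x (zeroBelow 1 (c · ω))) ∂P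

namespace IsIidStd

variable {P : Measure Ω} [IsProbabilityMeasure P] {c : ℕ → Ω → ℝ} {r : ℝ → ℝ}

lemma integrable_sq (h : IsIidStd P c r) (k : ℕ) : Integrable (fun ω => (c k ω) ^ 2) P := by
  by_contra hn
  have := h.var k
  rw [integral_undef hn] at this
  exact zero_ne_one this

lemma memLp (h : IsIidStd P c r) (k : ℕ) : MemLp (c k) 2 P :=
  (memLp_two_iff_integrable_sq (h.meas k).aestronglyMeasurable).2 (h.integrable_sq k)

lemma lintegral_abs_le (h : IsIidStd P c r) (k : ℕ) :
    ∫⁻ ω, ENNReal.ofReal |c k ω| ∂P ≤ 2 := by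
  have h1 : Integrable (fun ω => 1 + (c k ω) ^ 2) P := (integrable_const 1).add (h.integrable_sq k)
  calc ∫⁻ ω, ENNReal.ofReal |c k ω| ∂P ≤ ∫⁻ ω, ENNReal.ofReal (1 + (c k ω) ^ 2) ∂P := by
        refine lintegral_mono fun ω => ENNReal.ofReal_le_ofReal ?_
        rw [← sq_abs]
        nlinarith [sq_nonneg (|c k ω| - 1), abs_nonneg (c k ω)]
    _ = ENNReal.ofReal (∫ ω, (1 + (c k ω) ^ 2) ∂P) :=
        (ofReal_integral_eq_lintegral_ofReal h1 (ae_of_all _ fun ω => by positivity)).symm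
    _ = 2 := by
        rw [integral_add (integrable_const 1) (h.integrable_sq k), h.var k]
        norm_num

lemma measurable_seq (h : IsIidStd P c r) : Measurable fun ω => (c · ω) :=
  measurable_pi_lambda _ h.meas

/-- The first absolute moments are uniformly bounded, so ∑ E|cₖ| 2^{-k} converges. This one fact
yields both almost sure tameness and the integrable majorant used in every dominated convergence
over Ω. -/
lemma lintegral_tsum_ne_top (h : IsIidStd P c r) :
    ∫⁻ ω, ∑' k, ENNReal.ofReal (|c k ω| * (1 / 2 : ℝ) ^ k) ∂P ≠ ⊤ := by
  rw [lintegral_tsum fun k => ((h.meas k).abs.mul_const _).ennreal_ofReal.aemeasurable]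
  have hle : ∀ k, ∫⁻ ω, ENNReal.ofReal (|c k ω| * (1 / 2 : ℝ) ^ k) ∂P ≤
      ENNReal.ofReal (2 * (1 / 2 : ℝ) ^ k) := by
    intro k
    simp_rw [ENNReal.ofReal_mul (abs_nonneg _)]
    rw [lintegral_mul_const _ (h.meas k).abs.ennreal_ofReal, ENNReal.ofReal_mul zero_le_two]
    gcongr
    simpa using h.lintegral_abs_le k
  refine ne_top_of_le_ne_top ?_ (ENNReal.tsum_le_tsum hle)
  rw [← ENNReal.ofReal_tsum_of_nonneg (fun k => by positivity)
    (summable_geometric_two.mul_left 2)]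
  exact ENNReal.ofReal_ne_top

lemma ae_tame (h : IsIidStd P c r) : ∀ᵐ ω ∂P, Tame (c · ω) := by
  have := ae_lt_top (measurable_tsum_ofReal.comp h.measurable_seq) h.lintegral_tsum_ne_top
  filter_upwards [this] with ω hω
  exact (tame_iff_tsum_ne_top _).2 hω.ne

lemma integrable_tsum (h : IsIidStd P c r) :
    Integrable (fun ω => ∑' k, |c k ω| * (1 / 2 : ℝ) ^ k) P := by
  have := integrable_toReal_of_lintegral_ne_top
    (measurable_tsum_ofReal.comp h.measurable_seq).aemeasurable h.lintegral_tsum_ne_top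
  refine this.congr ?_
  filter_upwards [h.ae_tame] with ω hω
  have h0 : ∀ k, 0 ≤ |c k ω| * (1 / 2 : ℝ) ^ k := fun k => by positivity
  simp only [Function.comp]
  rw [← ENNReal.ofReal_tsum_of_nonneg h0 hω, ENNReal.toReal_ofReal (tsum_nonneg h0)]

lemma indepFun_zeroBelow (h : IsIidStd P c r) (m : ℕ) :
    IndepFun (c m) (fun ω => zeroBelow (m + 1) (c · ω)) P := by
  rw [IndepFun_iff_Indep]
  have hi := indep_iSup_of_disjoint (m := fun i => MeasurableSpace.comap (c i) inferInstance)
    (fun i => (h.meas i).comap_le) h.indep.iIndep (S := {m}) (T := {i | m < i}) (by simp)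
  refine indep_of_indep_of_le_right (indep_of_indep_of_le_left hi ?_) ?_
  · simp
  · rw [← measurable_iff_comap_le]
    refine @measurable_pi_lambda _ _ _ (_) _ _ fun k => ?_
    by_cases hk : k < m + 1
    · simp only [zeroBelow, hk, if_true]
      exact measurable_const
    · simp only [zeroBelow, hk, if_false]
      have hk' : k ∈ {i | m < i} := by simp only [mem_ofPred_eq]; omega
      rw [measurable_iff_comap_le]
      exact le_iSup₂_of_le (f := fun i (_ : i ∈ {i | m < i}) =>
        MeasurableSpace.comap (c i) inferInstance) k hk' le_rfl

variable {L M : ℝ} {α : ℕ → ℝ}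

lemma norm_integrand_le (h : IsIidStd P c r) (hM : ∀ t, r t ≤ M) (hL : 0 ≤ L)
    (hα : CoeffBound L α) {x R : ℝ} (hR : 1 ≤ R) (hx : |x| ≤ R) {ω : Ω} (hω : Tame (c · ω)) :
    ‖|serDeriv α x (zeroBelow 1 (c · ω))| * r (-ser α x (zeroBelow 1 (c · ω)))‖ ≤
      majorant L R * (∑' k, |c k ω| * (1 / 2 : ℝ) ^ k) * M := by
  rw [Real.norm_of_nonneg (mul_nonneg (abs_nonneg _) (h.nonneg _))]
  have h1 := abs_serDeriv_le hL hα (hω.zeroBelow 1) hR hx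
  have h2 : ∑' k, |zeroBelow 1 (c · ω) k| * (1 / 2 : ℝ) ^ k ≤
      ∑' k, |c k ω| * (1 / 2 : ℝ) ^ k :=
    Summable.tsum_le_tsum (fun k => mul_le_mul_of_nonneg_right (abs_zeroBelow_le 1 _ k)
      (by positivity)) (hω.zeroBelow 1) hω
  refine mul_le_mul (h1.trans ?_) (hM _) (h.nonneg _)
    (mul_nonneg (majorant_nonneg _ _) (tsum_nonneg fun k => by positivity))
  exact mul_le_mul_of_nonneg_left h2 (majorant_nonneg _ _)

lemma measurable_integrand (h : IsIidStd P c r) (α : ℕ → ℝ) (x : ℝ) :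
    Measurable fun ω => |serDeriv α x (zeroBelow 1 (c · ω))| *
      r (-ser α x (zeroBelow 1 (c · ω))) := by
  have hz := (measurable_zeroBelow 1).comp h.measurable_seq
  exact ((measurable_serDeriv α x).comp hz).abs.mul
    (h.cont.measurable.comp ((measurable_ser α x).comp hz).neg)

lemma integrable_integrand (h : IsIidStd P c r) (hM : ∀ t, r t ≤ M) (hL : 0 ≤ L)
    (hα : CoeffBound L α) (x : ℝ) :
    Integrable (fun ω => |serDeriv α x (zeroBelow 1 (c · ω))| *
      r (-ser α x (zeroBelow 1 (c · ω)))) P := by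
  refine ((h.integrable_tsum.const_mul (majorant L (max 1 |x|))).mul_const M).mono'
    (h.measurable_integrand α x).aestronglyMeasurable ?_
  filter_upwards [h.ae_tame] with ω hω
  exact h.norm_integrand_le hM hL hα (le_max_left _ _) (le_max_right _ _) hω

/-- Joint continuity of the density of zeros in the coefficients and in the point. -/
theorem tendsto_zeroDensity (h : IsIidStd P c r) (hM : ∀ t, r t ≤ M) (hL : 0 ≤ L)
    {ι : Type*} {l : Filter ι} [l.IsCountablyGenerated] {αs : ι → ℕ → ℝ} {xs : ι → ℝ} {x : ℝ}
    (hαs : ∀ i, CoeffBound L (αs i))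
    (hlim : ∀ k, Tendsto (fun i => αs i k) l (𝓝 (α k))) (hx : Tendsto xs l (𝓝 x)) :
    Tendsto (fun i => zeroDensity P c r (αs i) (xs i)) l (𝓝 (zeroDensity P c r α x)) := by
  have hR : 1 ≤ |x| + 1 := by linarith [abs_nonneg x]
  refine tendsto_integral_filter_of_dominated_convergence
    (fun ω => majorant L (|x| + 1) * (∑' k, |c k ω| * (1 / 2 : ℝ) ^ k) * M) ?_ ?_
    ((h.integrable_tsum.const_mul _).mul_const M) ?_
  · exact Eventually.of_forall fun i => (h.measurable_integrand _ _).aestronglyMeasurable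
  · filter_upwards [eventually_abs_le hx] with i hi
    filter_upwards [h.ae_tame] with ω hω
    exact h.norm_integrand_le hM hL (hαs i) hR hi hω
  · filter_upwards [h.ae_tame] with ω hω
    exact (tendsto_serDeriv hL hαs hlim hx (hω.zeroBelow 1)).abs.mul
      ((h.cont.tendsto _).comp (tendsto_ser hL hαs hlim hx (hω.zeroBelow 1)).neg)

lemma continuous_zeroDensity (h : IsIidStd P c r) (hM : ∀ t, r t ≤ M) (hL : 0 ≤ L)
    (hα : CoeffBound L α) : Continuous (zeroDensity P c r α) :=
  continuous_iff_continuousAt.2 fun _ => h.tendsto_zeroDensity hM hL (fun _ => hα)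
    (fun _ => tendsto_const_nhds) tendsto_id

lemma zeroDensity_nonneg (h : IsIidStd P c r) (x : ℝ) : 0 ≤ zeroDensity P c r α x :=
  integral_nonneg fun _ => mul_nonneg (abs_nonneg _) (h.nonneg _)

lemma ser_eq_add (hL : 0 ≤ L) (hα : CoeffBound L α) {ζ : ℕ → ℝ} (hζ : Tame ζ) (m : ℕ) (x : ℝ) :
    ser α x (zeroBelow m ζ) = α m * x ^ m * ζ m + ser α x (zeroBelow (m + 1) ζ) :=
  tsum_zeroBelow_succ (a := fun k => α k * x ^ k) m (summable_ser hL hα (hζ.zeroBelow m) x)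

lemma serDeriv_eq_add (hL : 0 ≤ L) (hα : CoeffBound L α) {ζ : ℕ → ℝ} (hζ : Tame ζ) (m : ℕ)
    (x : ℝ) : serDeriv α x (zeroBelow m ζ) =
      α m * (m * x ^ (m - 1)) * ζ m + serDeriv α x (zeroBelow (m + 1) ζ) :=
  tsum_zeroBelow_succ (a := fun k => α k * (k * x ^ (k - 1))) m
    (summable_serDeriv hL hα (hζ.zeroBelow m) x)

lemma zeroBelow_zero (ζ : ℕ → ℝ) : zeroBelow 0 ζ = ζ := by ext k; simp [zeroBelow]

/-- A random power series, up to a positive factor, has a density of zeros. -/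
theorem isZeroDensity (h : IsIidStd P c r) (hM : ∀ t, r t ≤ M) (hL : 0 ≤ L)
    (hα : CoeffBound L α) (hα0 : α 0 = 1) (hα1 : α 1 ≠ 0) {F F' : ℝ → Ω → ℝ} {e e' : ℝ → ℝ}
    (he : ∀ x, 0 < e x) (hF : ∀ᵐ ω ∂P, ∀ x, F x ω = e x * ser α x (c · ω))
    (hF' : ∀ᵐ ω ∂P, ∀ x, F' x ω = e' x * ser α x (c · ω) + e x * serDeriv α x (c · ω)) :
    IsZeroDensity P F F' (zeroDensity P c r α) where
  continuous := h.continuous_zeroDensity hM hL hα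
  nonneg := h.zeroDensity_nonneg
  expected_count := by
    intro a b
    have hz : Measurable fun ω => zeroBelow 1 (c · ω) :=
      (measurable_zeroBelow 1).comp h.measurable_seq
    have key := lintegral_encard_zeros (P := P) h.cont (h.meas 0) hz (h.law 0)
      -- The area formula needs differentiability for every sample sequence, not just almost every
      -- one; `tameOrZero` repairs the exceptional null set.
      (h.indepFun_zeroBelow 0) (U := fun x ζ => ser α x (tameOrZero ζ))
      (V := fun x ζ => serDeriv α x (tameOrZero ζ))
      (fun x => (measurable_ser α x).comp measurable_tameOrZero)
      (fun x => (measurable_serDeriv α x).comp measurable_tameOrZero)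
      (fun x ζ => hasDerivAt_ser hL hα (tame_tameOrZero ζ) x)
      (fun ζ => continuous_iff_continuousAt.2 fun x => tendsto_serDeriv hL (fun _ => hα)
        (fun _ => tendsto_const_nhds) tendsto_id (tame_tameOrZero ζ)) (isCompact_Icc (a := a) (b := b))
    calc _ = _ := lintegral_congr_ae ?_
      _ = _ := key
      _ = _ := lintegral_congr fun x => ?_
    · filter_upwards [h.ae_tame, hF] with ω hω hFω
      congr 3
      ext x
      refine and_congr_right fun _ => ?_
      have h0 := ser_eq_add hL hα hω 0 x
      rw [zeroBelow_zero] at h0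
      rw [hFω, (hω.zeroBelow 1).tameOrZero_eq, h0, mul_eq_zero, or_iff_right (he x).ne', hα0]
      simp
    · rw [zeroDensity, ofReal_integral_eq_lintegral_ofReal (h.integrable_integrand hM hL hα x)
        (ae_of_all _ fun ω => mul_nonneg (abs_nonneg _) (h.nonneg _))]
      refine lintegral_congr_ae ?_
      filter_upwards [h.ae_tame] with ω hω
      rw [(hω.zeroBelow 1).tameOrZero_eq]
  kac_rice := by
    intro x
    let w : (ℕ → ℝ) → ℝ × ℝ := fun ζ => (ser α x (zeroBelow 2 ζ), serDeriv α x (zeroBelow 2 ζ))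
    have hw : Measurable w := ((measurable_ser α x).comp (measurable_zeroBelow 2)).prodMk
      ((measurable_serDeriv α x).comp (measurable_zeroBelow 2))
    -- The remainder depends only on indices at least 2. It can thus be read as a function of the
    -- tail independent of c₀ or of c₁.
    have hw2 : ∀ m, m ≤ 2 → ∀ ζ, w (zeroBelow m ζ) = w ζ := by
      intro m hm ζ
      have : zeroBelow 2 (zeroBelow m ζ) = zeroBelow 2 ζ := by
        ext k
        by_cases hk : k < 2
        · simp [zeroBelow, hk]
        · simp [zeroBelow, hk, show ¬ k < m by omega]
      simp only [w, this]
    let W : Ω → ℝ × ℝ := fun ω => w (c · ω)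
    have hW : Measurable W := hw.comp h.measurable_seq
    have hind₁ : IndepFun (c 1) W P := by
      have := (h.indepFun_zeroBelow 1).comp measurable_id hw
      simpa only [Function.comp_def, id, hw2 _ le_rfl, Nat.reduceAdd] using this
    have hind₀ : IndepFun (c 0) (fun ω => (c 1 ω, W ω)) P := by
      have := (h.indepFun_zeroBelow 0).comp measurable_id ((measurable_pi_apply 1).prodMk hw)
      simpa only [Function.comp_def, id, hw2 1 one_le_two, zero_add, zeroBelow, lt_irrefl,
        if_false] using this
    -- Besides the remainder, the series is c₀ + α₁ x c₁ and its derivative is α₁ c₁. Since α₁ ≠ 0,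
    -- the pair (c₀, c₁) determines a nondegenerate map at every x, including x = 0.
    have hJ := isContJointDensity_affine (P := P) (e := e x) (e' := e' x) (β := α 1 * x)
      h.cont h.nonneg hM (he x) hα1 (h.meas 0) (h.meas 1) hW (h.law 0) (h.law 1) hind₀ hind₁
    have hlint := lintegral_abs_mul_affineDensity (P := P) (e := e x) (e' := e' x) (β := α 1 * x)
      h.cont h.nonneg hM (he x) hα1 (h.meas 1) hW (h.law 1) hind₁
    have hrhs : ∫⁻ ω, ENNReal.ofReal (|α 1 * c 1 ω + (W ω).2| *
        r (-(α 1 * x * c 1 ω + (W ω).1))) ∂P = ENNReal.ofReal (zeroDensity P c r α x) := by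
      rw [zeroDensity, ofReal_integral_eq_lintegral_ofReal (h.integrable_integrand hM hL hα x)
        (ae_of_all _ fun ω => mul_nonneg (abs_nonneg _) (h.nonneg _))]
      refine lintegral_congr_ae ?_
      filter_upwards [h.ae_tame] with ω hω
      rw [ser_eq_add hL hα hω 1 x, serDeriv_eq_add hL hα hω 1 x]
      simp [W, w]
    rw [hrhs] at hlint
    have hcont := hJ.continuous
    have hnn : ∀ η : ℝ, 0 ≤ |η| * ∫ ω, affineDensity r (e x) (e' x) (α 1 * x) (α 1) (0, η) (W ω) ∂P :=
      fun η => mul_nonneg (abs_nonneg _) (hJ.nonneg _)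
    have hmeas : AEStronglyMeasurable (fun η : ℝ =>
        |η| * ∫ ω, affineDensity r (e x) (e' x) (α 1 * x) (α 1) (0, η) (W ω) ∂P) volume :=
      (continuous_abs.mul (hcont.comp (by fun_prop : Continuous fun η : ℝ =>
        ((0 : ℝ), η)))).aestronglyMeasurable
    refine ⟨_, ⟨hcont, hJ.nonneg, ?_⟩, ?_, ?_⟩
    · rw [← hJ.law]
      refine Measure.map_congr ?_
      filter_upwards [h.ae_tame, hF, hF'] with ω hω hFω hF'ω
      have h0 := ser_eq_add hL hα hω 0 x
      have h0' := serDeriv_eq_add hL hα hω 0 x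
      rw [zeroBelow_zero] at h0 h0'
      rw [hFω, hF'ω, h0, h0', zero_add, ser_eq_add hL hα hω 1 x, serDeriv_eq_add hL hα hω 1 x, hα0]
      simp [W, w, add_assoc]
    · refine ⟨hmeas, ?_⟩
      rw [hasFiniteIntegral_iff_ofReal (ae_of_all _ hnn), hlint]
      exact ENNReal.ofReal_lt_top
    · rw [integral_eq_lintegral_of_nonneg_ae (ae_of_all _ hnn) hmeas, hlint,
        ENNReal.toReal_ofReal (h.zeroDensity_nonneg x)]

end IsIidStd

end

/-! ### Decay of characteristic functions, stable under products -/

section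

/-- Doubling inequality for characteristic functions. -/
lemma one_sub_norm_charFun_two_mul_le (μ : Measure ℝ) [IsProbabilityMeasure μ] (u : ℝ) :
    1 - ‖charFun μ (2 * u)‖ ≤ 4 * (1 - ‖charFun μ u‖) := by
  set θ : ℝ := (charFun μ u).arg
  have hre : ∀ s τ : ℝ, (Complex.exp (-(τ * Complex.I)) * charFun μ s).re =
      ∫ t, Real.cos (s * t - τ) ∂μ := by
    intro s τ
    have hint : Integrable (fun t : ℝ => Complex.exp ((s * t - τ : ℝ) * Complex.I)) μ := by
      refine Integrable.of_bound (C := 1) (by fun_prop) (ae_of_all _ fun t => ?_)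
      rw [Complex.norm_exp_ofReal_mul_I]
    rw [charFun_apply_real, ← integral_const_mul]
    have h1 : ∀ t : ℝ, Complex.exp (-(τ * Complex.I)) * Complex.exp (s * t * Complex.I) =
        Complex.exp ((s * t - τ : ℝ) * Complex.I) := by
      intro t
      rw [← Complex.exp_add]
      congr 1
      push_cast
      ring
    simp_rw [h1]
    have h2 := integral_re hint
    simp only [RCLike.re_eq_complex_re, Complex.exp_ofReal_mul_I_re] at h2
    exact h2.symm
  -- Rotating by the argument θ makes the value real. Rotating by 2θ at 2u gives a lower bound for
  -- the norm there, and 1 - cos 2z ≤ 4 (1 - cos z) finishes.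
  have hnorm : ‖charFun μ u‖ = ∫ t, Real.cos (u * t - θ) ∂μ := by
    rw [← hre u θ]
    conv_rhs => rw [← Complex.norm_mul_exp_arg_mul_I (charFun μ u)]
    rw [mul_left_comm, ← Complex.exp_add]
    simp [θ]
  have hcosint : ∀ s τ : ℝ, Integrable (fun t : ℝ => Real.cos (s * t - τ)) μ := by
    intro s τ
    refine Integrable.of_bound (C := 1) (by fun_prop) (ae_of_all _ fun t => ?_)
    exact Real.abs_cos_le_one _
  have hdouble : ∫ t, Real.cos (2 * u * t - 2 * θ) ∂μ ≤ ‖charFun μ (2 * u)‖ := by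
    rw [← hre (2 * u) (2 * θ)]
    refine (Complex.re_le_norm _).trans ?_
    rw [norm_mul]
    have : ‖Complex.exp (-(((2 * θ : ℝ) : ℂ) * Complex.I))‖ = 1 := by
      rw [← neg_mul, ← Complex.ofReal_neg, Complex.norm_exp_ofReal_mul_I]
    rw [this, one_mul]
  have hmain : 1 - ∫ t, Real.cos (2 * u * t - 2 * θ) ∂μ ≤
      4 * (1 - ∫ t, Real.cos (u * t - θ) ∂μ) := by
    have h1 : ∀ s τ : ℝ, 1 - ∫ t, Real.cos (s * t - τ) ∂μ =
        ∫ t, (1 - Real.cos (s * t - τ)) ∂μ := by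
      intro s τ
      rw [integral_sub (integrable_const _) (hcosint s τ)]
      simp
    rw [h1, h1, ← integral_const_mul]
    refine integral_mono ((integrable_const _).sub (hcosint _ _))
      (((integrable_const _).sub (hcosint _ _)).const_mul 4) fun t => ?_
    have : 2 * u * t - 2 * θ = 2 * (u * t - θ) := by ring
    simp only [this, Real.cos_two_mul]
    nlinarith [Real.cos_le_one (u * t - θ), Real.neg_one_le_cos (u * t - θ)]
  rw [hnorm]
  linarith

/-- Decay of a function that behaves like a characteristic function with six-fold decay. -/
structure CharDecay (φ φ₁ φ₂ : ℝ → ℂ) (κ C : ℝ) : Prop where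
  deriv₁ : ∀ s, HasDerivAt φ (φ₁ s) s
  deriv₂ : ∀ s, HasDerivAt φ₁ (φ₂ s) s
  κ_pos : 0 < κ
  C_nonneg : 0 ≤ C
  bound : ∀ s, ‖φ s‖ ≤ ((1 + κ * s ^ 2) ^ 3)⁻¹
  bound₁ : ∀ s, ‖φ₁ s‖ ≤ C * |s| * ((1 + κ * s ^ 2) ^ 3)⁻¹
  bound₂ : ∀ s, ‖φ₂ s‖ ≤ C * ((1 + κ * s ^ 2) ^ 3)⁻¹

/-- Double u until it reaches M, where the defect 1 - ‖φ‖ is at least 1/2. Each doubling loses a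
factor of at most 4, which is how u² scales, so a quadratic lower bound results. -/
lemma one_sub_norm_ge {φ : ℝ → ℂ} {M : ℝ} (hM : 0 < M)
    (hdbl : ∀ u, 1 - ‖φ (2 * u)‖ ≤ 4 * (1 - ‖φ u‖)) (hfar : ∀ u, M ≤ |u| → ‖φ u‖ ≤ 1 / 2)
    (h0 : ‖φ 0‖ ≤ 1) {u : ℝ} (hu : |u| ≤ M) : u ^ 2 / (8 * M ^ 2) ≤ 1 - ‖φ u‖ := by
  have key : ∀ k : ℕ, ∀ u : ℝ, |u| ≤ M → M ≤ 2 ^ k * |u| →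
      u ^ 2 / (8 * M ^ 2) ≤ 1 - ‖φ u‖ := by
    intro k
    induction k with
    | zero =>
      intro u hu hk
      have hk' : M ≤ |u| := by simpa using hk
      have := hfar u hk'
      have h2 : u ^ 2 / (8 * M ^ 2) ≤ 1 / 8 := by
        rw [div_le_iff₀ (by positivity), ← sq_abs]
        nlinarith [abs_nonneg u]
      linarith
    | succ k ih =>
      intro u hu hk
      have h4 : u ^ 2 / (8 * M ^ 2) = (2 * u) ^ 2 / (8 * M ^ 2) / 4 := by field_simp; ring
      have habs : |2 * u| = 2 * |u| := by rw [abs_mul, abs_of_pos two_pos]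
      by_cases h : |2 * u| ≤ M
      · have := ih (2 * u) h (by rw [habs]; rw [pow_succ] at hk; linarith)
        have := hdbl u
        rw [h4]; linarith
      · have h1 := hfar (2 * u) (not_le.1 h).le
        have h2 := hdbl u
        have h3 : u ^ 2 / (8 * M ^ 2) ≤ 1 / 8 := by
          rw [div_le_iff₀ (by positivity), ← sq_abs]
          nlinarith [abs_nonneg u]
        linarith
  rcases eq_or_ne u 0 with rfl | hne
  · simpa using h0
  · have hpos : 0 < |u| := abs_pos.2 hne
    obtain ⟨k, hk⟩ := pow_unbounded_of_one_lt (M / |u|) (one_lt_two (α := ℝ))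
    refine key k u hu ?_
    rw [div_lt_iff₀ hpos] at hk
    exact hk.le

/-- The bound on φ must have constant exactly 1 to survive a product of n factors. Near 0 this comes
from the quadratic defect 1 - ‖φ‖, far away from the assumed decay. The factor |s| in the bound on
φ₁ comes from φ₁ 0 = 0; it lets Cauchy-Schwarz control sums over the factors independently of their
number. -/
lemma exists_charDecay {φ φ₁ φ₂ : ℝ → ℂ} {a A : ℝ} (ha : 0 < a) (hA : 0 < A)
    (h₁ : ∀ s, HasDerivAt φ (φ₁ s) s) (h₂ : ∀ s, HasDerivAt φ₁ (φ₂ s) s)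
    (hφ0 : φ 0 = 1) (hφ₁0 : φ₁ 0 = 0) (hdbl : ∀ u, 1 - ‖φ (2 * u)‖ ≤ 4 * (1 - ‖φ u‖))
    (b : ∀ s, ‖φ s‖ ≤ A / (1 + a * |s|) ^ 6) (b₁ : ∀ s, ‖φ₁ s‖ ≤ A / (1 + a * |s|) ^ 6)
    (b₂ : ∀ s, ‖φ₂ s‖ ≤ A / (1 + a * |s|) ^ 6) :
    ∃ κ C, CharDecay φ φ₁ φ₂ κ C := by
  set B : ℝ := max A 1
  have hB1 : 1 ≤ B := le_max_right _ _
  have hAB : A ≤ B := le_max_left _ _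
  set M : ℝ := 2 * B / a
  have hM : 0 < M := by positivity
  have haM : a * M = 2 * B := by simp only [M]; field_simp
  -- Here 96 = 3 · 8 · 4 makes 3κ at most 1/(8M²), the constant of the quadratic defect, because M²
  -- = 4B²/a².
  set κ : ℝ := min 1 (a ^ 2 / (96 * B ^ 2))
  have hκ : 0 < κ := lt_min one_pos (by positivity)
  have hκ1 : κ ≤ 1 := min_le_left _ _
  have hκ2 : κ ≤ a ^ 2 / (96 * B ^ 2) := min_le_right _ _
  have hκB : κ * (96 * B ^ 2) ≤ a ^ 2 := by rwa [le_div_iff₀ (by positivity)] at hκ2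
  have hB2 : 0 ≤ κ * (B ^ 2 - 1) := mul_nonneg hκ.le (by nlinarith)
  have hB3 : 0 ≤ κ * (B ^ 2 - B) := mul_nonneg hκ.le (by nlinarith)
  have hκa : κ ≤ a ^ 2 := by nlinarith
  have hκaB : κ * (2 * B) ≤ a ^ 2 := by nlinarith
  have hκM : 3 * κ * (8 * M ^ 2) ≤ 1 := by
    have : M ^ 2 * a ^ 2 = 4 * B ^ 2 := by rw [← mul_pow, mul_comm M a, haM]; ring
    have h3 : (3 * κ * (8 * M ^ 2)) * (a ^ 2) ≤ 1 * a ^ 2 := by nlinarith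
    exact le_of_mul_le_mul_right h3 (by positivity)
  have gen : ∀ s : ℝ, A / (1 + a * |s|) ^ 6 ≤ A * ((1 + κ * s ^ 2) ^ 3)⁻¹ := by
    intro s
    rw [div_eq_mul_inv]
    gcongr
    have : 1 + κ * s ^ 2 ≤ (1 + a * |s|) ^ 2 := by
      rw [← sq_abs s]
      nlinarith [abs_nonneg s, mul_nonneg ha.le (abs_nonneg s),
        mul_le_mul_of_nonneg_right hκa (sq_nonneg |s|)]
    calc (1 + κ * s ^ 2) ^ 3 ≤ ((1 + a * |s|) ^ 2) ^ 3 := by gcongr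
      _ = _ := by ring
  have hA6 : ∀ s : ℝ, A / (1 + a * |s|) ^ 6 ≤ A := fun s => by
    refine div_le_self hA.le (one_le_pow₀ ?_)
    have := mul_nonneg ha.le (abs_nonneg s)
    linarith
  have hfar3 : ∀ u : ℝ, M ≤ |u| → B * (1 + κ * u ^ 2) ≤ (1 + a * |u|) ^ 2 := by
    intro u hu
    have h1 : 2 * B ≤ a * |u| := by rw [← haM]; gcongr
    have h2 : κ * (2 * B) * |u| ^ 2 ≤ a ^ 2 * |u| ^ 2 :=
      mul_le_mul_of_nonneg_right hκaB (sq_nonneg _)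
    rw [← sq_abs u]
    nlinarith
  have hfar6 : ∀ u : ℝ, M ≤ |u| → A / (1 + a * |u|) ^ 6 ≤ ((1 + κ * u ^ 2) ^ 3)⁻¹ := by
    intro u hu
    have hp : 0 ≤ a * |u| := by positivity
    rw [div_le_iff₀ (by positivity), ← div_eq_inv_mul, le_div_iff₀ (by positivity)]
    calc A * (1 + κ * u ^ 2) ^ 3 ≤ B ^ 3 * (1 + κ * u ^ 2) ^ 3 := by
          gcongr
          exact hAB.trans (le_self_pow₀ hB1 (by norm_num))
      _ = (B * (1 + κ * u ^ 2)) ^ 3 := by ring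
      _ ≤ ((1 + a * |u|) ^ 2) ^ 3 := by gcongr; exact hfar3 u hu
      _ = _ := by ring
  have hfar : ∀ u, M ≤ |u| → ‖φ u‖ ≤ 1 / 2 := by
    intro u hu
    refine (b u).trans ?_
    have h1 : 2 * B ≤ a * |u| := by rw [← haM]; gcongr
    rw [div_le_iff₀ (by positivity)]
    have : 1 + a * |u| ≤ (1 + a * |u|) ^ 6 := le_self_pow₀ (by linarith) (by norm_num)
    linarith
  have hmvt : ∀ u, ‖φ₁ u‖ ≤ A * |u| := by
    intro u
    have := Convex.norm_image_sub_le_of_norm_hasDerivWithin_le (s := univ) (x := 0) (y := u)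
      (fun s _ => (h₂ s).hasDerivWithinAt) (fun s _ => (b₂ s).trans (hA6 s)) convex_univ
      (mem_univ _) (mem_univ _)
    simpa [hφ₁0] using this
  refine ⟨κ, 8 * A, h₁, h₂, hκ, by positivity, ?_, ?_, ?_⟩
  · intro u
    rcases le_total M |u| with hu | hu
    · exact (b u).trans (hfar6 u hu)
    · have h := one_sub_norm_ge hM hdbl hfar (by simp [hφ0]) hu
      have h3 : 3 * (κ * u ^ 2) ≤ u ^ 2 / (8 * M ^ 2) := by
        rw [le_div_iff₀ (by positivity)]
        have := mul_le_mul_of_nonneg_right hκM (sq_nonneg u)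
        linarith
      have ht : 0 ≤ κ * u ^ 2 := by positivity
      -- The next bound is the Bernoulli-type inequality (1 - 3t)(1 + t)³ ≤ 1 for t ≥ 0.
      calc ‖φ u‖ ≤ 1 - 3 * (κ * u ^ 2) := by linarith
        _ ≤ _ := by
          rw [← one_div, le_div_iff₀ (by positivity)]
          nlinarith [pow_nonneg ht 2, pow_nonneg ht 3, pow_nonneg ht 4]
  · intro u
    rcases le_total 1 |u| with hu | hu
    · have hp : 0 ≤ A * ((1 + κ * u ^ 2) ^ 3)⁻¹ := by positivity
      calc ‖φ₁ u‖ ≤ A * ((1 + κ * u ^ 2) ^ 3)⁻¹ := (b₁ u).trans (gen u)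
        _ ≤ 8 * |u| * (A * ((1 + κ * u ^ 2) ^ 3)⁻¹) := by nlinarith
        _ = _ := by ring
    · have hu2 : u ^ 2 ≤ 1 := by rw [← sq_abs]; exact pow_le_one₀ (abs_nonneg u) hu
      -- On |u| ≤ 1 the weight is at least 1/8, because κ ≤ 1; this is the origin of the constant
      -- 8A.
      have : (1 : ℝ) / 8 ≤ ((1 + κ * u ^ 2) ^ 3)⁻¹ := by
        rw [← one_div]
        apply one_div_le_one_div_of_le (by positivity)
        calc (1 + κ * u ^ 2) ^ 3 ≤ (1 + 1 * 1) ^ 3 := by gcongr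
          _ = 8 := by norm_num
      have hp : 0 ≤ 8 * A * |u| := by positivity
      calc ‖φ₁ u‖ ≤ A * |u| := hmvt u
        _ = 8 * A * |u| * (1 / 8) := by ring
        _ ≤ _ := by gcongr
  · intro u
    have hp : 0 ≤ A * ((1 + κ * u ^ 2) ^ 3)⁻¹ := by positivity
    have := (b₂ u).trans (gen u)
    linarith

/-- First and second derivatives of a finite product, with bounds. -/
lemma exists_deriv_prod {ι : Type*} (S : Finset ι) {f f₁ f₂ : ι → ℝ → ℂ} {w A B : ι → ℝ → ℝ}
    (h₁ : ∀ i t, HasDerivAt (f i) (f₁ i t) t) (h₂ : ∀ i t, HasDerivAt (f₁ i) (f₂ i t) t)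
    (hw : ∀ i t, 0 ≤ w i t) (hA : ∀ i t, 0 ≤ A i t) (hB : ∀ i t, 0 ≤ B i t)
    (b : ∀ i t, ‖f i t‖ ≤ w i t) (b₁ : ∀ i t, ‖f₁ i t‖ ≤ A i t * w i t)
    (b₂ : ∀ i t, ‖f₂ i t‖ ≤ B i t * w i t) :
    ∃ G₁ G₂ : ℝ → ℂ, (∀ t, HasDerivAt (fun t => ∏ i ∈ S, f i t) (G₁ t) t) ∧
      (∀ t, HasDerivAt G₁ (G₂ t) t) ∧
      (∀ t, ‖∏ i ∈ S, f i t‖ ≤ ∏ i ∈ S, w i t) ∧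
      (∀ t, ‖G₁ t‖ ≤ (∑ i ∈ S, A i t) * ∏ i ∈ S, w i t) ∧
      (∀ t, ‖G₂ t‖ ≤ (∑ i ∈ S, B i t + (∑ i ∈ S, A i t) ^ 2) * ∏ i ∈ S, w i t) := by
  classical
  induction S using Finset.induction_on with
  | empty =>
    refine ⟨fun _ => 0, fun _ => 0, fun t => ?_, fun t => ?_, fun t => ?_, fun t => ?_,
      fun t => ?_⟩
    · simpa using hasDerivAt_const t (1 : ℂ)
    · simpa using hasDerivAt_const t (0 : ℂ)
    · simp
    · simp
    · simp
  | insert j S hj ih =>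
    obtain ⟨G₁, G₂, d₁, d₂, c₀, c₁, c₂⟩ := ih
    refine ⟨fun t => f₁ j t * ∏ i ∈ S, f i t + f j t * G₁ t,
      fun t => (f₂ j t * ∏ i ∈ S, f i t + f₁ j t * G₁ t) + (f₁ j t * G₁ t + f j t * G₂ t),
      fun t => ?_, fun t => ?_, fun t => ?_, fun t => ?_, fun t => ?_⟩
    · simp_rw [Finset.prod_insert hj]
      exact (h₁ j t).mul (d₁ t)
    · exact ((h₂ j t).mul (d₁ t)).add ((h₁ j t).mul (d₂ t))
    · rw [Finset.prod_insert hj, Finset.prod_insert hj, norm_mul]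
      exact mul_le_mul (b j t) (c₀ t) (norm_nonneg _) (hw j t)
    all_goals
      have hW : 0 ≤ ∏ i ∈ S, w i t := Finset.prod_nonneg fun i _ => hw i t
      have hSA : 0 ≤ ∑ i ∈ S, A i t := Finset.sum_nonneg fun i _ => hA i t
      have hSB : 0 ≤ ∑ i ∈ S, B i t := Finset.sum_nonneg fun i _ => hB i t
      have hAw : 0 ≤ A j t * w j t := mul_nonneg (hA j t) (hw j t)
      have hBw : 0 ≤ B j t * w j t := mul_nonneg (hB j t) (hw j t)
      have e1 : ‖f₁ j t * ∏ i ∈ S, f i t‖ ≤ A j t * w j t * ∏ i ∈ S, w i t := by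
        rw [norm_mul]; exact mul_le_mul (b₁ j t) (c₀ t) (norm_nonneg _) hAw
      have e2 : ‖f j t * G₁ t‖ ≤ w j t * ((∑ i ∈ S, A i t) * ∏ i ∈ S, w i t) := by
        rw [norm_mul]; exact mul_le_mul (b j t) (c₁ t) (norm_nonneg _) (hw j t)
      have e3 : ‖f₂ j t * ∏ i ∈ S, f i t‖ ≤ B j t * w j t * ∏ i ∈ S, w i t := by
        rw [norm_mul]; exact mul_le_mul (b₂ j t) (c₀ t) (norm_nonneg _) hBw
      have e4 : ‖f₁ j t * G₁ t‖ ≤ A j t * w j t * ((∑ i ∈ S, A i t) * ∏ i ∈ S, w i t) := by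
        rw [norm_mul]; exact mul_le_mul (b₁ j t) (c₁ t) (norm_nonneg _) hAw
      have e5 : ‖f j t * G₂ t‖ ≤
          w j t * ((∑ i ∈ S, B i t + (∑ i ∈ S, A i t) ^ 2) * ∏ i ∈ S, w i t) := by
        rw [norm_mul]; exact mul_le_mul (b j t) (c₂ t) (norm_nonneg _) (hw j t)
      simp only [Finset.prod_insert hj, Finset.sum_insert hj]
    · refine (norm_add_le _ _).trans ((add_le_add e1 e2).trans (le_of_eq ?_))
      ring
    · refine (norm_add_le _ _).trans ((add_le_add ((norm_add_le _ _).trans (add_le_add e3 e4))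
        ((norm_add_le _ _).trans (add_le_add e4 e5))).trans ?_)
      -- The product rule gives the cross terms of (A j t + ∑ A)² but not the square of A j t;
      -- adding it completes the square.
      have : 0 ≤ (A j t) ^ 2 * (w j t * ∏ i ∈ S, w i t) :=
        mul_nonneg (sq_nonneg _) (mul_nonneg (hw j t) hW)
      nlinarith

/-- The mean value inequality is applied twice: first to F₁, then to F(s) + F(-s), whose derivative
is at most 2B|t| on the ball of radius |t|. -/
lemma norm_second_difference_le {F F₁ F₂ : ℝ → ℂ} (h₁ : ∀ t, HasDerivAt F (F₁ t) t)
    (h₂ : ∀ t, HasDerivAt F₁ (F₂ t) t) {B : ℝ} (hB : ∀ t, ‖F₂ t‖ ≤ B) (t : ℝ) :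
    ‖F 0 - (F t + F (-t)) / 2‖ ≤ B * t ^ 2 := by
  have hlip : ∀ x y, ‖F₁ y - F₁ x‖ ≤ B * ‖y - x‖ := fun x y =>
    Convex.norm_image_sub_le_of_norm_hasDerivWithin_le (s := univ)
      (fun s _ => (h₂ s).hasDerivWithinAt) (fun s _ => hB s) convex_univ (mem_univ x) (mem_univ y)
  have hB0 : 0 ≤ B := (norm_nonneg _).trans (hB 0)
  have hd : ∀ s, HasDerivAt (fun s => F s + F (-s)) (F₁ s - F₁ (-s)) s := by
    intro s
    have := (h₁ (-s)).scomp s (hasDerivAt_neg s)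
    have h : HasDerivAt (fun s => F s + F (-s)) (F₁ s + (-1 : ℝ) • F₁ (-s)) s := (h₁ s).add this
    rwa [neg_one_smul, ← sub_eq_add_neg] at h
  have := Convex.norm_image_sub_le_of_norm_hasDerivWithin_le (C := 2 * B * |t|)
    (s := Metric.closedBall (0 : ℝ) |t|)
    (fun s _ => (hd s).hasDerivWithinAt) (fun s hs => ?_) (convex_closedBall _ _)
    (x := 0) (y := t) (by simp) (by simp)
  · have e : F 0 - (F t + F (-t)) / 2 = -(1 / 2 : ℂ) * (F t + F (-t) - (F 0 + F 0)) := by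
      ring
    have h12 : ‖-(1 / 2 : ℂ)‖ = 1 / 2 := by simp
    simp only [sub_zero, neg_zero, Real.norm_eq_abs] at this
    rw [e, norm_mul, h12, ← sq_abs]
    nlinarith
  · refine (hlip (-s) s).trans ?_
    have hs' : |s| ≤ |t| := by simpa using hs
    have : ‖s - -s‖ = 2 * |s| := by
      rw [Real.norm_eq_abs, sub_neg_eq_add, ← two_mul, abs_mul, abs_of_pos two_pos]
    rw [this]
    nlinarith

lemma one_add_sum_le_prod_one_add {ι : Type*} (S : Finset ι) {f : ι → ℝ} (hf : ∀ i, 0 ≤ f i) :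
    1 + ∑ i ∈ S, f i ≤ ∏ i ∈ S, (1 + f i) := by
  classical
  induction S using Finset.induction_on with
  | empty => simp
  | insert j S hj ih =>
    rw [Finset.sum_insert hj, Finset.prod_insert hj]
    have := hf j
    have := Finset.sum_nonneg fun i (_ : i ∈ S) => hf i
    nlinarith

/-- Expanding the product of 1 + κ uᵢ² only adds nonnegative terms to 1 + κ ∑ uᵢ². For orthonormal
weights the sum is s² + t², so the bound is independent of the number of factors. -/
lemma prod_inv_cube_le {ι : Type*} (S : Finset ι) {κ : ℝ} (hκ : 0 ≤ κ) (u : ι → ℝ) :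
    ∏ i ∈ S, ((1 + κ * u i ^ 2) ^ 3)⁻¹ ≤ ((1 + κ * ∑ i ∈ S, u i ^ 2) ^ 3)⁻¹ := by
  rw [Finset.prod_inv_distrib, Finset.prod_pow, Finset.mul_sum]
  have hs : 0 ≤ ∑ i ∈ S, κ * u i ^ 2 := Finset.sum_nonneg fun i _ => by positivity
  gcongr
  exact one_add_sum_le_prod_one_add S fun i => by positivity

/-- A finite system of pairs of weights that is orthonormal. -/
structure Orthonormal₂ {ι : Type*} (S : Finset ι) (a b : ι → ℝ) : Prop where
  sq_left : ∑ i ∈ S, a i ^ 2 = 1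
  sq_right : ∑ i ∈ S, b i ^ 2 = 1
  inner : ∑ i ∈ S, a i * b i = 0

lemma Orthonormal₂.sum_sq {ι : Type*} {S : Finset ι} {a b : ι → ℝ} (h : Orthonormal₂ S a b)
    (s t : ℝ) : ∑ i ∈ S, (a i * s + b i * t) ^ 2 = s ^ 2 + t ^ 2 := by
  have : ∀ i, (a i * s + b i * t) ^ 2 = s ^ 2 * a i ^ 2 + 2 * s * t * (a i * b i) +
      t ^ 2 * b i ^ 2 := fun i => by ring
  simp_rw [this, Finset.sum_add_distrib, ← Finset.mul_sum, h.sq_left, h.sq_right, h.inner]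
  ring

namespace CharDecay

variable {φ φ₁ φ₂ : ℝ → ℂ} {κ C : ℝ} {ι : Type*} {S : Finset ι} {a b : ι → ℝ}

lemma norm_prod_le (hφ : CharDecay φ φ₁ φ₂ κ C) (h : Orthonormal₂ S a b) (s t : ℝ) :
    ‖∏ i ∈ S, φ (a i * s + b i * t)‖ ≤ (1 + κ * s ^ 2)⁻¹ := by
  have hκ := hφ.κ_pos
  calc ‖∏ i ∈ S, φ (a i * s + b i * t)‖ ≤
      ∏ i ∈ S, ((1 + κ * (a i * s + b i * t) ^ 2) ^ 3)⁻¹ := by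
        rw [norm_prod]
        exact Finset.prod_le_prod (fun i _ => norm_nonneg _) fun i _ => hφ.bound _
    _ ≤ ((1 + κ * (s ^ 2 + t ^ 2)) ^ 3)⁻¹ := by
        rw [← h.sum_sq]; exact prod_inv_cube_le S hκ.le _
    _ ≤ (1 + κ * s ^ 2)⁻¹ := by
        have : 0 ≤ κ * t ^ 2 := by positivity
        gcongr
        calc 1 + κ * s ^ 2 ≤ 1 + κ * (s ^ 2 + t ^ 2) := by nlinarith
          _ ≤ _ := le_self_pow₀ (by nlinarith [mul_nonneg hκ.le (sq_nonneg s)]) (by norm_num)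

/-- The factor t² makes division by t² harmless near t = 0, with a constant that does not depend on
S, a or b. -/
lemma norm_second_difference_prod_le (hφ : CharDecay φ φ₁ φ₂ κ C) (h : Orthonormal₂ S a b)
    (s t : ℝ) :
    ‖∏ i ∈ S, φ (a i * s + b i * 0) - (∏ i ∈ S, φ (a i * s + b i * t) +
      ∏ i ∈ S, φ (a i * s + b i * (-t))) / 2‖ ≤
      (C + C ^ 2 / κ) * (1 + κ * s ^ 2)⁻¹ * t ^ 2 := by
  have hκ := hφ.κ_pos
  have hC := hφ.C_nonneg
  have hin : ∀ i t, HasDerivAt (fun t => a i * s + b i * t) (b i) t := fun i t => by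
    simpa using ((hasDerivAt_id t).const_mul (b i)).const_add (a i * s)
  obtain ⟨G₁, G₂, d₁, d₂, -, -, hG₂⟩ := exists_deriv_prod S
    (f := fun i t => φ (a i * s + b i * t))
    (f₁ := fun i t => b i • φ₁ (a i * s + b i * t))
    (f₂ := fun i t => b i • b i • φ₂ (a i * s + b i * t))
    (w := fun i t => ((1 + κ * (a i * s + b i * t) ^ 2) ^ 3)⁻¹)
    (A := fun i t => C * (|b i| * |a i * s + b i * t|)) (B := fun i t => C * b i ^ 2)
    (fun i t => (hφ.deriv₁ _).scomp t (hin i t))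
    (fun i t => ((hφ.deriv₂ _).scomp t (hin i t)).const_smul (b i))
    (fun i t => by positivity) (fun i t => by positivity) (fun i t => by positivity)
    (fun i t => hφ.bound _)
    (fun i t => by
      rw [norm_smul, Real.norm_eq_abs]
      calc |b i| * ‖φ₁ (a i * s + b i * t)‖ ≤
          |b i| * (C * |a i * s + b i * t| * ((1 + κ * (a i * s + b i * t) ^ 2) ^ 3)⁻¹) := by
            gcongr; exact hφ.bound₁ _
        _ = _ := by ring)
    (fun i t => by
      rw [norm_smul, norm_smul, Real.norm_eq_abs, ← mul_assoc, abs_mul_abs_self]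
      calc b i * b i * ‖φ₂ (a i * s + b i * t)‖ ≤
          b i * b i * (C * ((1 + κ * (a i * s + b i * t) ^ 2) ^ 3)⁻¹) :=
            mul_le_mul_of_nonneg_left (hφ.bound₂ _) (mul_self_nonneg _)
        _ = _ := by ring)
  refine norm_second_difference_le d₁ d₂ (fun τ => ?_) t
  refine (hG₂ τ).trans ?_
  have hA : (∑ i ∈ S, C * (|b i| * |a i * s + b i * τ|)) ^ 2 ≤ C ^ 2 * (s ^ 2 + τ ^ 2) := by
    rw [← Finset.mul_sum, mul_pow]
    gcongr
    have := Finset.sum_mul_sq_le_sq_mul_sq S (fun i => |b i|) (fun i => |a i * s + b i * τ|)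
    simp only [sq_abs] at this
    rwa [h.sq_right, one_mul, h.sum_sq] at this
  have hw : ∏ i ∈ S, ((1 + κ * (a i * s + b i * τ) ^ 2) ^ 3)⁻¹ ≤
      ((1 + κ * (s ^ 2 + τ ^ 2)) ^ 3)⁻¹ := by
    rw [← h.sum_sq]; exact prod_inv_cube_le S hκ.le _
  set σ := s ^ 2 + τ ^ 2
  have hσ : 0 ≤ σ := by positivity
  have hσs : s ^ 2 ≤ σ := by simp only [σ]; nlinarith [sq_nonneg τ]
  calc (∑ i ∈ S, C * b i ^ 2 + (∑ i ∈ S, C * (|b i| * |a i * s + b i * τ|)) ^ 2) *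
      ∏ i ∈ S, ((1 + κ * (a i * s + b i * τ) ^ 2) ^ 3)⁻¹ ≤
      (C + C ^ 2 * σ) * ((1 + κ * σ) ^ 3)⁻¹ := by
        have h0 : 0 ≤ ∏ i ∈ S, ((1 + κ * (a i * s + b i * τ) ^ 2) ^ 3)⁻¹ :=
          Finset.prod_nonneg fun i _ => by positivity
        rw [← Finset.mul_sum, h.sq_right, mul_one]
        gcongr
    -- The growth of the squared first-order sum costs one of the three powers of 1 + κσ; enough
    -- decay remains to integrate in s.
    _ ≤ ((C + C ^ 2 / κ) * (1 + κ * σ)) * ((1 + κ * σ) ^ 3)⁻¹ := by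
        gcongr
        have e : (C + C ^ 2 / κ) * (1 + κ * σ) = C + C ^ 2 * σ + (C * κ * σ + C ^ 2 / κ) := by
          field_simp; ring
        rw [e]
        have : 0 ≤ C * κ * σ + C ^ 2 / κ := by positivity
        linarith
    _ = (C + C ^ 2 / κ) * ((1 + κ * σ) ^ 2)⁻¹ := by field_simp
    _ ≤ (C + C ^ 2 / κ) * (1 + κ * s ^ 2)⁻¹ := by
        gcongr
        calc 1 + κ * s ^ 2 ≤ 1 + κ * σ := by gcongr
          _ ≤ _ := le_self_pow₀ (by nlinarith [mul_nonneg hκ.le hσ]) (by norm_num)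

end CharDecay

end

/-! ### Absolute moments and Fourier inversion -/

section

/-- The constant in `∫ (1 - cos (t v)) / t² dt = cosConst * |v|`. -/
noncomputable def cosConst : ℝ := ∫ t : ℝ, (1 - Real.cos t) / t ^ 2

lemma one_sub_cos_nonneg (t : ℝ) : 0 ≤ 1 - Real.cos t := by linarith [Real.cos_le_one t]

/-- A quadratic bound near 0 and a constant bound at infinity merge into one integrable majorant. -/
lemma inv_sq_mul_le {B m t : ℝ} (hB : 0 ≤ B) (h₁ : m ≤ B * t ^ 2) (h₂ : m ≤ B) :
    m / t ^ 2 ≤ 2 * B * (1 + t ^ 2)⁻¹ := by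
  rcases eq_or_ne t 0 with rfl | ht
  · simp; positivity
  have ht2 : 0 < t ^ 2 := by positivity
  rw [← div_eq_mul_inv, div_le_div_iff₀ ht2 (by positivity)]
  nlinarith

lemma one_sub_cos_div_sq_le (t : ℝ) : (1 - Real.cos t) / t ^ 2 ≤ 4 * (1 + t ^ 2)⁻¹ := by
  have h := inv_sq_mul_le (B := 2) (m := 1 - Real.cos t) (t := t) zero_le_two
    (by nlinarith [Real.one_sub_sq_div_two_le_cos (x := t), sq_nonneg t])
    (by linarith [Real.neg_one_le_cos t])
  linarith

lemma integrable_one_sub_cos_div_sq : Integrable fun t : ℝ => (1 - Real.cos t) / t ^ 2 := by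
  refine (integrable_inv_one_add_sq.const_mul 4).mono'
    (Measurable.aestronglyMeasurable (by fun_prop)) (ae_of_all _ fun t => ?_)
  rw [Real.norm_of_nonneg (div_nonneg (one_sub_cos_nonneg t) (sq_nonneg t))]
  exact one_sub_cos_div_sq_le t

/-- The value of the constant is never needed, since it occurs in the Gaussian limit as well and
cancels. -/
lemma cosConst_pos : 0 < cosConst := by
  refine (integral_pos_iff_support_of_nonneg
    (fun t => div_nonneg (one_sub_cos_nonneg t) (sq_nonneg t))
    integrable_one_sub_cos_div_sq).2 ?_
  have hsub : Ioo (0 : ℝ) 1 ⊆ Function.support fun t : ℝ => (1 - Real.cos t) / t ^ 2 := by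
    intro t ht
    have h1 : Real.cos t < 1 := by
      rw [← Real.cos_zero]
      exact Real.cos_lt_cos_of_nonneg_of_le_pi le_rfl (by linarith [ht.2, Real.pi_gt_three]) ht.1
    exact (div_pos (by linarith) (by have := ht.1; positivity)).ne'
  refine lt_of_lt_of_le ?_ (measure_mono hsub)
  simp

lemma one_sub_cos_mul_div_sq (v t : ℝ) : (1 - Real.cos (t * v)) / t ^ 2 =
    v ^ 2 * ((1 - Real.cos (t * v)) / (t * v) ^ 2) := by
  rcases eq_or_ne v 0 with rfl | hv
  · simp
  rcases eq_or_ne t 0 with rfl | ht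
  · simp
  field_simp

lemma integrable_one_sub_cos_mul_div_sq (v : ℝ) :
    Integrable fun t : ℝ => (1 - Real.cos (t * v)) / t ^ 2 := by
  rcases eq_or_ne v 0 with rfl | hv
  · simp
  simp_rw [one_sub_cos_mul_div_sq v]
  exact (integrable_one_sub_cos_div_sq.comp_mul_right' hv).const_mul _

lemma integral_one_sub_cos_mul_div_sq (v : ℝ) :
    ∫ t : ℝ, (1 - Real.cos (t * v)) / t ^ 2 = cosConst * |v| := by
  rcases eq_or_ne v 0 with rfl | hv
  · simp
  simp_rw [one_sub_cos_mul_div_sq v]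
  rw [integral_const_mul,
    Measure.integral_comp_mul_right (fun t : ℝ => (1 - Real.cos t) / t ^ 2) v, ← cosConst,
    smul_eq_mul, abs_inv, ← sq_abs]
  have := abs_pos.2 hv
  field_simp

section Expectation

variable {Ω : Type*} [MeasurableSpace Ω] {P : Measure Ω} [IsProbabilityMeasure P]

/-- First absolute moments in terms of characteristic functions. -/
lemma integral_expectation_one_sub_cos {V R : Ω → ℝ} {M : ℝ} (hV : Measurable V)
    (hVi : Integrable V P) (hR : Measurable R) (hRM : ∀ ω, |R ω| ≤ M) :
    ∫ t : ℝ, (∫ ω, (1 - Real.cos (t * V ω)) * R ω ∂P) / t ^ 2 =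
      cosConst * ∫ ω, |V ω| * R ω ∂P := by
  have hm : Measurable fun q : Ω × ℝ => (1 - Real.cos (q.2 * V q.1)) / q.2 ^ 2 * R q.1 := by
    fun_prop
  have hnorm : ∀ ω (t : ℝ), ‖(1 - Real.cos (t * V ω)) / t ^ 2 * R ω‖ =
      (1 - Real.cos (t * V ω)) / t ^ 2 * |R ω| := fun ω t => by
    rw [norm_mul, Real.norm_of_nonneg (div_nonneg (one_sub_cos_nonneg _) (sq_nonneg t)),
      Real.norm_eq_abs]
  have hsec : ∀ ω, Integrable fun t : ℝ => (1 - Real.cos (t * V ω)) / t ^ 2 * R ω := fun ω =>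
    (integrable_one_sub_cos_mul_div_sq (V ω)).mul_const (R ω)
  have hint : Integrable (fun q : Ω × ℝ =>
      (1 - Real.cos (q.2 * V q.1)) / q.2 ^ 2 * R q.1) (P.prod volume) := by
    refine (integrable_prod_iff hm.aestronglyMeasurable).2 ⟨ae_of_all _ hsec, ?_⟩
    · simp only [hnorm]
      simp_rw [integral_mul_const, integral_one_sub_cos_mul_div_sq]
      refine ((hVi.abs.const_mul cosConst).mul_const M).mono'
        (Measurable.aestronglyMeasurable (by fun_prop)) (ae_of_all _ fun ω => ?_)
      have hK := cosConst_pos.le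
      rw [Real.norm_of_nonneg (by positivity)]
      gcongr
      exact hRM ω
  have hswap := integral_integral_swap (f := fun ω (t : ℝ) =>
    (1 - Real.cos (t * V ω)) / t ^ 2 * R ω) hint
  simp_rw [integral_mul_const, integral_one_sub_cos_mul_div_sq] at hswap
  calc ∫ t : ℝ, (∫ ω, (1 - Real.cos (t * V ω)) * R ω ∂P) / t ^ 2 =
      ∫ t : ℝ, ∫ ω, (1 - Real.cos (t * V ω)) / t ^ 2 * R ω ∂P := by
        refine integral_congr_ae (ae_of_all _ fun t => ?_)
        simp only
        rw [← integral_div]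
        congr 1
        ext ω
        ring
    _ = _ := by
        rw [← hswap, ← integral_const_mul]
        congr 1
        ext ω
        ring

/-- Fourier inversion for a continuous density. -/
lemma density_eq_integral_charFun {r : ℝ → ℝ} {μ : Measure ℝ} [IsProbabilityMeasure μ]
    (hr : Continuous r) (hr0 : ∀ t, 0 ≤ r t)
    (hμ : μ = volume.withDensity (fun t => ENNReal.ofReal (r t))) (hφ : Integrable (charFun μ))
    (v : ℝ) :
    (r v : ℂ) = (2 * Real.pi : ℂ)⁻¹ * ∫ s : ℝ, Complex.exp (-(s * v * Complex.I)) * charFun μ s := by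
  have hri : Integrable r := by
    refine ⟨hr.aestronglyMeasurable, ?_⟩
    rw [hasFiniteIntegral_iff_ofReal (ae_of_all _ hr0)]
    have : μ univ = ∫⁻ t, ENNReal.ofReal (r t) := by
      rw [hμ, withDensity_apply _ MeasurableSet.univ, setLIntegral_univ]
    rw [← this, measure_univ]
    exact ENNReal.one_lt_top
  have hrc : Continuous fun t => (r t : ℂ) := Complex.continuous_ofReal.comp hr
  -- The Fourier transform has kernel e^{-2πi t w}; the dilation by -2π is undone by substitution
  -- and leaves the factor (2π)⁻¹.
  have hFour : ∀ w : ℝ, FourierTransform.fourier (fun t => (r t : ℂ)) w =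
      charFun μ (-(2 * Real.pi) * w) := by
    intro w
    rw [Real.fourier_eq', charFun_apply_real, hμ, integral_withDensity_eq_integral_toReal_smul
      hr.measurable.ennreal_ofReal (ae_of_all _ fun t => ENNReal.ofReal_lt_top)]
    refine integral_congr_ae (ae_of_all _ fun t => ?_)
    simp only [smul_eq_mul, ENNReal.toReal_ofReal (hr0 t), Complex.real_smul]
    rw [mul_comm]
    congr 2
    simp only [RCLike.inner_apply, conj_trivial]
    push_cast
    ring
  have hpi : -(2 * Real.pi) ≠ 0 := by have := Real.pi_pos; linarith [this]
  have hFint : Integrable (FourierTransform.fourier fun t => (r t : ℂ)) := by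
    have : FourierTransform.fourier (fun t => (r t : ℂ)) =
      fun w => charFun μ (-(2 * Real.pi) * w) := funext hFour
    rw [this]
    exact hφ.comp_mul_left' hpi
  have hinv := congrFun (hrc.fourierInv_fourier_eq hri.ofReal hFint) v
  rw [Real.fourierInv_eq'] at hinv
  simp_rw [hFour] at hinv
  rw [← hinv]
  have hsub := Measure.integral_comp_mul_left
    (fun s : ℝ => Complex.exp (-(s * v * Complex.I)) * charFun μ s) (-(2 * Real.pi))
  have habs : |(-(2 * Real.pi))⁻¹| = (2 * Real.pi)⁻¹ := by
    rw [inv_neg, abs_neg, abs_of_pos (by positivity)]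
  rw [habs, Complex.real_smul] at hsub
  push_cast at hsub
  rw [← hsub]
  refine integral_congr_ae (ae_of_all _ fun t => ?_)
  simp only [smul_eq_mul]
  congr 2
  simp only [RCLike.inner_apply, conj_trivial]
  push_cast
  ring

/-- Inserting Fourier inversion into an expectation. -/
lemma expectation_density_eq {r : ℝ → ℝ} {φ : ℝ → ℂ} (hφ : Integrable φ) (hφc : Continuous φ)
    (hinv : ∀ v : ℝ, (r v : ℂ) =
      (2 * Real.pi : ℂ)⁻¹ * ∫ s : ℝ, Complex.exp (-(s * v * Complex.I)) * φ s)
    {U V : Ω → ℝ} (hU : Measurable U) (hV : Measurable V) (t : ℝ) :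
    ((∫ ω, (1 - Real.cos (t * V ω)) * r (-U ω) ∂P : ℝ) : ℂ) = (2 * Real.pi : ℂ)⁻¹ *
      ∫ s : ℝ, φ s * ∫ ω, ((1 - Real.cos (t * V ω) : ℝ) : ℂ) * Complex.exp (s * U ω * Complex.I) ∂P := by
  have hm : Measurable fun q : Ω × ℝ => ((1 - Real.cos (t * V q.1) : ℝ) : ℂ) *
      (Complex.exp (q.2 * U q.1 * Complex.I) * φ q.2) := by
    have := hφc.measurable
    fun_prop
  have hint : Integrable (Function.uncurry fun ω (s : ℝ) => ((1 - Real.cos (t * V ω) : ℝ) : ℂ) *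
      (Complex.exp (s * U ω * Complex.I) * φ s)) (P.prod volume) := by
    have hdom : Integrable (fun q : Ω × ℝ => (2 : ℝ) * ‖φ q.2‖) (P.prod volume) :=
      (integrable_const (2 : ℝ)).mul_prod hφ.norm
    refine hdom.mono' hm.aestronglyMeasurable (ae_of_all _ fun q => ?_)
    simp only [Function.uncurry]
    have h1 : ‖Complex.exp (q.2 * U q.1 * Complex.I)‖ = 1 := by
      rw [← Complex.ofReal_mul, Complex.norm_exp_ofReal_mul_I]
    rw [norm_mul, norm_mul, h1, one_mul, Complex.norm_real,
      Real.norm_of_nonneg (one_sub_cos_nonneg _)]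
    gcongr
    linarith [Real.neg_one_le_cos (t * V q.1)]
  have hswap := integral_integral_swap hint
  calc ((∫ ω, (1 - Real.cos (t * V ω)) * r (-U ω) ∂P : ℝ) : ℂ) =
      ∫ ω, ((2 * Real.pi : ℂ)⁻¹ * ∫ s : ℝ, ((1 - Real.cos (t * V ω) : ℝ) : ℂ) *
        (Complex.exp (s * U ω * Complex.I) * φ s)) ∂P := by
        rw [← integral_complex_ofReal]
        refine integral_congr_ae (ae_of_all _ fun ω => ?_)
        simp only
        rw [Complex.ofReal_mul, hinv (-U ω), mul_left_comm, ← integral_const_mul]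
        congr 1
        refine integral_congr_ae (ae_of_all _ fun s => ?_)
        simp
    _ = _ := by
        rw [integral_const_mul, hswap]
        congr 1
        refine integral_congr_ae (ae_of_all _ fun s => ?_)
        simp only
        rw [← integral_const_mul]
        refine integral_congr_ae (ae_of_all _ fun ω => ?_)
        simp only
        ring

/-- The cosine is the mean of two exponentials, so the expectation becomes a symmetric second
difference. The term `0 * v` matches the shape of `prodDiff`. -/
lemma one_sub_cos_mul_exp (z t v : ℝ) : ((1 - Real.cos (t * v) : ℝ) : ℂ) *
    Complex.exp (z * Complex.I) = Complex.exp ((z + 0 * v : ℝ) * Complex.I) -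
      (Complex.exp ((z + t * v : ℝ) * Complex.I) +
        Complex.exp ((z + -t * v : ℝ) * Complex.I)) / 2 := by
  push_cast
  rw [Complex.cos]
  rw [show ((z : ℂ) + t * v) * Complex.I = z * Complex.I + t * v * Complex.I by ring,
    show ((z : ℂ) + -t * v) * Complex.I = z * Complex.I + -(t * v) * Complex.I by ring,
    Complex.exp_add, Complex.exp_add]
  simp
  ring

end Expectation

end

/-! ### Fourier form of the density of zeros -/

section

lemma integrable_inv_one_add_mul_sq {κ : ℝ} (hκ : 0 < κ) :
    Integrable fun s : ℝ => (1 + κ * s ^ 2)⁻¹ := by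
  have h := integrable_inv_one_add_sq.comp_mul_left' (Real.sqrt_pos.2 hκ).ne'
  simpa only [mul_pow, Real.sq_sqrt hκ.le] using h

lemma integral_sub_half_add {X : Type*} [MeasurableSpace X] {μ : Measure X} {f g h : X → ℂ}
    (hf : Integrable f μ) (hg : Integrable g μ) (hh : Integrable h μ) :
    ∫ x, (f x - (g x + h x) / 2) ∂μ = ∫ x, f x ∂μ - (∫ x, g x ∂μ + ∫ x, h x ∂μ) / 2 := by
  have := integral_sub hf ((hg.add hh).div_const 2)
  rw [integral_div] at this
  simp only [Pi.add_apply] at this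
  rw [this, integral_add hg hh]

/-- The symmetric second difference in the second variable of a product of characteristic
functions. -/
noncomputable def prodDiff {ι : Type*} (φ : ℝ → ℂ) (S : Finset ι) (a b : ι → ℝ) (s t : ℝ) : ℂ :=
  ∏ i ∈ S, φ (a i * s + b i * 0) -
    (∏ i ∈ S, φ (a i * s + b i * t) + ∏ i ∈ S, φ (a i * s + b i * (-t))) / 2

/-- The Fourier form of the Kac-Rice integral. -/
noncomputable def kacRiceInt {ι : Type*} (φ : ℝ → ℂ) (S : Finset ι) (a b : ι → ℝ) : ℂ :=
  ∫ t : ℝ, (∫ s : ℝ, prodDiff φ S a b s t) / (t : ℂ) ^ 2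

namespace CharDecay

variable {φ φ₁ φ₂ : ℝ → ℂ} {κ C : ℝ} {ι : Type*} {S : Finset ι} {a b : ι → ℝ}

lemma continuous (hφ : CharDecay φ φ₁ φ₂ κ C) : Continuous φ :=
  continuous_iff_continuousAt.2 fun s => (hφ.deriv₁ s).continuousAt

lemma integrable (hφ : CharDecay φ φ₁ φ₂ κ C) : Integrable φ := by
  refine (integrable_inv_one_add_mul_sq hφ.κ_pos).mono' hφ.continuous.aestronglyMeasurable
    (ae_of_all _ fun s => (hφ.bound s).trans ?_)
  have := hφ.κ_pos
  gcongr
  have : 0 ≤ κ * s ^ 2 := by positivity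
  exact le_self_pow₀ (by linarith) (by norm_num)

lemma norm_le_one (hφ : CharDecay φ φ₁ φ₂ κ C) (s : ℝ) : ‖φ s‖ ≤ 1 := by
  refine (hφ.bound s).trans (inv_le_one_of_one_le₀ (one_le_pow₀ ?_))
  have := mul_nonneg hφ.κ_pos.le (sq_nonneg s)
  linarith

lemma continuous_prod (hφ : CharDecay φ φ₁ φ₂ κ C) (S : Finset ι) (a b : ι → ℝ) (t : ℝ) :
    Continuous fun s : ℝ => ∏ i ∈ S, φ (a i * s + b i * t) :=
  continuous_finsetProd _ fun i _ => hφ.continuous.comp (by fun_prop)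

lemma integrable_prod (hφ : CharDecay φ φ₁ φ₂ κ C) (h : Orthonormal₂ S a b) (t : ℝ) :
    Integrable fun s : ℝ => ∏ i ∈ S, φ (a i * s + b i * t) :=
  (integrable_inv_one_add_mul_sq hφ.κ_pos).mono' (hφ.continuous_prod S a b t).aestronglyMeasurable
    (ae_of_all _ fun s => hφ.norm_prod_le h s t)

lemma continuous_prodDiff (hφ : CharDecay φ φ₁ φ₂ κ C) (S : Finset ι) (a b : ι → ℝ) :
    Continuous fun q : ℝ × ℝ => prodDiff φ S a b q.1 q.2 := by
  have := hφ.continuous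
  unfold prodDiff
  fun_prop

lemma norm_prodDiff_le (hφ : CharDecay φ φ₁ φ₂ κ C) (h : Orthonormal₂ S a b) (s t : ℝ) :
    ‖prodDiff φ S a b s t‖ ≤ 2 * (1 + κ * s ^ 2)⁻¹ := by
  have h0 := hφ.norm_prod_le h s 0
  have h1 := hφ.norm_prod_le h s t
  have h2 := hφ.norm_prod_le h s (-t)
  unfold prodDiff
  refine (norm_sub_le _ _).trans ?_
  rw [norm_div, Complex.norm_ofNat]
  have h3 := norm_add_le (∏ i ∈ S, φ (a i * s + b i * t)) (∏ i ∈ S, φ (a i * s + b i * (-t)))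
  linarith

lemma integral_prodDiff_le (hφ : CharDecay φ φ₁ φ₂ κ C) (h : Orthonormal₂ S a b) (t : ℝ) :
    ‖(∫ s : ℝ, prodDiff φ S a b s t) / (t : ℂ) ^ 2‖ ≤
      2 * ((C + C ^ 2 / κ + 2) * ∫ s : ℝ, (1 + κ * s ^ 2)⁻¹) * (1 + t ^ 2)⁻¹ := by
  have hκ := hφ.κ_pos
  have hC := hφ.C_nonneg
  have hint := integrable_inv_one_add_mul_sq hκ
  have hI : 0 ≤ ∫ s : ℝ, (1 + κ * s ^ 2)⁻¹ := integral_nonneg fun s => by positivity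
  rw [norm_div, norm_pow, Complex.norm_real, Real.norm_eq_abs, sq_abs]
  refine inv_sq_mul_le (by positivity) ?_ ?_
  · calc ‖∫ s : ℝ, prodDiff φ S a b s t‖ ≤
        ∫ s : ℝ, (C + C ^ 2 / κ) * (1 + κ * s ^ 2)⁻¹ * t ^ 2 :=
          norm_integral_le_of_norm_le ((hint.const_mul _).mul_const _)
            (ae_of_all _ fun s => hφ.norm_second_difference_prod_le h s t)
      _ = (C + C ^ 2 / κ) * (∫ s : ℝ, (1 + κ * s ^ 2)⁻¹) * t ^ 2 := by
          rw [integral_mul_const, integral_const_mul]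
      _ ≤ _ := mul_le_mul_of_nonneg_right (mul_le_mul_of_nonneg_right (by linarith) hI)
          (sq_nonneg t)
  · calc ‖∫ s : ℝ, prodDiff φ S a b s t‖ ≤ ∫ s : ℝ, 2 * (1 + κ * s ^ 2)⁻¹ :=
          norm_integral_le_of_norm_le (hint.const_mul _)
            (ae_of_all _ fun s => hφ.norm_prodDiff_le h s t)
      _ = 2 * ∫ s : ℝ, (1 + κ * s ^ 2)⁻¹ := by rw [integral_const_mul]
      _ ≤ _ := by
          gcongr
          have : 0 ≤ C + C ^ 2 / κ := by positivity
          linarith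

lemma integral_prod_shear (e : ℝ) (he : 0 < e) (d t : ℝ) (φ : ℝ → ℂ) (S : Finset ι)
    (a b : ι → ℝ) :
    ∫ s : ℝ, ∏ i ∈ S, φ (a i * (s / e - d) + b i * t) =
      e * ∫ s : ℝ, ∏ i ∈ S, φ (a i * s + b i * t) := by
  rw [Measure.integral_comp_div (fun s : ℝ => ∏ i ∈ S, φ (a i * (s - d) + b i * t)) e,
    integral_sub_right_eq_self (fun s : ℝ => ∏ i ∈ S, φ (a i * s + b i * t)) d, abs_of_pos he,
    Complex.real_smul]

/-- Passing to orthonormal weights by a shear. -/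
lemma kacRiceInt_shear (hφ : CharDecay φ φ₁ φ₂ κ C) {a' b' : ι → ℝ} {e e' l : ℝ} (he : 0 < e)
    (hl : 0 < l) (ha : ∀ i, a i = e * a' i) (hb : ∀ i, b i = l * (e' * a' i + e * b' i))
    (h : Orthonormal₂ S a b) :
    l * kacRiceInt φ S a' b' = kacRiceInt φ S a b := by
  -- These arguments invert the linear change from a', b' to a, b. The shift of s depends on t
  -- alone, so it disappears on integrating over s, leaving only a dilation.
  have hprod : ∀ s t : ℝ, ∏ i ∈ S, φ (a' i * s + b' i * t) =
      ∏ i ∈ S, φ (a i * (s / e - t * e' / e ^ 2) + b i * (t / (l * e))) := by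
    intro s t
    refine Finset.prod_congr rfl fun i _ => ?_
    congr 1
    rw [ha, hb]
    field_simp
    ring
  have hintg : ∀ d t : ℝ, Integrable fun s : ℝ => ∏ i ∈ S, φ (a i * (s / e - d) + b i * t) :=
    fun d t => ((hφ.integrable_prod h t).comp_sub_right d).comp_div he.ne'
  have hinner : ∀ t : ℝ, ∫ s : ℝ, prodDiff φ S a' b' s t =
      e * ∫ s : ℝ, prodDiff φ S a b s (t / (l * e)) := by
    intro t
    unfold prodDiff
    simp_rw [hprod]
    rw [integral_sub_half_add (hintg _ _) (hintg _ _) (hintg _ _), integral_prod_shear e he,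
      integral_prod_shear e he, integral_prod_shear e he, integral_sub_half_add
      (hφ.integrable_prod h _) (hφ.integrable_prod h _) (hφ.integrable_prod h _), zero_div, neg_div]
    ring
  have hle : l * e ≠ 0 := (mul_pos hl he).ne'
  have hpt : ∀ t : ℝ, (∫ s : ℝ, prodDiff φ S a' b' s t) / (t : ℂ) ^ 2 =
      ((e / (l * e) ^ 2 : ℝ) : ℂ) * ((∫ s : ℝ, prodDiff φ S a b s (t / (l * e))) /
        ((t / (l * e) : ℝ) : ℂ) ^ 2) := by
    intro t
    rw [hinner]
    rcases eq_or_ne t 0 with rfl | ht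
    · simp
    have h1 : (t : ℂ) ≠ 0 := by exact_mod_cast ht
    have h2 : (l : ℂ) ≠ 0 := by exact_mod_cast hl.ne'
    have h3 : (e : ℂ) ≠ 0 := by exact_mod_cast he.ne'
    push_cast
    field_simp
  unfold kacRiceInt
  simp_rw [hpt]
  rw [integral_const_mul, Measure.integral_comp_div
    (fun t : ℝ => (∫ s : ℝ, prodDiff φ S a b s t) / (t : ℂ) ^ 2), abs_of_pos (mul_pos hl he),
    Complex.real_smul, ← mul_assoc, ← mul_assoc]
  have h2 : (l : ℂ) ≠ 0 := by exact_mod_cast hl.ne'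
  have h3 : (e : ℂ) ≠ 0 := by exact_mod_cast he.ne'
  have hone : (l : ℂ) * ((e / (l * e) ^ 2 : ℝ) : ℂ) * ((l * e : ℝ) : ℂ) = 1 := by
    push_cast
    field_simp
  rw [hone, one_mul]

end CharDecay

section Representation

variable {Ω : Type*} [MeasurableSpace Ω] {P : Measure Ω} [IsProbabilityMeasure P]
  {c : ℕ → Ω → ℝ} {r : ℝ → ℝ}

lemma IsIidStd.integral_cexp_sum (h : IsIidStd P c r) (n : ℕ) (γ : ℕ → ℝ) :
    ∫ ω, Complex.exp ((∑ k ∈ Finset.range n, γ k * c (k + 1) ω : ℝ) * Complex.I) ∂P =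
      ∏ k ∈ Finset.range n, charFun (P.map (c 0)) (γ k) := by
  have hmeas : ∀ k, Measurable fun ω => γ k * c (k + 1) ω := fun k => (h.meas (k + 1)).const_mul _
  have hind : iIndepFun (fun k ω => γ k * c (k + 1) ω) P :=
    (h.indep.precomp (add_left_injective 1)).comp (fun k x => γ k * x)
      fun k => measurable_const_mul _
  have hprod := iIndepFun.charFun_map_fun_finsetSum_eq_prod (s := Finset.range n)
    (fun k _ => (hmeas k).aemeasurable) (hind.restrict _)
  have h1 := congrFun hprod 1
  rw [charFun_apply_real, integral_map
    (Finset.measurable_fun_sum _ fun k _ => hmeas k).aemeasurable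
    (Continuous.aestronglyMeasurable (by fun_prop))] at h1
  simp only [Complex.ofReal_one, one_mul, Finset.prod_apply] at h1
  rw [h1]
  refine Finset.prod_congr rfl fun k _ => ?_
  have h2 : P.map (fun ω => γ k * c (k + 1) ω) = (P.map (c 0)).map (fun x => γ k * x) := by
    rw [h.law 0, ← h.law (k + 1), Measure.map_map (measurable_const_mul _) (h.meas _)]
    rfl
  rw [h2, charFun_map_mul, mul_one]

variable {α : ℕ → ℝ} {n : ℕ}

lemma ser_eq_sum (hα : ∀ k, n < k → α k = 0) (x : ℝ) (ζ : ℕ → ℝ) :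
    ser α x ζ = ∑ k ∈ Finset.range (n + 1), α k * x ^ k * ζ k :=
  tsum_eq_sum fun k hk => by
    rw [hα k (by simpa [Nat.lt_succ_iff] using hk)]; simp

lemma serDeriv_eq_sum (hα : ∀ k, n < k → α k = 0) (x : ℝ) (ζ : ℕ → ℝ) :
    serDeriv α x ζ = ∑ k ∈ Finset.range (n + 1), α k * (k * x ^ (k - 1)) * ζ k :=
  tsum_eq_sum fun k hk => by
    rw [hα k (by simpa [Nat.lt_succ_iff] using hk)]; simp

/-- The density of zeros of a random polynomial in Fourier form. -/
theorem IsIidStd.zeroDensity_eq_kacRiceInt (h : IsIidStd P c r) {φ₁ φ₂ : ℝ → ℂ} {κ C : ℝ}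
    (hφ : CharDecay (charFun (P.map (c 0))) φ₁ φ₂ κ C) {M : ℝ} (hM : ∀ t, r t ≤ M)
    (hα0 : α 0 = 1) (hα : ∀ k, n < k → α k = 0) (x : ℝ) :
    ((cosConst * zeroDensity P c r α x : ℝ) : ℂ) = (2 * Real.pi : ℂ)⁻¹ *
      kacRiceInt (charFun (P.map (c 0))) (Finset.range (n + 1)) (fun k => α k * x ^ k)
        (fun k => α k * (k * x ^ (k - 1))) := by
  set φ := charFun (P.map (c 0))
  have := Measure.isProbabilityMeasure_map (μ := P) (h.meas 0).aemeasurable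
  set U : Ω → ℝ := fun ω => ∑ k ∈ Finset.range n, α (k + 1) * x ^ (k + 1) * c (k + 1) ω
  set V : Ω → ℝ := fun ω =>
    ∑ k ∈ Finset.range n, α (k + 1) * ((k + 1 : ℕ) * x ^ k) * c (k + 1) ω
  have hU : Measurable U := Finset.measurable_fun_sum _ fun k _ => (h.meas _).const_mul _
  have hV : Measurable V := Finset.measurable_fun_sum _ fun k _ => (h.meas _).const_mul _
  have hVi : Integrable V P := integrable_finsetSum _ fun k _ =>
    ((h.memLp (k + 1)).integrable (by norm_num)).const_mul _
  have hserU : ∀ ω, ser α x (zeroBelow 1 (c · ω)) = U ω := by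
    intro ω
    rw [ser_eq_sum hα, Finset.sum_range_succ']
    simp [zeroBelow, U]
  have hserV : ∀ ω, serDeriv α x (zeroBelow 1 (c · ω)) = V ω := by
    intro ω
    rw [serDeriv_eq_sum hα, Finset.sum_range_succ']
    simp [zeroBelow, V]
  have hz : zeroDensity P c r α x = ∫ ω, |V ω| * r (-U ω) ∂P := by
    unfold zeroDensity
    simp_rw [hserU, hserV]
  have hRM : ∀ ω, |r (-U ω)| ≤ M := fun ω => by
    rw [abs_of_nonneg (h.nonneg _)]; exact hM _
  have hinv := density_eq_integral_charFun h.cont h.nonneg (h.law 0) hφ.integrable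
  -- The factor φ(s) from the inversion formula for r is exactly the missing factor k = 0 of the
  -- product: α₀ = 1, and the derivative weight vanishes there.
  have hchar : ∀ s t : ℝ, φ s * ∫ ω, Complex.exp ((s * U ω + t * V ω : ℝ) * Complex.I) ∂P =
      ∏ k ∈ Finset.range (n + 1), φ (α k * x ^ k * s + α k * (k * x ^ (k - 1)) * t) := by
    intro s t
    have hsum : ∀ ω, s * U ω + t * V ω = ∑ k ∈ Finset.range n,
        (α (k + 1) * x ^ (k + 1) * s + α (k + 1) * ((k + 1 : ℕ) * x ^ k) * t) * c (k + 1) ω := by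
      intro ω
      simp only [U, V, Finset.mul_sum, ← Finset.sum_add_distrib]
      exact Finset.sum_congr rfl fun k _ => by ring
    simp_rw [hsum]
    rw [h.integral_cexp_sum, Finset.prod_range_succ']
    simp [hα0, mul_comm, φ]
  have hexpint : ∀ s t : ℝ, Integrable
      (fun ω => Complex.exp ((s * U ω + t * V ω : ℝ) * Complex.I)) P := by
    intro s t
    refine Integrable.of_bound (C := 1) (Measurable.aestronglyMeasurable (by fun_prop))
      (ae_of_all _ fun ω => ?_)
    rw [Complex.norm_exp_ofReal_mul_I]
  have hdiff : ∀ s t : ℝ, φ s * ∫ ω, ((1 - Real.cos (t * V ω) : ℝ) : ℂ) *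
      Complex.exp (s * U ω * Complex.I) ∂P =
      prodDiff φ (Finset.range (n + 1)) (fun k => α k * x ^ k)
        (fun k => α k * (k * x ^ (k - 1))) s t := by
    intro s t
    unfold prodDiff
    rw [← hchar, ← hchar, ← hchar]
    have e1 : ∀ ω, ((1 - Real.cos (t * V ω) : ℝ) : ℂ) * Complex.exp (s * U ω * Complex.I) =
        Complex.exp ((s * U ω + 0 * V ω : ℝ) * Complex.I) -
      (Complex.exp ((s * U ω + t * V ω : ℝ) * Complex.I) +
        Complex.exp ((s * U ω + -t * V ω : ℝ) * Complex.I)) / 2 := fun ω => by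
      rw [← one_sub_cos_mul_exp, Complex.ofReal_mul]
    simp_rw [e1]
    rw [integral_sub_half_add (hexpint _ _) (hexpint _ _) (hexpint _ _)]
    ring
  have hq : ∀ t : ℝ, ((∫ ω, (1 - Real.cos (t * V ω)) * r (-U ω) ∂P : ℝ) : ℂ) =
      (2 * Real.pi : ℂ)⁻¹ * ∫ s : ℝ, prodDiff φ (Finset.range (n + 1)) (fun k => α k * x ^ k)
        (fun k => α k * (k * x ^ (k - 1))) s t := by
    intro t
    rw [expectation_density_eq hφ.integrable hφ.continuous hinv hU hV t]
    simp_rw [hdiff]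
  rw [hz, ← integral_expectation_one_sub_cos (R := fun ω => r (-U ω)) hV hVi
      (h.cont.measurable.comp hU.neg) hRM,
    ← integral_complex_ofReal, kacRiceInt, ← integral_const_mul]
  refine integral_congr_ae (ae_of_all _ fun t => ?_)
  simp only
  rw [Complex.ofReal_div, hq]
  push_cast
  ring

end Representation

end

/-! ### Central limit theorem and the Gaussian value -/

section

lemma norm_prod_sub_prod_le {ι : Type*} (S : Finset ι) {f g : ι → ℂ} (hf : ∀ i, ‖f i‖ ≤ 1)
    (hg : ∀ i, ‖g i‖ ≤ 1) : ‖∏ i ∈ S, f i - ∏ i ∈ S, g i‖ ≤ ∑ i ∈ S, ‖f i - g i‖ := by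
  classical
  induction S using Finset.induction_on with
  | empty => simp
  | insert j S hj ih =>
    rw [Finset.prod_insert hj, Finset.prod_insert hj, Finset.sum_insert hj]
    have e : f j * ∏ i ∈ S, f i - g j * ∏ i ∈ S, g i =
        (f j - g j) * ∏ i ∈ S, f i + g j * (∏ i ∈ S, f i - ∏ i ∈ S, g i) := by ring
    have hF : ‖∏ i ∈ S, f i‖ ≤ 1 := by
      rw [norm_prod]
      exact Finset.prod_le_one (fun i _ => norm_nonneg _) fun i _ => hf i
    rw [e]
    refine (norm_add_le _ _).trans ?_
    rw [norm_mul, norm_mul]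
    have h1 : ‖f j - g j‖ * ‖∏ i ∈ S, f i‖ ≤ ‖f j - g j‖ :=
      mul_le_of_le_one_right (norm_nonneg _) hF
    have h2 : ‖g j‖ * ‖∏ i ∈ S, f i - ∏ i ∈ S, g i‖ ≤ ‖∏ i ∈ S, f i - ∏ i ∈ S, g i‖ :=
      mul_le_of_le_one_left (norm_nonneg _) (hg j)
    linarith

/-- The characteristic function of the standard normal distribution. -/
noncomputable def gaussChar (u : ℝ) : ℂ := (Real.exp (-u ^ 2 / 2) : ℝ)

lemma norm_gaussChar_le (u : ℝ) : ‖gaussChar u‖ ≤ 1 := by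
  rw [gaussChar, Complex.norm_real, Real.norm_of_nonneg (Real.exp_pos _).le]
  refine Real.exp_le_one_iff.2 ?_
  have := sq_nonneg u
  linarith

lemma prod_gaussChar {ι : Type*} (S : Finset ι) (u : ι → ℝ) :
    ∏ i ∈ S, gaussChar (u i) = (Real.exp (-(∑ i ∈ S, u i ^ 2) / 2) : ℝ) := by
  simp only [gaussChar]
  rw [← Complex.ofReal_prod, ← Real.exp_sum]
  congr 3
  rw [← Finset.sum_div, Finset.sum_neg_distrib]

/-- Both functions agree with 1 - u²/2 up to o(u²). Small individual arguments with fixed total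
square then make the summed error small. -/
lemma exists_norm_sub_gaussChar_le {φ : ℝ → ℂ}
    (hT : (fun u : ℝ => φ u - (1 - (u : ℂ) ^ 2 / 2)) =o[𝓝 0] fun u : ℝ => u ^ 2) {ε : ℝ}
    (hε : 0 < ε) : ∃ δ > 0, ∀ u : ℝ, |u| ≤ δ → ‖φ u - gaussChar u‖ ≤ ε * u ^ 2 := by
  have h := hT.def (half_pos hε)
  obtain ⟨δ, hδ, hball⟩ := Metric.eventually_nhds_iff_ball.1 h
  refine ⟨min (δ / 2) (min 1 ε), by positivity, fun u hu => ?_⟩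
  have hu1 : |u| ≤ δ / 2 := hu.trans (min_le_left _ _)
  have hu2 : |u| ≤ 1 := hu.trans ((min_le_right _ _).trans (min_le_left _ _))
  have hu3 : |u| ≤ ε := hu.trans ((min_le_right _ _).trans (min_le_right _ _))
  have h1 := hball u (by rw [Metric.mem_ball, dist_zero_right, Real.norm_eq_abs]; linarith)
  have hsq : u ^ 2 ≤ ε := by
    rw [← sq_abs]; nlinarith [abs_nonneg u]
  have hsq1 : u ^ 2 ≤ 1 := by
    rw [← sq_abs]; nlinarith [abs_nonneg u]
  have h2 : ‖gaussChar u - (1 - (u : ℂ) ^ 2 / 2)‖ ≤ ε / 2 * u ^ 2 := by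
    have e : gaussChar u - (1 - (u : ℂ) ^ 2 / 2) =
        ((Real.exp (-u ^ 2 / 2) - 1 - (-u ^ 2 / 2) : ℝ) : ℂ) := by
      simp only [gaussChar]; push_cast; ring
    rw [e, Complex.norm_real, Real.norm_eq_abs]
    have habs : |-u ^ 2 / 2| ≤ 1 := by
      rw [abs_div, abs_neg, abs_of_nonneg (sq_nonneg u), abs_of_pos two_pos]; linarith
    refine (Real.abs_exp_sub_one_sub_id_le habs).trans ?_
    nlinarith [sq_nonneg u]
  rw [Real.norm_eq_abs, abs_of_nonneg (sq_nonneg u)] at h1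
  calc ‖φ u - gaussChar u‖ =
      ‖(φ u - (1 - (u : ℂ) ^ 2 / 2)) - (gaussChar u - (1 - (u : ℂ) ^ 2 / 2))‖ := by
        congr 1; ring
    _ ≤ ε / 2 * u ^ 2 + ε / 2 * u ^ 2 := (norm_sub_le _ _).trans (add_le_add h1 h2)
    _ = _ := by ring

/-- The central limit theorem for triangular arrays of weights. -/
lemma tendsto_prod_charFun {φ : ℝ → ℂ} (hφ1 : ∀ u, ‖φ u‖ ≤ 1)
    (hT : (fun u : ℝ => φ u - (1 - (u : ℂ) ^ 2 / 2)) =o[𝓝 0] fun u : ℝ => u ^ 2)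
    {ι κ : Type*} {l : Filter κ} {S : κ → Finset ι} {a b : κ → ι → ℝ} {δ : κ → ℝ}
    (h : ∀ᶠ j in l, Orthonormal₂ (S j) (a j) (b j)) (hδ : Tendsto δ l (𝓝 0))
    (ha : ∀ᶠ j in l, ∀ i ∈ S j, |a j i| ≤ δ j) (hb : ∀ᶠ j in l, ∀ i ∈ S j, |b j i| ≤ δ j)
    (s t : ℝ) :
    Tendsto (fun j => ∏ i ∈ S j, φ (a j i * s + b j i * t)) l
      (𝓝 ((Real.exp (-(s ^ 2 + t ^ 2) / 2) : ℝ) : ℂ)) := by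
  rw [Metric.tendsto_nhds]
  intro ε hε
  have hσ : 0 < s ^ 2 + t ^ 2 + 1 := by positivity
  -- The total error is ε (s² + t²)/(s² + t² + 1); the added 1 keeps the inequality strict and the
  -- denominator nonzero.
  obtain ⟨η, hη, hbound⟩ := exists_norm_sub_gaussChar_le hT (div_pos hε hσ)
  have hsmall : ∀ᶠ j in l, δ j * (|s| + |t|) < η := by
    have : Tendsto (fun j => δ j * (|s| + |t|)) l (𝓝 0) := by
      simpa using hδ.mul_const (|s| + |t|)
    exact this.eventually (gt_mem_nhds hη)
  filter_upwards [h, ha, hb, hsmall] with j hj haj hbj hsj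
  rw [dist_eq_norm, ← hj.sum_sq, ← prod_gaussChar]
  refine (norm_prod_sub_prod_le (S j) (fun i => hφ1 _) fun i => norm_gaussChar_le _).trans_lt ?_
  have hterm : ∀ i ∈ S j, ‖φ (a j i * s + b j i * t) - gaussChar (a j i * s + b j i * t)‖ ≤
      ε / (s ^ 2 + t ^ 2 + 1) * (a j i * s + b j i * t) ^ 2 := by
    intro i hi
    refine hbound _ ?_
    calc |a j i * s + b j i * t| ≤ |a j i| * |s| + |b j i| * |t| := by
          rw [← abs_mul, ← abs_mul]; exact abs_add_le _ _
      _ ≤ δ j * |s| + δ j * |t| := by gcongr; exacts [haj i hi, hbj i hi]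
      _ ≤ η := by linarith
  refine (Finset.sum_le_sum hterm).trans_lt ?_
  rw [← Finset.mul_sum, hj.sum_sq, div_mul_eq_mul_div, div_lt_iff₀ hσ]
  nlinarith [sq_nonneg s, sq_nonneg t]

lemma integral_abs_gaussianReal : ∫ x, |x| ∂(gaussianReal 0 1) = 2 / Real.sqrt (2 * Real.pi) := by
  rw [integral_gaussianReal_eq_integral_smul one_ne_zero]
  have h1 : ∀ x : ℝ, gaussianPDFReal 0 1 x • |x| =
      (Real.sqrt (2 * Real.pi))⁻¹ * (|x| * Real.exp (-(1 / 2) * |x| ^ 2)) := by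
    intro x
    rw [gaussianPDFReal, smul_eq_mul, sq_abs]
    simp only [NNReal.coe_one, mul_one, sub_zero]
    rw [show -x ^ 2 / 2 = -(1 / 2) * x ^ 2 by ring]
    ring
  simp_rw [h1]
  rw [integral_const_mul, integral_comp_abs (f := fun x => x * Real.exp (-(1 / 2) * x ^ 2))]
  have h2 : ∫ x in Ioi (0 : ℝ), x * Real.exp (-(1 / 2) * x ^ 2) = 1 := by
    have h3 := integral_mul_cexp_neg_mul_sq (b := 1 / 2) (by norm_num)
    have h4 : ∀ x : ℝ, (x : ℂ) * Complex.exp (-(1 / 2) * (x : ℂ) ^ 2) =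
        ((x * Real.exp (-(1 / 2) * x ^ 2) : ℝ) : ℂ) := by
      intro x; push_cast; rfl
    simp_rw [h4] at h3
    rw [integral_complex_ofReal] at h3
    have h5 : (2 * (1 / 2 : ℂ))⁻¹ = ((1 : ℝ) : ℂ) := by norm_num
    rw [h5] at h3
    exact_mod_cast h3
  rw [h2]
  ring

lemma integral_cos_gaussianReal (t : ℝ) :
    ∫ x, (1 - Real.cos (t * x)) * 1 ∂(gaussianReal 0 1) = 1 - Real.exp (-t ^ 2 / 2) := by
  have hint : Integrable (fun x : ℝ => Complex.exp (t * x * Complex.I)) (gaussianReal 0 1) := by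
    refine Integrable.of_bound (C := 1) (by fun_prop) (ae_of_all _ fun x => ?_)
    rw [← Complex.ofReal_mul, Complex.norm_exp_ofReal_mul_I]
  have hcos : ∫ x, Real.cos (t * x) ∂(gaussianReal 0 1) = Real.exp (-t ^ 2 / 2) := by
    have h1 := charFun_gaussianReal (μ := 0) (v := 1) t
    rw [charFun_apply_real] at h1
    have h2 := integral_re hint
    simp only [RCLike.re_eq_complex_re, ← Complex.ofReal_mul, Complex.exp_ofReal_mul_I_re] at h2
    simp only [← Complex.ofReal_mul] at h1
    rw [h2, h1]
    have h3 : ((t * 0 : ℝ) : ℂ) * Complex.I - ((1 : NNReal) : ℝ) * (t : ℂ) ^ 2 / 2 =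
        ((-t ^ 2 / 2 : ℝ) : ℂ) := by push_cast; ring
    rw [h3, ← Complex.ofReal_exp, Complex.ofReal_re]
  have hcint : Integrable (fun x : ℝ => Real.cos (t * x)) (gaussianReal 0 1) := by
    refine Integrable.of_bound (C := 1) (by fun_prop) (ae_of_all _ fun x => ?_)
    exact Real.abs_cos_le_one _
  simp_rw [mul_one]
  rw [integral_sub (integrable_const _) hcint, hcos]
  simp

/-- The moment identity applied to a standard normal Z gives K E|Z| with E|Z| = 2/√(2π); the
s-integral contributes √(2π). -/
lemma integral_gaussian_kacRice :
    ∫ t : ℝ, (∫ s : ℝ, (((Real.exp (-s ^ 2 / 2) * (1 - Real.exp (-t ^ 2 / 2))) : ℝ) : ℂ)) /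
      (t : ℂ) ^ 2 = ((2 * cosConst : ℝ) : ℂ) := by
  have h := integral_expectation_one_sub_cos (P := gaussianReal 0 1) (V := id) (R := fun _ => 1)
    (M := 1) measurable_id ((memLp_id_gaussianReal 1).integrable (by norm_num))
    measurable_const (by simp)
  simp only [id, mul_one] at h
  have hc := integral_cos_gaussianReal
  simp only [mul_one] at hc
  simp_rw [hc] at h
  rw [integral_abs_gaussianReal] at h
  have hs : ∫ s : ℝ, Real.exp (-s ^ 2 / 2) = Real.sqrt (2 * Real.pi) := by
    have := integral_gaussian (1 / 2)
    rw [show Real.pi / (1 / 2) = 2 * Real.pi by ring] at this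
    rw [← this]
    congr 1
    ext s
    congr 1
    ring
  have hpt : ∀ t : ℝ, (∫ s : ℝ, (((Real.exp (-s ^ 2 / 2) * (1 - Real.exp (-t ^ 2 / 2))) : ℝ) : ℂ)) /
      (t : ℂ) ^ 2 = ((Real.sqrt (2 * Real.pi) * ((1 - Real.exp (-t ^ 2 / 2)) / t ^ 2) : ℝ) : ℂ) := by
    intro t
    rw [integral_complex_ofReal, integral_mul_const, hs]
    push_cast
    ring
  simp_rw [hpt]
  rw [integral_complex_ofReal, integral_const_mul, h]
  congr 1
  have : Real.sqrt (2 * Real.pi) ≠ 0 := (Real.sqrt_pos.2 (by positivity)).ne'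
  field_simp

/-- The limit of the Kac-Rice integral in the Gaussian regime. -/
theorem CharDecay.tendsto_kacRiceInt {φ φ₁ φ₂ : ℝ → ℂ} {C₁ C₂ : ℝ}
    (hφ : CharDecay φ φ₁ φ₂ C₁ C₂)
    (hT : (fun u : ℝ => φ u - (1 - (u : ℂ) ^ 2 / 2)) =o[𝓝 0] fun u : ℝ => u ^ 2)
    {ι κ : Type*} {l : Filter κ} [l.IsCountablyGenerated] {S : κ → Finset ι} {a b : κ → ι → ℝ}
    {δ : κ → ℝ} (h : ∀ᶠ j in l, Orthonormal₂ (S j) (a j) (b j)) (hδ : Tendsto δ l (𝓝 0))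
    (ha : ∀ᶠ j in l, ∀ i ∈ S j, |a j i| ≤ δ j) (hb : ∀ᶠ j in l, ∀ i ∈ S j, |b j i| ≤ δ j) :
    Tendsto (fun j => kacRiceInt φ (S j) (a j) (b j)) l (𝓝 ((2 * cosConst : ℝ) : ℂ)) := by
  rw [← integral_gaussian_kacRice]
  have hdiff : ∀ s t : ℝ, Tendsto (fun j => prodDiff φ (S j) (a j) (b j) s t) l
      (𝓝 (((Real.exp (-s ^ 2 / 2) * (1 - Real.exp (-t ^ 2 / 2))) : ℝ) : ℂ)) := by
    intro s t
    have h0 := tendsto_prod_charFun hφ.norm_le_one hT h hδ ha hb s 0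
    have h1 := tendsto_prod_charFun hφ.norm_le_one hT h hδ ha hb s t
    have h2 := tendsto_prod_charFun hφ.norm_le_one hT h hδ ha hb s (-t)
    have h3 := h0.sub ((h1.add h2).div_const 2)
    have e : Real.exp (-s ^ 2 / 2) * (1 - Real.exp (-t ^ 2 / 2)) =
        Real.exp (-(s ^ 2 + 0 ^ 2) / 2) - Real.exp (-(s ^ 2 + t ^ 2) / 2) := by
      rw [mul_sub, mul_one, ← Real.exp_add]
      congr 2 <;> ring
    rw [neg_sq, add_self_div_two, ← Complex.ofReal_sub, ← e] at h3
    exact h3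
  refine tendsto_integral_filter_of_dominated_convergence
    (fun t => 2 * ((C₂ + C₂ ^ 2 / C₁ + 2) * ∫ s : ℝ, (1 + C₁ * s ^ 2)⁻¹) * (1 + t ^ 2)⁻¹)
    ?_ ?_ (integrable_inv_one_add_sq.const_mul _) ?_
  · refine Eventually.of_forall fun j => ?_
    have hm : StronglyMeasurable fun t : ℝ => ∫ s : ℝ, prodDiff φ (S j) (a j) (b j) s t :=
      (hφ.continuous_prodDiff (S j) (a j) (b j)).stronglyMeasurable.integral_prod_left
    exact (hm.measurable.div (by fun_prop)).aestronglyMeasurable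
  · filter_upwards [h] with j hj
    exact ae_of_all _ fun t => hφ.integral_prodDiff_le hj t
  · refine ae_of_all _ fun t => Tendsto.div_const ?_ _
    refine tendsto_integral_filter_of_dominated_convergence
      (fun s => 2 * (1 + C₁ * s ^ 2)⁻¹) ?_ ?_
      ((integrable_inv_one_add_mul_sq hφ.κ_pos).const_mul _) ?_
    · refine Eventually.of_forall fun j => Continuous.aestronglyMeasurable ?_
      exact (hφ.continuous_prodDiff (S j) (a j) (b j)).comp (by fun_prop : Continuous fun s : ℝ => (s, t))
    · filter_upwards [h] with j hj
      exact ae_of_all _ fun s => hφ.norm_prodDiff_le hj s t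
    · exact ae_of_all _ fun s => hdiff s t

end

/-! ### Binomial distributions and the orthonormal weights -/

section

/-- Binomial probabilities. -/
noncomputable def binProb (p : ℝ) (n k : ℕ) : ℝ := n.choose k * p ^ k * (1 - p) ^ (n - k)

/-- Binomial expectations. -/
noncomputable def binMean (p : ℝ) (n : ℕ) (g : ℕ → ℝ) : ℝ :=
  ∑ k ∈ Finset.range (n + 1), binProb p n k * g k

section Binomial

variable {p : ℝ}

lemma binProb_nonneg (h0 : 0 ≤ p) (h1 : p ≤ 1) (n k : ℕ) : 0 ≤ binProb p n k := by
  have : 0 ≤ 1 - p := by linarith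
  unfold binProb
  positivity

lemma binProb_of_lt {n k : ℕ} (h : n < k) : binProb p n k = 0 := by
  simp [binProb, Nat.choose_eq_zero_of_lt h]

lemma binProb_succ_zero (n : ℕ) : binProb p (n + 1) 0 = (1 - p) * binProb p n 0 := by
  simp [binProb, pow_succ, mul_comm]

/-- The extra factor 1 - p raises the truncated exponent n - (k+1) to n - k; the boundary case is
absorbed by a vanishing binomial coefficient. -/
lemma binProb_mul (n k : ℕ) :
    (1 - p) * binProb p n (k + 1) = n.choose (k + 1) * p ^ (k + 1) * (1 - p) ^ (n - k) := by
  rcases lt_or_ge k n with h | h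
  · obtain ⟨m, rfl⟩ := Nat.exists_eq_add_of_lt h
    simp only [binProb, show k + m + 1 - (k + 1) = m by omega, show k + m + 1 - k = m + 1 by omega]
    ring
  · rw [binProb_of_lt (by omega), Nat.choose_eq_zero_of_lt (by omega)]
    simp

lemma binProb_succ_succ (n k : ℕ) :
    binProb p (n + 1) (k + 1) = (1 - p) * binProb p n (k + 1) + p * binProb p n k := by
  rw [binProb_mul]
  simp only [binProb, Nat.choose_succ_succ, Nat.add_sub_add_right]
  push_cast
  ring

lemma binProb_ratio (n k : ℕ) :
    ((k : ℝ) + 1) * ((1 - p) * binProb p n (k + 1)) = ((n : ℝ) - k) * (p * binProb p n k) := by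
  rw [binProb_mul]
  rcases le_or_gt k n with h | h
  · have := Nat.choose_succ_right_eq n k
    have h2 : (n.choose (k + 1) : ℝ) * (k + 1) = n.choose k * (n - k) := by
      rw [← Nat.cast_sub h]
      exact_mod_cast this
    simp only [binProb]
    linear_combination p ^ (k + 1) * (1 - p) ^ (n - k) * h2
  · rw [binProb_of_lt h, Nat.choose_eq_zero_of_lt (by omega)]
    simp

/-- Conditioning on one Bernoulli trial; all the central moments follow from this by induction on n.
-/
lemma binMean_succ (n : ℕ) (g : ℕ → ℝ) :
    binMean p (n + 1) g = (1 - p) * binMean p n g + p * binMean p n (fun k => g (k + 1)) := by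
  have h1 : binMean p n g = ∑ k ∈ Finset.range (n + 2), binProb p n k * g k := by
    rw [Finset.sum_range_succ, binProb_of_lt (Nat.lt_succ_self n), zero_mul, add_zero, binMean]
  rw [h1]
  unfold binMean
  rw [Finset.sum_range_succ', Finset.sum_range_succ' (n := n + 1), binProb_succ_zero]
  simp_rw [binProb_succ_succ]
  rw [mul_add, Finset.mul_sum, Finset.mul_sum]
  simp_rw [add_mul]
  rw [Finset.sum_add_distrib]
  simp_rw [mul_assoc]
  ring

lemma binMean_congr {n : ℕ} {g g' : ℕ → ℝ} (h : ∀ k, g k = g' k) : binMean p n g = binMean p n g' := by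
  rw [funext h]

lemma binMean_add (n : ℕ) (g g' : ℕ → ℝ) :
    binMean p n (fun k => g k + g' k) = binMean p n g + binMean p n g' := by
  simp only [binMean, mul_add, Finset.sum_add_distrib]

lemma binMean_const_mul (n : ℕ) (a : ℝ) (g : ℕ → ℝ) :
    binMean p n (fun k => a * g k) = a * binMean p n g := by
  simp only [binMean, Finset.mul_sum]
  exact Finset.sum_congr rfl fun k _ => by ring

lemma binMean_one (n : ℕ) : binMean p n (fun _ => 1) = 1 := by
  induction n with
  | zero => simp [binMean, binProb]
  | succ n ih => rw [binMean_succ, ih]; ring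

lemma binMean_succ_centered (n : ℕ) (f : ℝ → ℝ) :
    binMean p (n + 1) (fun k => f (k - (n + 1 : ℕ) * p)) =
      binMean p n (fun k => (1 - p) * f ((k - n * p) - p) + p * f ((k - n * p) + (1 - p))) := by
  rw [binMean_succ, binMean_add, binMean_const_mul, binMean_const_mul]
  congr 2
  · refine binMean_congr fun k => ?_
    congr 1; push_cast; ring
  · refine binMean_congr fun k => ?_
    congr 1; push_cast; ring

lemma binMean_centered (n : ℕ) : binMean p n (fun k => k - n * p) = 0 := by
  induction n with
  | zero => simp [binMean, binProb]
  | succ n ih =>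
    rw [binMean_succ_centered n fun t => t, ← ih]
    exact binMean_congr fun k => by ring

lemma binMean_centered_sq (n : ℕ) :
    binMean p n (fun k => (k - n * p) ^ 2) = n * (p * (1 - p)) := by
  induction n with
  | zero => simp [binMean, binProb]
  | succ n ih =>
    rw [binMean_succ_centered n fun t => t ^ 2,
      binMean_congr (g' := fun k => (k - n * p) ^ 2 + p * (1 - p) * 1) fun k => by ring,
      binMean_add, ih, binMean_const_mul, binMean_one]
    push_cast
    ring

lemma binMean_centered_four_le (h0 : 0 ≤ p) (h1 : p ≤ 1) (n : ℕ) :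
    binMean p n (fun k => (k - n * p) ^ 4) ≤
      3 * (n * (p * (1 - p))) ^ 2 + n * (p * (1 - p)) := by
  induction n with
  | zero => simp [binMean, binProb]
  | succ n ih =>
    have hv : 0 ≤ p * (1 - p) := mul_nonneg h0 (by linarith)
    rw [binMean_succ_centered n fun t => t ^ 4,
      binMean_congr (g' := fun k => ((k - n * p) ^ 4 + 6 * (p * (1 - p)) * (k - n * p) ^ 2) +
        (4 * (p * (1 - p)) * (1 - 2 * p) * (k - n * p) +
          p * (1 - p) * (1 - 3 * (p * (1 - p))) * 1)) fun k => by ring,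
      binMean_add, binMean_add, binMean_add, binMean_const_mul, binMean_const_mul,
      binMean_const_mul, binMean_one, binMean_centered, binMean_centered_sq]
    push_cast
    nlinarith [mul_nonneg hv hv]

/-- De Moivre's identity: by `binProb_ratio` the truncated centered first moment telescopes to a
single atom. An atom is therefore controlled by the mean absolute deviation, hence by the standard
deviation. -/
lemma binProb_mul_variance (n k : ℕ) :
    ((n : ℝ) + 1) * (p * (1 - p)) * binProb p n k =
      ∑ j ∈ Finset.range (k + 1), binProb p (n + 1) j * (((n : ℝ) + 1) * p - j) := by
  induction k with
  | zero => simp [binProb_succ_zero]; ring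
  | succ k ih =>
    rw [Finset.sum_range_succ, ← ih, binProb_succ_succ]
    push_cast
    linear_combination binProb_ratio (p := p) n k

lemma binMean_abs_le (h0 : 0 ≤ p) (h1 : p ≤ 1) (n : ℕ) :
    (binMean p n fun k => |k - n * p|) ^ 2 ≤ n * (p * (1 - p)) := by
  have h := Finset.sum_sq_le_sum_mul_sum_of_sq_le_mul (Finset.range (n + 1))
    (r := fun k => binProb p n k * |(k : ℝ) - n * p|) (f := fun k => binProb p n k * 1)
    (g := fun k => binProb p n k * ((k : ℝ) - n * p) ^ 2)
    (fun k _ => mul_nonneg (binProb_nonneg h0 h1 n k) zero_le_one)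
    (fun k _ => mul_nonneg (binProb_nonneg h0 h1 n k) (sq_nonneg _))
    (fun k _ => le_of_eq (by rw [mul_pow, sq_abs]; ring))
  have h2 := binMean_one (p := p) n
  have h3 := binMean_centered_sq (p := p) n
  unfold binMean at h2 h3 ⊢
  rwa [h2, h3, one_mul] at h

/-- The binomial distribution with large variance has small atoms. -/
lemma binProb_sq_mul_le (h0 : 0 ≤ p) (h1 : p ≤ 1) (n k : ℕ) :
    binProb p n k ^ 2 * (n * (p * (1 - p))) ≤ 1 := by
  rcases lt_or_ge n k with hk | hk
  · simp [binProb_of_lt hk]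
  have hv : 0 ≤ p * (1 - p) := mul_nonneg h0 (by linarith)
  have hle : ((n : ℝ) + 1) * (p * (1 - p)) * binProb p n k ≤
      binMean p (n + 1) fun k => |k - (n + 1 : ℕ) * p| := by
    rw [binProb_mul_variance]
    calc ∑ j ∈ Finset.range (k + 1), binProb p (n + 1) j * (((n : ℝ) + 1) * p - j) ≤
        ∑ j ∈ Finset.range (k + 1), binProb p (n + 1) j * |(j : ℝ) - (n + 1 : ℕ) * p| := by
          refine Finset.sum_le_sum fun j _ => mul_le_mul_of_nonneg_left ?_
            (binProb_nonneg h0 h1 _ _)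
          rw [abs_sub_comm]
          push_cast
          exact le_abs_self _
      _ ≤ _ := Finset.sum_le_sum_of_subset_of_nonneg
          (Finset.range_subset_range.2 (by omega))
          fun j _ _ => mul_nonneg (binProb_nonneg h0 h1 _ _) (abs_nonneg _)
  have hw := binProb_nonneg h0 h1 n k
  have hn : (0 : ℝ) ≤ n := Nat.cast_nonneg n
  have hsq := (pow_le_pow_left₀ (by positivity) hle 2).trans (binMean_abs_le h0 h1 (n + 1))
  push_cast at hsq
  rcases eq_or_lt_of_le hv with hv0 | hvpos
  · rw [← hv0]; simp
  · have hpos : 0 < ((n : ℝ) + 1) * (p * (1 - p)) := by positivity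
    have h3 : ((n : ℝ) + 1) * (p * (1 - p)) * binProb p n k ^ 2 ≤ 1 := by
      refine le_of_mul_le_mul_left ?_ hpos
      calc _ = (((n : ℝ) + 1) * (p * (1 - p)) * binProb p n k) ^ 2 := by ring
        _ ≤ _ := hsq
        _ = _ := by ring
    have : 0 ≤ p * (1 - p) * binProb p n k ^ 2 := by positivity
    nlinarith

lemma binProb_mul_four_le (h0 : 0 ≤ p) (h1 : p ≤ 1) {n k : ℕ} :
    binProb p n k * (k - n * p) ^ 4 ≤ 3 * (n * (p * (1 - p))) ^ 2 + n * (p * (1 - p)) := by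
  have hv : 0 ≤ p * (1 - p) := mul_nonneg h0 (by linarith)
  rcases lt_or_ge n k with hk | hk
  · rw [binProb_of_lt hk, zero_mul]; positivity
  refine le_trans ?_ (binMean_centered_four_le h0 h1 n)
  exact Finset.single_le_sum (f := fun k : ℕ => binProb p n k * ((k : ℝ) - n * p) ^ 4)
    (fun j _ => mul_nonneg (binProb_nonneg h0 h1 _ _) (by positivity))
    (Finset.mem_range.2 (by omega))

end Binomial

/-- The coefficients of the binomial random polynomial. -/
noncomputable def binCoeff (n k : ℕ) : ℝ := Real.sqrt (n.choose k)

lemma binCoeff_zero (n : ℕ) : binCoeff n 0 = 1 := by simp [binCoeff]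

lemma binCoeff_of_lt {n k : ℕ} (h : n < k) : binCoeff n k = 0 := by
  simp [binCoeff, Nat.choose_eq_zero_of_lt h]

/-- The limiting variance parameter. -/
noncomputable def binVar (n : ℕ) (x : ℝ) : ℝ := n * x ^ 2 / (1 + x ^ 2) ^ 2

section Weights

variable (n : ℕ) (x : ℝ)

/-- The weights of the normalized polynomial. -/
noncomputable def valWeight (k : ℕ) : ℝ :=
  1 / Real.sqrt ((1 + x ^ 2) ^ n) * (binCoeff n k * x ^ k)

/-- The weights of the normalized derivative. -/
noncomputable def derivWeight (k : ℕ) : ℝ :=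
  (1 + x ^ 2) / Real.sqrt n * (-(n * x / (1 + x ^ 2)) * (1 / Real.sqrt ((1 + x ^ 2) ^ n)) *
    (binCoeff n k * x ^ k) + 1 / Real.sqrt ((1 + x ^ 2) ^ n) * (binCoeff n k * (k * x ^ (k - 1))))

lemma prob_nonneg : 0 ≤ x ^ 2 / (1 + x ^ 2) := by positivity

lemma prob_le_one : x ^ 2 / (1 + x ^ 2) ≤ 1 := by
  rw [div_le_one (by positivity)]; linarith

lemma binVar_eq : (n : ℝ) * (x ^ 2 / (1 + x ^ 2) * (1 - x ^ 2 / (1 + x ^ 2))) = binVar n x := by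
  have : 1 + x ^ 2 ≠ 0 := by positivity
  unfold binVar
  field_simp
  ring

lemma valWeight_sq (k : ℕ) : valWeight n x k ^ 2 = binProb (x ^ 2 / (1 + x ^ 2)) n k := by
  rcases lt_or_ge n k with hk | hk
  · simp [binProb_of_lt hk, valWeight, binCoeff_of_lt hk]
  have h1 : 0 < 1 + x ^ 2 := by positivity
  have hq : 1 - x ^ 2 / (1 + x ^ 2) = 1 / (1 + x ^ 2) := by field_simp; ring
  unfold valWeight binProb binCoeff
  rw [hq, mul_pow, div_pow, Real.sq_sqrt (by positivity), mul_pow, Real.sq_sqrt (by positivity),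
    div_pow, div_pow, one_pow, one_pow]
  have : (1 + x ^ 2) ^ n = (1 + x ^ 2) ^ k * (1 + x ^ 2) ^ (n - k) := by
    rw [← pow_add]; congr 1; omega
  rw [this]
  field_simp
  ring

variable {n x}

/-- The logarithmic derivative of x^k (1+x²)^{-n/2} is (k - np)/x with p = x²/(1+x²). Orthonormality
thus becomes the statement that the standardized binomial has mean 0 and variance 1. The divisor is
the standard deviation with the sign of x. -/
lemma derivWeight_eq (hn : n ≠ 0) (hx : x ≠ 0) (k : ℕ) : derivWeight n x k =
    valWeight n x k * ((k - n * (x ^ 2 / (1 + x ^ 2))) / (Real.sqrt n * x / (1 + x ^ 2))) := by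
  have h1 : 1 + x ^ 2 ≠ 0 := by positivity
  have h2 : Real.sqrt n ≠ 0 := (Real.sqrt_pos.2 (by positivity)).ne'
  have h3 : Real.sqrt ((1 + x ^ 2) ^ n) ≠ 0 := (Real.sqrt_pos.2 (by positivity)).ne'
  have h4 : (k : ℝ) * x ^ (k - 1) = k * x ^ k / x := by
    rcases Nat.eq_zero_or_pos k with rfl | hk
    · simp
    · obtain ⟨m, rfl⟩ := Nat.exists_eq_add_of_lt hk
      simp only [zero_add, Nat.add_sub_cancel, pow_succ]
      field_simp
  unfold derivWeight valWeight
  rw [h4]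
  field_simp
  ring

lemma sq_sd : (Real.sqrt n * x / (1 + x ^ 2)) ^ 2 = binVar n x := by
  unfold binVar
  rw [div_pow, mul_pow, Real.sq_sqrt (Nat.cast_nonneg n)]

lemma binVar_pos (hn : n ≠ 0) (hx : x ≠ 0) : 0 < binVar n x := by
  unfold binVar; positivity

lemma derivWeight_sq (hn : n ≠ 0) (hx : x ≠ 0) (k : ℕ) : derivWeight n x k ^ 2 =
    binProb (x ^ 2 / (1 + x ^ 2)) n k * (k - n * (x ^ 2 / (1 + x ^ 2))) ^ 2 / binVar n x := by
  rw [derivWeight_eq hn hx, mul_pow, valWeight_sq, div_pow, sq_sd]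
  ring

lemma orthonormal_weights (hn : n ≠ 0) (hx : x ≠ 0) :
    Orthonormal₂ (Finset.range (n + 1)) (valWeight n x) (derivWeight n x) where
  sq_left := by
    have := binMean_one (p := x ^ 2 / (1 + x ^ 2)) n
    simp_rw [valWeight_sq]
    simpa [binMean] using this
  sq_right := by
    simp_rw [derivWeight_sq hn hx]
    rw [← Finset.sum_div]
    have := binMean_centered_sq (p := x ^ 2 / (1 + x ^ 2)) n
    rw [binVar_eq] at this
    unfold binMean at this
    rw [this, div_self (binVar_pos hn hx).ne']
  inner := by
    have h : ∀ k, valWeight n x k * derivWeight n x k =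
        binProb (x ^ 2 / (1 + x ^ 2)) n k * (k - n * (x ^ 2 / (1 + x ^ 2))) /
          (Real.sqrt n * x / (1 + x ^ 2)) := by
      intro k
      rw [derivWeight_eq hn hx, ← mul_assoc, ← sq, valWeight_sq]
      ring
    simp_rw [h]
    rw [← Finset.sum_div]
    have := binMean_centered (p := x ^ 2 / (1 + x ^ 2)) n
    unfold binMean at this
    rw [this, zero_div]

/-- The common bound of the weights. -/
noncomputable def weightBound (v : ℝ) : ℝ := (16 / v) ^ (1 / 8 : ℝ)

lemma tendsto_weightBound : Tendsto weightBound atTop (𝓝 0) := by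
  have h1 : Tendsto (fun v : ℝ => 16 / v) atTop (𝓝 0) := tendsto_const_nhds.div_atTop tendsto_id
  have h2 := h1.rpow_const (p := 1 / 8) (Or.inr (by norm_num))
  rwa [Real.zero_rpow (by norm_num)] at h2

lemma abs_le_weightBound {a v : ℝ} (hv : 0 < v) (h : a ^ 8 ≤ 16 / v) : |a| ≤ weightBound v := by
  have h8 : weightBound v ^ 8 = 16 / v := by
    unfold weightBound
    rw [← Real.rpow_natCast, ← Real.rpow_mul (by positivity)]
    norm_num
  refine le_of_pow_le_pow_left₀ (n := 8) (by norm_num) (Real.rpow_nonneg (by positivity) _) ?_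
  rw [h8, pow_abs, abs_of_nonneg (by positivity)]
  exact h

lemma abs_valWeight_le (hv : 1 ≤ binVar n x) (k : ℕ) :
    |valWeight n x k| ≤ weightBound (binVar n x) := by
  have hv0 : 0 < binVar n x := by linarith
  have h := binProb_sq_mul_le (prob_nonneg x) (prob_le_one x) n k
  rw [binVar_eq, ← le_div_iff₀ hv0] at h
  refine abs_le_weightBound hv0 ?_
  have hp := binProb_nonneg (prob_nonneg x) (prob_le_one x) n k
  have hd : 1 / binVar n x ≤ 1 := by rw [div_le_one hv0]; exact hv
  have hd0 : 0 < 1 / binVar n x := by positivity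
  calc valWeight n x k ^ 8 = (binProb (x ^ 2 / (1 + x ^ 2)) n k ^ 2) ^ 2 := by
        rw [← valWeight_sq]; ring
    _ ≤ (1 / binVar n x) ^ 2 := by gcongr
    _ ≤ 16 / binVar n x := by
        rw [show 16 / binVar n x = 16 * (1 / binVar n x) by ring]
        nlinarith

lemma abs_derivWeight_le (hn : n ≠ 0) (hx : x ≠ 0) (hv : 1 ≤ binVar n x) (k : ℕ) :
    |derivWeight n x k| ≤ weightBound (binVar n x) := by
  have hv0 : 0 < binVar n x := by linarith
  have h := binProb_sq_mul_le (prob_nonneg x) (prob_le_one x) n k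
  have h4 := binProb_mul_four_le (prob_nonneg x) (prob_le_one x) (n := n) (k := k)
  rw [binVar_eq] at h h4
  refine abs_le_weightBound hv0 ?_
  have hd := derivWeight_sq hn hx k
  set w := binProb (x ^ 2 / (1 + x ^ 2)) n k
  set T := (k : ℝ) - n * (x ^ 2 / (1 + x ^ 2))
  set v := binVar n x
  have hp : 0 ≤ w := binProb_nonneg (prob_nonneg x) (prob_le_one x) n k
  -- The fourth-moment bound 3v² + v is at most 4v² because v ≥ 1. In the eighth power, one factor
  -- w² is spent on the atom bound and the other on this one.
  have h5 : w * T ^ 4 ≤ 4 * v ^ 2 := by nlinarith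
  have h6 : 0 ≤ w * T ^ 4 := by positivity
  have e : derivWeight n x k ^ 8 = (w ^ 2 * v) * (w * T ^ 4) ^ 2 / v ^ 5 := by
    rw [show derivWeight n x k ^ 8 = (derivWeight n x k ^ 2) ^ 4 by ring, hd]
    field_simp
  rw [e, div_le_div_iff₀ (by positivity) hv0]
  calc w ^ 2 * v * (w * T ^ 4) ^ 2 * v ≤ 1 * (4 * v ^ 2) ^ 2 * v := by gcongr
    _ = 16 * v ^ 5 := by ring

end Weights

end

/-! ### Convergence of coefficients and identification of the random functions -/

section

/-- The coefficients of the limiting random series. -/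
noncomputable def limCoeff (k : ℕ) : ℝ := 1 / Real.sqrt (k.factorial)

/-- The coefficients of the rescaled random polynomial. -/
noncomputable def scaledCoeff (n k : ℕ) : ℝ := binCoeff n k / Real.sqrt n ^ k

section Coefficients

lemma sqrt_pow_eq {z : ℝ} (hz : 0 ≤ z) (k : ℕ) : Real.sqrt (z ^ k) = Real.sqrt z ^ k := by
  induction k with
  | zero => simp
  | succ k ih => rw [pow_succ, pow_succ, Real.sqrt_mul (pow_nonneg hz k), ih]

lemma coeffBound_limCoeff : CoeffBound 1 limCoeff := fun k => by
  rw [limCoeff, one_pow, abs_of_nonneg (by positivity)]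

lemma coeffBound_binCoeff (n : ℕ) : CoeffBound (Real.sqrt n) (binCoeff n) := fun k => by
  rw [binCoeff, abs_of_nonneg (Real.sqrt_nonneg _), ← sqrt_pow_eq (Nat.cast_nonneg n),
    ← Real.sqrt_div (by positivity)]
  exact Real.sqrt_le_sqrt (Nat.choose_le_pow_div k n)

/-- The inequality C(n,k) ≤ n^k/k! gives one bound for all n, as dominated convergence requires. -/
lemma coeffBound_scaledCoeff (n : ℕ) : CoeffBound 1 (scaledCoeff n) := fun k => by
  have h := coeffBound_binCoeff n k
  rw [scaledCoeff, abs_div, abs_of_nonneg (pow_nonneg (Real.sqrt_nonneg n) k), one_pow]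
  refine div_le_of_le_mul₀ (by positivity) (by positivity) ?_
  rwa [one_div_mul_eq_div]

lemma tendsto_scaledCoeff (k : ℕ) :
    Tendsto (fun n => scaledCoeff n k) atTop (𝓝 (limCoeff k)) := by
  have h1 : Tendsto (fun n : ℕ => (n : ℝ) * (1 / n)) atTop (𝓝 1) := by
    refine tendsto_const_nhds.congr' ?_
    filter_upwards [eventually_ne_atTop 0] with n hn
    field_simp
  have h2 := (tendsto_choose_mul_pow_atTop k h1).sqrt
  rw [one_pow, Real.sqrt_div zero_le_one, Real.sqrt_one] at h2
  refine h2.congr fun n => ?_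
  rw [scaledCoeff, binCoeff, ← sqrt_pow_eq (Nat.cast_nonneg n), ← Real.sqrt_div (by positivity)]
  congr 1
  rw [div_pow, one_pow, mul_one_div]

lemma ser_scaledCoeff (n : ℕ) (y : ℝ) (ζ : ℕ → ℝ) :
    ser (scaledCoeff n) y ζ = ser (binCoeff n) (y / Real.sqrt n) ζ :=
  tsum_congr fun k => by rw [scaledCoeff, div_pow]; ring

lemma serDeriv_scaledCoeff {n : ℕ} (hn : n ≠ 0) (y : ℝ) (ζ : ℕ → ℝ) :
    serDeriv (scaledCoeff n) y ζ = serDeriv (binCoeff n) (y / Real.sqrt n) ζ / Real.sqrt n := by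
  rw [serDeriv, serDeriv, ← tsum_div_const]
  refine tsum_congr fun k => ?_
  have h2 : Real.sqrt n ≠ 0 := (Real.sqrt_pos.2 (by positivity)).ne'
  rcases Nat.eq_zero_or_pos k with rfl | hk
  · simp
  · obtain ⟨m, rfl⟩ := Nat.exists_eq_add_of_lt hk
    rw [scaledCoeff, div_pow]
    simp only [zero_add, Nat.add_sub_cancel, pow_succ]
    field_simp

lemma mWeight_mul (k : ℕ) (y z : ℝ) :
    mWeight k y * z = Real.exp (-y ^ 2 / 2) * (limCoeff k * y ^ k * z) := by
  unfold mWeight limCoeff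
  ring

lemma lWeight_mul (k : ℕ) (y z : ℝ) :
    lWeight k y * z = -y * Real.exp (-y ^ 2 / 2) * (limCoeff k * y ^ k * z) +
      Real.exp (-y ^ 2 / 2) * (limCoeff k * (k * y ^ (k - 1)) * z) := by
  unfold lWeight limCoeff
  ring

end Coefficients

section Functions

variable {Ω : Type*} {c : ℕ → Ω → ℝ}

lemma limitG_eq (c : ℕ → Ω → ℝ) (y : ℝ) (ω : Ω) :
    limitG c y ω = Real.exp (-y ^ 2 / 2) * ser limCoeff y (c · ω) := by
  simp_rw [limitG, mWeight_mul, tsum_mul_left, ser]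

lemma limitH_eq {ω : Ω} (hω : Tame (c · ω)) (y : ℝ) :
    limitH c y ω = -y * Real.exp (-y ^ 2 / 2) * ser limCoeff y (c · ω) +
      Real.exp (-y ^ 2 / 2) * serDeriv limCoeff y (c · ω) := by
  simp_rw [limitH, lWeight_mul]
  rw [((summable_ser zero_le_one coeffBound_limCoeff hω y).mul_left _).tsum_add
    ((summable_serDeriv zero_le_one coeffBound_limCoeff hω y).mul_left _),
    tsum_mul_left, tsum_mul_left, ser, serDeriv]

lemma summable_mWeight {ω : Ω} (hω : Tame (c · ω)) (y : ℝ) :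
    Summable fun k => mWeight k y * c k ω := by
  simp_rw [mWeight_mul]
  exact (summable_ser zero_le_one coeffBound_limCoeff hω y).mul_left _

lemma summable_lWeight {ω : Ω} (hω : Tame (c · ω)) (y : ℝ) :
    Summable fun k => lWeight k y * c k ω := by
  simp_rw [lWeight_mul]
  exact ((summable_ser zero_le_one coeffBound_limCoeff hω y).mul_left _).add
    ((summable_serDeriv zero_le_one coeffBound_limCoeff hω y).mul_left _)

lemma hasDerivAt_limitG {ω : Ω} (hω : Tame (c · ω)) (y : ℝ) :
    HasDerivAt (fun t => limitG c t ω) (limitH c y ω) y := by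
  simp_rw [limitG_eq, limitH_eq hω]
  have h1 : HasDerivAt (fun t : ℝ => Real.exp (-t ^ 2 / 2)) (-y * Real.exp (-y ^ 2 / 2)) y := by
    convert! (((hasDerivAt_id y).pow 2).neg.div_const 2).exp using 1
    simp
    ring
  exact h1.mul (hasDerivAt_ser zero_le_one coeffBound_limCoeff hω y)

lemma poly_eq_ser (c : ℕ → Ω → ℝ) (n : ℕ) (x : ℝ) (ω : Ω) :
    poly c n x ω = ser (binCoeff n) x (c · ω) := by
  rw [ser_eq_sum (n := n) fun k hk => binCoeff_of_lt hk]
  exact Finset.sum_congr rfl fun k _ => by rw [binCoeff]; ring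

lemma polyDeriv_eq_serDeriv (n : ℕ) (x : ℝ) {ω : Ω} (hω : Tame (c · ω)) :
    polyDeriv c n x ω = serDeriv (binCoeff n) x (c · ω) := by
  simp_rw [polyDeriv, poly_eq_ser]
  exact (hasDerivAt_ser (Real.sqrt_nonneg _) (coeffBound_binCoeff n) hω x).deriv

end Functions

section RandomFunctions

variable {Ω : Type*} [MeasurableSpace Ω] {P : Measure Ω} [IsProbabilityMeasure P]
  {c : ℕ → Ω → ℝ} {r : ℝ → ℝ} {M : ℝ}

lemma isZeroDensity_poly (h : IsIidStd P c r) (hM : ∀ t, r t ≤ M) {n : ℕ} (hn : n ≠ 0) :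
    IsZeroDensity P (poly c n) (polyDeriv c n) (zeroDensity P c r (binCoeff n)) := by
  have h1 : binCoeff n 1 ≠ 0 := by
    rw [binCoeff, Nat.choose_one_right]
    exact (Real.sqrt_pos.2 (by positivity)).ne'
  refine h.isZeroDensity hM (Real.sqrt_nonneg _) (coeffBound_binCoeff n) (binCoeff_zero n) h1
    (e := fun _ => 1) (e' := fun _ => 0) (fun _ => one_pos) ?_ ?_
  · exact ae_of_all _ fun ω x => by rw [poly_eq_ser, one_mul]
  · filter_upwards [h.ae_tame] with ω hω x
    rw [polyDeriv_eq_serDeriv n x hω, one_mul, zero_mul, zero_add]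

lemma isZeroDensity_limitG (h : IsIidStd P c r) (hM : ∀ t, r t ≤ M) :
    IsZeroDensity P (limitG c) (limitH c) (zeroDensity P c r limCoeff) := by
  refine h.isZeroDensity hM zero_le_one coeffBound_limCoeff (by simp [limCoeff])
    (by simp [limCoeff]) (e := fun y => Real.exp (-y ^ 2 / 2))
    (e' := fun y => -y * Real.exp (-y ^ 2 / 2)) (fun _ => Real.exp_pos _) ?_ ?_
  · exact ae_of_all _ fun ω y => limitG_eq c y ω
  · filter_upwards [h.ae_tame] with ω hω y
    exact limitH_eq hω y

lemma zeroDensity_scaledCoeff (P : Measure Ω) (c : ℕ → Ω → ℝ) (r : ℝ → ℝ) {n : ℕ} (hn : n ≠ 0)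
    (y : ℝ) : zeroDensity P c r (scaledCoeff n) y =
      zeroDensity P c r (binCoeff n) (y / Real.sqrt n) / Real.sqrt n := by
  unfold zeroDensity
  rw [← integral_div]
  refine integral_congr_ae (ae_of_all _ fun ω => ?_)
  simp only
  rw [ser_scaledCoeff, serDeriv_scaledCoeff hn, abs_div, abs_of_nonneg (Real.sqrt_nonneg n)]
  ring

end RandomFunctions

section CharacteristicFunction

variable {Ω : Type*} [MeasurableSpace Ω] {P : Measure Ω} [IsProbabilityMeasure P]
  {c : ℕ → Ω → ℝ} {r : ℝ → ℝ}

lemma IsIidStd.deriv_charFun_zero (h : IsIidStd P c r) :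
    iteratedDeriv 1 (charFun (P.map (c 0))) 0 = 0 := by
  have := Measure.isProbabilityMeasure_map (μ := P) (h.meas 0).aemeasurable
  have hL : MemLp id 1 (P.map (c 0)) := by
    refine (memLp_map_measure_iff aestronglyMeasurable_id (h.meas 0).aemeasurable).2 ?_
    exact (h.memLp 0).mono_exponent one_le_two
  rw [iteratedDeriv_charFun_zero (by exact_mod_cast hL), integral_map (h.meas 0).aemeasurable
    (by fun_prop)]
  simp [h.mean 0]

lemma IsIidStd.exists_charDecay (h : IsIidStd P c r) {a A : ℝ} (ha : 0 < a) (hA : 0 < A)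
    (hdiff : ∀ j < 3, Differentiable ℝ (iteratedDeriv j (charFun (P.map (c 0)))))
    (hbound : ∀ j ≤ 3, ∀ s : ℝ,
      ‖iteratedDeriv j (charFun (P.map (c 0))) s‖ ≤ A / (1 + a * |s|) ^ 6) :
    ∃ φ₁ φ₂ κ C, CharDecay (charFun (P.map (c 0))) φ₁ φ₂ κ C := by
  have := Measure.isProbabilityMeasure_map (μ := P) (h.meas 0).aemeasurable
  refine ⟨iteratedDeriv 1 (charFun (P.map (c 0))), iteratedDeriv 2 (charFun (P.map (c 0))),
    RealZeros.exists_charDecay ha hA (fun s => ?_) (fun s => ?_) (by simp) h.deriv_charFun_zero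
    (one_sub_norm_charFun_two_mul_le _) (hbound 0 (by norm_num)) (hbound 1 (by norm_num))
    (hbound 2 (by norm_num))⟩
  · have := (hdiff 0 (by norm_num) s).hasDerivAt
    rwa [← iteratedDeriv_succ, iteratedDeriv_zero] at this
  · have := (hdiff 1 (by norm_num) s).hasDerivAt
    rwa [← iteratedDeriv_succ] at this

/-- Fourier inversion with an integrable characteristic function bounds the density. -/
lemma IsIidStd.exists_density_le (h : IsIidStd P c r)
    (hφ : Integrable (charFun (P.map (c 0)))) : ∃ M, ∀ t, r t ≤ M := by
  have := Measure.isProbabilityMeasure_map (μ := P) (h.meas 0).aemeasurable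
  refine ⟨‖(2 * Real.pi : ℂ)⁻¹‖ * ∫ s, ‖charFun (P.map (c 0)) s‖, fun t => ?_⟩
  have key := density_eq_integral_charFun h.cont h.nonneg (h.law 0) hφ t
  calc r t = ‖(r t : ℂ)‖ := by rw [Complex.norm_real, Real.norm_of_nonneg (h.nonneg t)]
    _ ≤ _ := by
      rw [key, norm_mul]
      refine mul_le_mul_of_nonneg_left ((norm_integral_le_integral_norm _).trans_eq ?_)
        (norm_nonneg _)
      refine integral_congr_ae (ae_of_all _ fun s => ?_)
      have : -((s : ℂ) * t * Complex.I) = ((-(s * t) : ℝ) : ℂ) * Complex.I := by push_cast; ring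
      simp only
      rw [norm_mul, this, Complex.norm_exp_ofReal_mul_I, one_mul]

end CharacteristicFunction

/-! ### The two asymptotic regimes and their combination -/

section Limits

variable {Ω : Type*} [MeasurableSpace Ω] {P : Measure Ω} [IsProbabilityMeasure P]
  {c : ℕ → Ω → ℝ} {r : ℝ → ℝ} {M : ℝ} {φ₁ φ₂ : ℝ → ℂ} {κ C : ℝ}

/-- In the Gaussian regime the normalized density of zeros is asymptotically constant. -/
theorem IsIidStd.tendsto_normalized_zeroDensity (h : IsIidStd P c r) (hM : ∀ t, r t ≤ M)
    (hφ : CharDecay (charFun (P.map (c 0))) φ₁ φ₂ κ C) :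
    Tendsto (fun q : ℕ × ℝ => (1 + q.2 ^ 2) / Real.sqrt q.1 *
        zeroDensity P c r (binCoeff q.1) q.2)
      (comap (fun q : ℕ × ℝ => binVar q.1 q.2) atTop) (𝓝 (1 / Real.pi)) := by
  -- This filter on pairs (n, x) only asks that the variance be large; a limit along it is
  -- automatically uniform in n and x.
  set l := comap (fun q : ℕ × ℝ => binVar q.1 q.2) atTop
  have hv : Tendsto (fun q : ℕ × ℝ => binVar q.1 q.2) l atTop := tendsto_comap
  have hev : ∀ᶠ q in l, 1 ≤ binVar q.1 q.2 ∧ q.1 ≠ 0 ∧ q.2 ≠ 0 := by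
    filter_upwards [hv.eventually_ge_atTop 1] with q hq
    refine ⟨hq, fun h0 => ?_, fun h0 => ?_⟩ <;> norm_num [binVar, h0] at hq
  have hT : (fun u : ℝ => charFun (P.map (c 0)) u - (1 - (u : ℂ) ^ 2 / 2)) =o[𝓝 0]
      fun u : ℝ => u ^ 2 :=
    taylor_charFun_two (h.meas 0).aemeasurable (h.mean 0) (h.var 0)
  have hlim := hφ.tendsto_kacRiceInt hT (l := l) (S := fun q => Finset.range (q.1 + 1))
    (a := fun q => valWeight q.1 q.2) (b := fun q => derivWeight q.1 q.2)
    (δ := fun q => weightBound (binVar q.1 q.2))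
    (hev.mono fun q hq => orthonormal_weights hq.2.1 hq.2.2) (tendsto_weightBound.comp hv)
    (hev.mono fun q hq i _ => abs_valWeight_le hq.1 i)
    (hev.mono fun q hq i _ => abs_derivWeight_le hq.2.1 hq.2.2 hq.1 i)
  have heq : ∀ᶠ q in l, kacRiceInt (charFun (P.map (c 0))) (Finset.range (q.1 + 1))
      (valWeight q.1 q.2) (derivWeight q.1 q.2) =
      ((2 * Real.pi * cosConst * ((1 + q.2 ^ 2) / Real.sqrt q.1 *
        zeroDensity P c r (binCoeff q.1) q.2) : ℝ) : ℂ) := by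
    filter_upwards [hev] with q hq
    obtain ⟨n, x⟩ := q
    have hn : 0 < Real.sqrt n := Real.sqrt_pos.2 (by have := hq.2.1; positivity)
    -- Here e = (1+x²)^{-n/2} normalizes the value to variance 1 and e' is its derivative; l
    -- normalizes the derivative.
    rw [← hφ.kacRiceInt_shear (a := valWeight n x) (b := derivWeight n x) (a' := fun k => binCoeff n k * x ^ k)
      (b' := fun k => binCoeff n k * (k * x ^ (k - 1)))
      (e := 1 / Real.sqrt ((1 + x ^ 2) ^ n))
      (e' := -(n * x / (1 + x ^ 2)) * (1 / Real.sqrt ((1 + x ^ 2) ^ n)))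
      (l := (1 + x ^ 2) / Real.sqrt n)
      (one_div_pos.2 (Real.sqrt_pos.2 (by positivity))) (by positivity) (fun i => rfl)
      (fun i => by unfold derivWeight; ring) (orthonormal_weights hq.2.1 hq.2.2)]
    have hz := h.zeroDensity_eq_kacRiceInt hφ hM (binCoeff_zero n)
      (fun k hk => binCoeff_of_lt hk) x
    have hpi : (2 * Real.pi : ℂ) ≠ 0 := by
      exact_mod_cast (by positivity : (2 * Real.pi : ℝ) ≠ 0)
    rw [eq_inv_mul_iff_mul_eq₀ hpi] at hz
    rw [← hz]
    push_cast
    ring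
  have h2 := (Complex.continuous_re.tendsto _).comp (hlim.congr' heq)
  have hK := cosConst_pos
  have h3 := h2.div_const (2 * Real.pi * cosConst)
  simp only [Function.comp_def, Complex.ofReal_re] at h3
  convert! h3 using 1
  · ext q
    field_simp
  · congr 1
    field_simp

lemma IsIidStd.exists_normalized_zeroDensity_sub_lt (h : IsIidStd P c r) (hM : ∀ t, r t ≤ M)
    (hφ : CharDecay (charFun (P.map (c 0))) φ₁ φ₂ κ C) {ε : ℝ} (hε : 0 < ε) :
    ∃ V, ∀ (n : ℕ) (x : ℝ), V ≤ binVar n x → |(1 + x ^ 2) / Real.sqrt n *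
      zeroDensity P c r (binCoeff n) x - 1 / Real.pi| < ε := by
  have := Metric.tendsto_nhds.1 (h.tendsto_normalized_zeroDensity hM hφ) ε hε
  obtain ⟨V, hV⟩ := eventually_atTop.1 (eventually_comap.1 this)
  exact ⟨V, fun n x hx => hV _ hx (n, x) rfl⟩

lemma IsIidStd.tendstoUniformlyOn_zeroDensity (h : IsIidStd P c r) (hM : ∀ t, r t ≤ M)
    {K : Set ℝ} (hK : IsCompact K) :
    TendstoUniformlyOn (fun n => zeroDensity P c r (scaledCoeff n)) (zeroDensity P c r limCoeff)
      atTop K := by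
  rw [← tendstoLocallyUniformlyOn_iff_tendstoUniformlyOn_of_compact hK,
    tendstoLocallyUniformlyOn_iff_forall_tendsto]
  intro y _
  have hy : Tendsto (fun q : ℕ × ℝ => q.2) (atTop ×ˢ 𝓝[K] y) (𝓝 y) :=
    tendsto_snd.mono_right nhdsWithin_le_nhds
  have h1 := ((h.continuous_zeroDensity hM zero_le_one coeffBound_limCoeff).tendsto y).comp hy
  have h2 := h.tendsto_zeroDensity hM zero_le_one (l := atTop ×ˢ 𝓝[K] y)
    (αs := fun q => scaledCoeff q.1) (fun q => coeffBound_scaledCoeff q.1)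
    (fun k => (tendsto_scaledCoeff k).comp tendsto_fst) hy
  exact (h1.prodMk_nhds h2).mono_right (nhds_le_uniformity _)

lemma binVar_div_sqrt {n : ℕ} (hn : n ≠ 0) (y : ℝ) :
    binVar n (y / Real.sqrt n) = y ^ 2 / (1 + y ^ 2 / n) ^ 2 := by
  unfold binVar
  rw [div_pow, Real.sq_sqrt (Nat.cast_nonneg n)]
  field_simp

/-- With y fixed and x = y/√n, the variance tends to y² as n → ∞. The strict inequality V < y² thus
puts these points in the Gaussian regime, and the estimate passes to the limit. -/
lemma IsIidStd.abs_zeroDensity_limCoeff_sub_le (h : IsIidStd P c r) (hM : ∀ t, r t ≤ M)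
    {V ε : ℝ} (hV : ∀ (n : ℕ) (x : ℝ), V ≤ binVar n x → |(1 + x ^ 2) / Real.sqrt n *
      zeroDensity P c r (binCoeff n) x - 1 / Real.pi| < ε) {y : ℝ} (hy : V < y ^ 2) :
    |zeroDensity P c r limCoeff y - 1 / Real.pi| ≤ ε := by
  have h0 : Tendsto (fun n : ℕ => 1 + y ^ 2 / (n : ℝ)) atTop (𝓝 1) := by
    simpa using (tendsto_const_div_atTop_nhds_zero_nat (y ^ 2)).const_add 1
  have h1 : Tendsto (fun n : ℕ => y ^ 2 / (1 + y ^ 2 / (n : ℝ)) ^ 2) atTop (𝓝 (y ^ 2)) := by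
    simpa [Pi.div_def] using (tendsto_const_nhds (x := y ^ 2)).div (h0.pow 2) (by norm_num)
  have h2 : Tendsto (fun n : ℕ => (1 + y ^ 2 / (n : ℝ)) * zeroDensity P c r (scaledCoeff n) y)
      atTop (𝓝 (zeroDensity P c r limCoeff y)) := by
    simpa using h0.mul (h.tendsto_zeroDensity hM zero_le_one coeffBound_scaledCoeff
      tendsto_scaledCoeff (tendsto_const_nhds (x := y)))
  refine le_of_tendsto (h2.sub_const _).abs ?_
  filter_upwards [h1.eventually (lt_mem_nhds hy), eventually_ne_atTop 0] with n hn hn0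
  rw [← binVar_div_sqrt hn0] at hn
  have := hV n _ hn.le
  rw [div_pow, Real.sq_sqrt (Nat.cast_nonneg n)] at this
  rw [zeroDensity_scaledCoeff P c r hn0]
  convert! this.le using 3
  ring

/-- Convergence of the rescaled densities of zeros near the origin. -/
theorem IsIidStd.exists_forall_scaled_sub_lt (h : IsIidStd P c r) (hM : ∀ t, r t ≤ M)
    (hφ : CharDecay (charFun (P.map (c 0))) φ₁ φ₂ κ C) {ε : ℝ} (hε : 0 < ε) :
    ∃ N : ℕ, ∀ n ≥ N, ∀ y : ℝ, |y| ≤ (n : ℝ) ^ (1 / 8 : ℝ) →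
      |zeroDensity P c r (binCoeff n) (y / Real.sqrt n) / Real.sqrt n -
        zeroDensity P c r limCoeff y| < ε := by
  have hε' : 0 < min (ε / 4) 1 := lt_min (by positivity) one_pos
  obtain ⟨V, hV⟩ := h.exists_normalized_zeroDensity_sub_lt hM hφ hε'
  -- Beyond Y one has y²/4 > V. The divisor 4 covers (1 + y²/n)² ≤ 4, so the variance at y/√n
  -- exceeds V as well.
  set Y : ℝ := 2 * (|V| + 1)
  have hY : ∀ y : ℝ, Y ≤ |y| → V < y ^ 2 / 4 := by
    intro y hy
    rw [← sq_abs y]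
    have : V ≤ |V| := le_abs_self V
    nlinarith [abs_nonneg V]
  have hunif := Metric.tendstoUniformlyOn_iff.1
    (h.tendstoUniformlyOn_zeroDensity hM (isCompact_Icc (a := -Y) (b := Y))) ε hε
  -- For |y| ≤ n^{1/8} the excess y²/n of the factor 1 + y²/n is at most n^{-3/4}. The rescaled
  -- density is at most 2, so replacing this factor by 1 costs at most ε/4.
  have hsmall : ∀ᶠ n : ℕ in atTop, (n : ℝ) ^ (-(3 / 4) : ℝ) < min (ε / 8) 1 :=
    ((tendsto_rpow_neg_atTop (by norm_num : (0 : ℝ) < 3 / 4)).comp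
      tendsto_natCast_atTop_atTop).eventually (gt_mem_nhds (lt_min (by positivity) one_pos))
  refine eventually_atTop.1 ?_
  filter_upwards [hunif, hsmall, eventually_ne_atTop 0] with n h1 h2 hn y hy
  rw [← zeroDensity_scaledCoeff P c r hn]
  rcases le_total |y| Y with hyY | hyY
  · have := h1 y (abs_le.1 hyY)
    rwa [dist_comm, Real.dist_eq] at this
  have hn0 : (0 : ℝ) < n := by positivity
  have hx : y ^ 2 / n ≤ (n : ℝ) ^ (-(3 / 4) : ℝ) := by
    rw [div_le_iff₀ hn0]
    calc y ^ 2 = |y| ^ 2 := (sq_abs y).symm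
      _ ≤ ((n : ℝ) ^ (1 / 8 : ℝ)) ^ 2 := by gcongr
      _ = (n : ℝ) ^ (1 / 4 : ℝ) := by
        rw [← Real.rpow_natCast, ← Real.rpow_mul hn0.le]; norm_num
      _ = (n : ℝ) ^ (-(3 / 4) : ℝ) * n := by
        nth_rewrite 3 [← Real.rpow_one (n : ℝ)]
        rw [← Real.rpow_add hn0]; norm_num
  obtain ⟨hx1, hx2⟩ := lt_min_iff.1 (hx.trans_lt h2)
  have hx0 : 0 ≤ y ^ 2 / n := by positivity
  have hbin : V ≤ binVar n (y / Real.sqrt n) := by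
    rw [binVar_div_sqrt hn]
    refine (hY y hyY).le.trans (div_le_div_of_nonneg_left (sq_nonneg y) (by positivity) ?_)
    nlinarith
  have h3 := hV n _ hbin
  have h4 := h.abs_zeroDensity_limCoeff_sub_le hM hV
    ((hY y hyY).trans_le (by linarith [sq_nonneg y] : y ^ 2 / 4 ≤ y ^ 2))
  rw [div_pow, Real.sq_sqrt hn0.le, div_mul_eq_mul_div, mul_div_assoc,
    ← zeroDensity_scaledCoeff P c r hn] at h3
  set s := zeroDensity P c r (scaledCoeff n) y
  have hs : 0 ≤ s := h.zeroDensity_nonneg y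
  have hpi : 1 / Real.pi ≤ 1 := by
    rw [div_le_one Real.pi_pos]; linarith [Real.pi_gt_three]
  have hm1 := min_le_left (ε / 4) 1
  have hm2 := min_le_right (ε / 4) 1
  rw [abs_lt] at h3 ⊢
  rw [abs_le] at h4
  have hs2 : s ≤ 2 := by nlinarith
  constructor <;> nlinarith

/-- Convergence of the densities of zeros away from the origin. -/
theorem IsIidStd.exists_forall_sub_cauchy_lt (h : IsIidStd P c r) (hM : ∀ t, r t ≤ M)
    (hφ : CharDecay (charFun (P.map (c 0))) φ₁ φ₂ κ C) {ε : ℝ} (hε : 0 < ε) :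
    ∃ N : ℕ, ∀ n ≥ N, ∀ x : ℝ, (n : ℝ) ^ (-(3 / 8) : ℝ) ≤ |x| → |x| ≤ 1 →
      |zeroDensity P c r (binCoeff n) x / Real.sqrt n - 1 / (Real.pi * (1 + x ^ 2))| < ε := by
  obtain ⟨V, hV⟩ := h.exists_normalized_zeroDensity_sub_lt hM hφ hε
  -- On this range n x² ≥ n^{1/4} and (1+x²)² ≤ 4, so the variance is at least n^{1/4}/4.
  have hlarge : ∀ᶠ n : ℕ in atTop, 4 * V ≤ (n : ℝ) ^ (1 / 4 : ℝ) :=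
    ((tendsto_rpow_atTop (by norm_num : (0 : ℝ) < 1 / 4)).comp
      tendsto_natCast_atTop_atTop).eventually_ge_atTop _
  refine eventually_atTop.1 ?_
  filter_upwards [hlarge, eventually_ne_atTop 0] with n h1 hn x hx hx1
  have hn0 : (0 : ℝ) < n := by positivity
  have hxx : x ^ 2 ≤ 1 := by rw [← sq_abs]; exact pow_le_one₀ (abs_nonneg x) hx1
  have hnx : (n : ℝ) ^ (1 / 4 : ℝ) ≤ n * x ^ 2 := by
    calc (n : ℝ) ^ (1 / 4 : ℝ) = n * ((n : ℝ) ^ (-(3 / 8) : ℝ)) ^ 2 := by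
          nth_rewrite 2 [← Real.rpow_one (n : ℝ)]
          rw [← Real.rpow_natCast, ← Real.rpow_mul hn0.le, ← Real.rpow_add hn0]; norm_num
      _ ≤ n * |x| ^ 2 := by gcongr
      _ = n * x ^ 2 := by rw [sq_abs]
  have hbin : V ≤ binVar n x := by
    unfold binVar
    rw [le_div_iff₀ (by positivity)]
    rcases le_total V 0 with hV0 | hV0
    · exact (mul_nonpos_of_nonpos_of_nonneg hV0 (by positivity)).trans (by positivity)
    · have : (1 + x ^ 2) ^ 2 ≤ 4 := by nlinarith [sq_nonneg x]
      nlinarith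
  have h3 := hV n x hbin
  have hq : 0 < 1 + x ^ 2 := by positivity
  have e : zeroDensity P c r (binCoeff n) x / Real.sqrt n - 1 / (Real.pi * (1 + x ^ 2)) =
      ((1 + x ^ 2) / Real.sqrt n * zeroDensity P c r (binCoeff n) x - 1 / Real.pi) /
        (1 + x ^ 2) := by
    have := Real.sqrt_pos.2 hn0
    field_simp
  rw [e, abs_div, abs_of_pos hq, div_lt_iff₀ hq]
  nlinarith [sq_nonneg x]

end Limits

end

end RealZeros

theorem theorem5p2 {Ω : Type*} [MeasurableSpace Ω] (P : Measure Ω) [IsProbabilityMeasure P]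
    (c : ℕ → Ω → ℝ) (hc_meas : ∀ k, Measurable (c k)) (hc_indep : iIndepFun c P)
    (r : ℝ → ℝ) (hr_cont : Continuous r) (hr_nonneg : ∀ t, 0 ≤ r t)
    (hc_law : ∀ k, P.map (c k) = volume.withDensity (fun t => ENNReal.ofReal (r t)))
    (hc_mean : ∀ k, ∫ ω, c k ω ∂P = 0) (hc_var : ∀ k, ∫ ω, (c k ω) ^ 2 ∂P = 1)
    (a A : ℝ) (ha : 0 < a) (hA : 0 < A)
    (hφ_diff : ∀ j < 3, Differentiable ℝ (iteratedDeriv j (charFun (P.map (c 0)))))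
    (hφ_bound : ∀ j ≤ 3, ∀ s : ℝ,
      ‖iteratedDeriv j (charFun (P.map (c 0))) s‖ ≤ A / (1 + a * |s|) ^ 6) :
    (∀ᵐ ω ∂P, ∀ y : ℝ, Summable (fun k => RealZeros.mWeight k y * c k ω) ∧
      Summable (fun k => RealZeros.lWeight k y * c k ω) ∧
      HasDerivAt (fun t => RealZeros.limitG c t ω) (RealZeros.limitH c y ω) y) ∧
    ∃ (p : ℕ → ℝ → ℝ) (phat : ℝ → ℝ),
      (∀ n, 1 ≤ n →
        RealZeros.IsZeroDensity P (RealZeros.poly c n) (RealZeros.polyDeriv c n) (p n)) ∧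
      RealZeros.IsZeroDensity P (RealZeros.limitG c) (RealZeros.limitH c) phat ∧
      (∀ ε : ℝ, 0 < ε → ∃ N : ℕ, ∀ n ≥ N, ∀ y : ℝ, |y| ≤ (n : ℝ) ^ (1 / 8 : ℝ) →
        |p n (y / Real.sqrt n) / Real.sqrt n - phat y| < ε) ∧
      (∀ ε : ℝ, 0 < ε → ∃ N : ℕ, ∀ n ≥ N, ∀ x : ℝ, (n : ℝ) ^ (-(3 / 8) : ℝ) ≤ |x| → |x| ≤ 1 →
        |p n x / Real.sqrt n - 1 / (Real.pi * (1 + x ^ 2))| < ε) := by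
  have h : RealZeros.IsIidStd P c r :=
    ⟨hc_meas, hc_indep, hr_cont, hr_nonneg, hc_law, hc_mean, hc_var⟩
  obtain ⟨φ₁, φ₂, κ, C, hφ⟩ := h.exists_charDecay ha hA hφ_diff hφ_bound
  obtain ⟨M, hM⟩ := h.exists_density_le hφ.integrable
  refine ⟨?_, fun n => RealZeros.zeroDensity P c r (RealZeros.binCoeff n),
    RealZeros.zeroDensity P c r RealZeros.limCoeff,
    fun n hn => RealZeros.isZeroDensity_poly h hM (Nat.one_le_iff_ne_zero.1 hn),
    RealZeros.isZeroDensity_limitG h hM,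
    fun ε hε => h.exists_forall_scaled_sub_lt hM hφ hε,
    fun ε hε => h.exists_forall_sub_cauchy_lt hM hφ hε⟩
  filter_upwards [h.ae_tame] with ω hω y
  exact ⟨RealZeros.summable_mWeight hω y, RealZeros.summable_lWeight hω y,
    RealZeros.hasDerivAt_limitG hω y⟩
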